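/- Let $n\ge 4$ and let $X_1,\dots,X_n$ be independent real random variables with a common distribution function $F$, which is assumed continuous. Let $F_n(x)=n^{-1}\sum_{i=1}^n I(X_i\le x)$ be the empirical distribution function. Let $J:[0,1]\to\mathbb R$ satisfy, for a constant $c_0$, $$|J(t)-J(s)|\le c_0|t-s|\qquad\text{for all } 0\le s,t\le 1 .$$ For a distribution function $G$ put $T(G)=\int_{-\infty}^{\infty}xJ(G(x))\,dG(x)$, and let $$\sigma^2=\int_{-\infty}^{\infty}\int_{-\infty}^{\infty}J(F(s))J(F(t))F(\min(s,t))\bigl(1-F(\max(s,t))\bigr)\,ds\,dt ,\qquad g(x)=\int_{-\infty}^{\infty}\bigl(I(x\le s)-F(s)\bigr)J(F(s))\,ds ,$$ where $\sigma\ge 0$. Write $\|X_1\|_2=(\mathbb E X_1^2)^{1/2}$ and let $\Phi$ be the standard normal distribution function. Assume that $\mathbb E X_1^2<\infty$, that $\mathbb E|g(X_1)|^p<\infty$ for some $2<p\le 3$, and that $\sigma>0$. Then $$\sup_{z\in\mathbb R}\left|P\bigl(\sqrt n\,\sigma^{-1}(T(F_n)-T(F))\le z\bigr)-\Phi(z)\right|\le\frac{(1+\sqrt2)\,c_0\|X_1\|_2}{\sqrt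 n\,\sigma}+\frac{6.1\,\mathbb E|g(X_1)|^p}{n^{(p-2)/2}\sigma^p},$$ and, for every $z\in\mathbb R$, $$\left|P\bigl(\sqrt n\,\sigma^{-1}(T(F_n)-T(F))\le z\bigr)-\Phi(z)\right|\le\frac{9c_0^2\,\mathbb E X_1^2}{(1+|z|)^2n\sigma^2}+\frac{C}{(1+|z|)^p}\left(\frac{c_0\|X_1\|_2}{\sqrt n\,\sigma}+\frac{\mathbb E|g(X_1)|^p}{n^{(p-2)/2}\sigma^p}\right),$$ where $C$ is an absolute constant (independent of $n$, $p$, $z$, $J$, $c_0$ and the distribution of the $X_i$). -/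

import Mathlib

open MeasureTheory ProbabilityTheory Set

noncomputable section

namespace LStat

/-- The empirical distribution function `F_n(t) = n⁻¹ ∑ᵢ I(xᵢ ≤ t)` of a sample `x₁, …, xₙ`. -/
def empiricalCDF {n : ℕ} (x : Fin n → ℝ) : StieltjesFunction ℝ where
  toFun t := (n : ℝ)⁻¹ * ∑ i, (Ici (x i)).indicator (fun _ => (1 : ℝ)) t
  mono' := by
    intro s t hst
    refine mul_le_mul_of_nonneg_left (Finset.sum_le_sum fun i _ => ?_) (by positivity)
    by_cases h : x i ≤ s
    · simp [indicator, h, h.trans hst]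
    · simp only [indicator, mem_Ici, h, if_false]
      split_ifs <;> norm_num
  right_continuous' := by
    intro t
    refine continuousWithinAt_const.mul ?_
    refine tendsto_finsetSum _ fun i _ => ?_
    by_cases h : x i ≤ t
    · refine tendsto_const_nhds.congr' ?_
      filter_upwards [self_mem_nhdsWithin] with s hs
      have h1 : x i ≤ s := h.trans hs
      simp [indicator, h, h1]
    · refine tendsto_const_nhds.congr' ?_
      filter_upwards [mem_nhdsWithin_of_mem_nhds (Iio_mem_nhds (not_le.1 h))] with s hs
      have h1 : ¬ x i ≤ s := not_le.2 hs
      simp [indicator, h, h1]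

/-- The functional `T(G) = ∫ x J(G(x)) dG(x)` (a Lebesgue–Stieltjes integral). -/
def T (J : ℝ → ℝ) (G : StieltjesFunction ℝ) : ℝ :=
  ∫ x, x * J (G x) ∂G.measure

/-- `σ² = ∫∫ J(F(s)) J(F(t)) F(min(s,t)) (1 - F(max(s,t))) ds dt`. -/
def sigmaSq (J : ℝ → ℝ) (F : StieltjesFunction ℝ) : ℝ :=
  ∫ s : ℝ, ∫ t : ℝ, J (F s) * J (F t) * F (min s t) * (1 - F (max s t))

/-- `σ`, the nonnegative square root of `σ²`. -/
def sigma (J : ℝ → ℝ) (F : StieltjesFunction ℝ) : ℝ :=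
  Real.sqrt (sigmaSq J F)

/-- `g(x) = ∫ (I(x ≤ s) - F(s)) J(F(s)) ds`. -/
def g (J : ℝ → ℝ) (F : StieltjesFunction ℝ) (x : ℝ) : ℝ :=
  ∫ s : ℝ, ((Ici x).indicator (fun _ => (1 : ℝ)) s - F s) * J (F s)

/-- The standard normal distribution function. -/
def Phi (z : ℝ) : ℝ := cdf (gaussianReal 0 1) z

/-- The probability `P(√n σ⁻¹ (T(F_n) - T(F)) ≤ z)`, where `F_n` is the empirical distribution
function of the sample `X₁, …, Xₙ`. -/
def standardizedCDF {Ω : Type*} [MeasurableSpace Ω] (P : Measure Ω) {n : ℕ}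
    (X : Fin n → Ω → ℝ) (J : ℝ → ℝ) (F : StieltjesFunction ℝ) (z : ℝ) : ℝ :=
  P.real {ω | Real.sqrt n * (sigma J F)⁻¹ *
    (T J (empiricalCDF fun i => X i ω) - T J F) ≤ z}

end LStat

end

open Filter Topology
set_option linter.unusedSectionVars false

/-! Almost surely `√n σ⁻¹ (T(F_n) - T(F)) = W + Δ`, where `W = ∑ φ(X_i)` is a normalized i.i.d. sum
with `φ = -g / (√n σ)` and `Δ` is a small nonlinear remainder. Both bounds are instances of
Berry–Esseen theorems for such perturbed sums, proved by Stein's method and concentration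
inequalities. Throughout, `L = ∑ E|φ(X_i)|^p` is the Lyapunov ratio and `η = c₀ ‖X₁‖₂ / (√n σ)`.

Linearization. Writing `x = ∫ (I(0 ≤ s) - I(x ≤ s)) ds` turns `T(F)` and `T(F_n)` into integrals
over `s`. Because `F` is continuous, `T(F)` involves the primitive of `J` at `F(s)`; in the absence
of ties, `T(F_n)` involves the Riemann sum of `J` up to `F_n(s)`. The difference consists of a
linear term, which integrates to `-n⁻¹ ∑ g(X_i)`, a second-order Taylor error and a Riemann-sum
error (`T_sub_eq`). The Riemann-sum error is extended off the grid `k/n` with Lipschitz constant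
`c₀/(2n)` (`exists_gridError`), so the remainder keeps its meaning when `I(X_i ≤ s)` is replaced by
`F(s)`; this yields approximations `Δ_i` that do not involve `X_i`. The covariance kernel of the
empirical process has total mass `Var X₁`, and a fourth-moment bound by the same kernel
(`integral_sum_dev_sq_mul_sq_le`) gives `‖Δ‖₂ ≤ η` and `‖Δ - Δ_i‖₂ ≤ √2 η / √n`.

Uniform bound. Adding `Δ` changes `P(W ≤ z)` by at most the probability that `W` lies within `|Δ|`
of `z` on one side. `randomized_concentration` tests `W` against a clamped linear function whose
endpoints are random; subtracting its versions with endpoints free of `X_i` leaves the costs `E|WΔ|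
≤ η` and `∑ E|φ(X_i)(Δ - Δ_i)| ≤ √2 η`, plus `1.5 L`. For `W` alone, Stein's identity compares
averages of the Stein derivative at a leave-one-out sum with two different insertions. Its
continuous part is Lipschitz and its jump is controlled by concentration, giving `4.3 L`. When `6.1
L ≥ 1` there is nothing to prove.

Nonuniform bound. For `z ≥ 64`, if `W` is near `z` then either some summand exceeds `z/64`, which
has probability `O(L z^(-p))`, or one half of the sum is large without large summands, which has
probability `O(z^(-8))` by an exponential moment bound. In the second case the other half is
independent of that event and still supplies concentration. Large values of `Δ` are removed by
Chebyshev's inequality at level `(1 + z)/3`, the source of `9 η²/(1 + z)²`. Bounded `z` follows from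
the uniform bound and negative `z` by reflection. -/

namespace LStat

/-! ### The normal law and its Mills ratio -/

/-- The Mills ratio of the standard normal law, as a Laplace transform. -/
noncomputable def mills (v : ℝ) : ℝ := ∫ s in Ioi (0 : ℝ), Real.exp (-(v * s) - s ^ 2 / 2)

/-- Minus the derivative of the Mills ratio. -/
noncomputable def millsQ (v : ℝ) : ℝ := ∫ s in Ioi (0 : ℝ), s * Real.exp (-(v * s) - s ^ 2 / 2)

lemma integrable_mills (v : ℝ) :
    Integrable (fun s : ℝ => Real.exp (-(v * s) - s ^ 2 / 2)) := by
  have h := (integrable_exp_neg_mul_sq (b := 1 / 2) (by norm_num)).comp_add_right v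
  refine (h.const_mul (Real.exp (v ^ 2 / 2))).congr (ae_of_all _ fun s => ?_)
  simp only [← Real.exp_add]
  congr 1; ring

lemma integrable_millsQ (v : ℝ) :
    Integrable (fun s : ℝ => s * Real.exp (-(v * s) - s ^ 2 / 2)) := by
  have h := (integrable_mul_exp_neg_mul_sq (b := 1 / 2) (by norm_num)).comp_add_right v
  have h2 := (h.const_mul (Real.exp (v ^ 2 / 2))).sub ((integrable_mills v).const_mul v)
  refine h2.congr (ae_of_all _ fun s => ?_)
  have : Real.exp (-(v * s) - s ^ 2 / 2)
      = Real.exp (v ^ 2 / 2) * Real.exp (-(1 / 2) * (s + v) ^ 2) := by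
    rw [← Real.exp_add]; congr 1; ring
  simp only [Pi.sub_apply, this]; ring

lemma mills_antitone : Antitone mills := fun v w h => by
  refine setIntegral_mono_on (integrable_mills w).integrableOn (integrable_mills v).integrableOn
    measurableSet_Ioi fun s hs => ?_
  have : v * s ≤ w * s := mul_le_mul_of_nonneg_right h (le_of_lt hs)
  exact Real.exp_le_exp.2 (by linarith)

lemma millsQ_antitone : Antitone millsQ := fun v w h => by
  refine setIntegral_mono_on (integrable_millsQ w).integrableOn (integrable_millsQ v).integrableOn
    measurableSet_Ioi fun s hs => ?_
  have : v * s ≤ w * s := mul_le_mul_of_nonneg_right h (le_of_lt hs)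
  exact mul_le_mul_of_nonneg_left (Real.exp_le_exp.2 (by linarith)) (le_of_lt hs)

lemma mills_nonneg (v : ℝ) : 0 ≤ mills v := integral_nonneg fun _ => (Real.exp_pos _).le

lemma millsQ_nonneg (v : ℝ) : 0 ≤ millsQ v :=
  setIntegral_nonneg measurableSet_Ioi fun _ hs => mul_nonneg (le_of_lt hs) (Real.exp_pos _).le

/-- The integrand `(v + s) exp(-vs - s²/2)` is an exact derivative of total mass one. The identity
expresses `w f(w)` and `f'(w)` through `millsQ`, whose sign and monotonicity are visible from its
Laplace form. -/
lemma mul_mills (v : ℝ) : v * mills v = 1 - millsQ v := by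
  have hd : ∀ s ∈ Ici (0 : ℝ), HasDerivAt (fun s => -Real.exp (-(v * s) - s ^ 2 / 2))
      (v * Real.exp (-(v * s) - s ^ 2 / 2) + s * Real.exp (-(v * s) - s ^ 2 / 2)) s := by
    intro s _
    have h1 : HasDerivAt (fun s : ℝ => -(v * s) - s ^ 2 / 2) (-v - s) s := by
      have := ((hasDerivAt_id s).const_mul v).neg.sub (((hasDerivAt_id s).pow 2).div_const 2)
      convert! this using 1
      simp
    convert! h1.exp.neg using 1; ring
  have hi : Integrable (fun s : ℝ => v * Real.exp (-(v * s) - s ^ 2 / 2)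
      + s * Real.exp (-(v * s) - s ^ 2 / 2)) :=
    ((integrable_mills v).const_mul v).add (integrable_millsQ v)
  have hlim : Tendsto (fun s : ℝ => -Real.exp (-(v * s) - s ^ 2 / 2)) atTop (𝓝 0) := by
    rw [← neg_zero]
    refine Tendsto.neg (Real.tendsto_exp_atBot.comp ?_)
    have h1 : Tendsto (fun s : ℝ => s * (v + s / 2)) atTop atTop :=
      tendsto_id.atTop_mul_atTop₀
        (tendsto_atTop_add_const_left _ _ (tendsto_id.atTop_div_const (by norm_num)))
    refine (tendsto_neg_atTop_atBot.comp h1).congr fun s => ?_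
    simp only [Function.comp]; ring
  have := integral_Ioi_of_hasDerivAt_of_tendsto' hd hi.integrableOn hlim
  rw [integral_add ((integrable_mills v).const_mul v).integrableOn
    (integrable_millsQ v).integrableOn, integral_const_mul] at this
  simp at this
  rw [mills, millsQ]; linarith

lemma mills_zero_sq : mills 0 ^ 2 = Real.pi / 2 := by
  have h := integral_gaussian_Ioi (1 / 2)
  have h2 : mills 0 = √(Real.pi / (1 / 2)) / 2 := by
    rw [← h, mills]; congr 1; ext s; congr 1; ring
  rw [h2, div_pow, Real.sq_sqrt (by positivity)]; ring

lemma mills_zero_le : mills 0 ≤ 1.26 := by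
  have := mills_zero_sq
  have := Real.pi_lt_d2
  nlinarith [mills_nonneg 0]

lemma Phi_eq (z : ℝ) : Phi z = ∫ x in Iic z, (√(2 * Real.pi))⁻¹ * Real.exp (-x ^ 2 / 2) := by
  rw [Phi, cdf_eq_real, Measure.real, gaussianReal_apply_eq_integral _ one_ne_zero,
    ENNReal.toReal_ofReal (setIntegral_nonneg measurableSet_Iic fun x _ =>
      gaussianPDFReal_nonneg _ _ _)]
  simp [gaussianPDFReal]

lemma Phi_nonneg (z : ℝ) : 0 ≤ Phi z := cdf_nonneg _ _
lemma Phi_le_one (z : ℝ) : Phi z ≤ 1 := cdf_le_one _ _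
lemma Phi_mono : Monotone Phi := monotone_cdf _

lemma integrable_pdf : Integrable fun x : ℝ => (√(2 * Real.pi))⁻¹ * Real.exp (-x ^ 2 / 2) := by
  refine ((integrable_exp_neg_mul_sq (b := 1 / 2) (by norm_num)).const_mul
    (√(2 * Real.pi))⁻¹).congr (ae_of_all _ fun s => ?_)
  show _ * Real.exp _ = _ * Real.exp _
  congr 2; ring

lemma one_sub_Phi (z : ℝ) :
    1 - Phi z = (√(2 * Real.pi))⁻¹ * Real.exp (-z ^ 2 / 2) * mills z := by
  have htot : ∫ x, (√(2 * Real.pi))⁻¹ * Real.exp (-x ^ 2 / 2) = 1 := by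
    have := integral_gaussianPDFReal_eq_one 0 (v := 1) one_ne_zero
    simpa [gaussianPDFReal] using this
  have h := intervalIntegral.integral_Iic_add_Ioi (b := z) (μ := volume)
    integrable_pdf.integrableOn integrable_pdf.integrableOn
  rw [htot, ← Phi_eq] at h
  have h2 : ∫ x in Ioi z, (√(2 * Real.pi))⁻¹ * Real.exp (-x ^ 2 / 2)
      = ∫ s in Ioi (0 : ℝ), (√(2 * Real.pi))⁻¹ * Real.exp (-(s + z) ^ 2 / 2) := by
    rw [← integral_indicator measurableSet_Ioi, ← integral_indicator measurableSet_Ioi,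
      ← integral_add_right_eq_self _ z]
    congr 1; ext s
    simp [indicator]
  have h3 : ∫ s in Ioi (0 : ℝ), (√(2 * Real.pi))⁻¹ * Real.exp (-(s + z) ^ 2 / 2)
      = (√(2 * Real.pi))⁻¹ * Real.exp (-z ^ 2 / 2) * mills z := by
    rw [mills, ← integral_const_mul]
    congr 1; ext s
    rw [mul_assoc, ← Real.exp_add]; congr 2; ring
  linarith

lemma Phi_neg (z : ℝ) : Phi (-z) = 1 - Phi z := by
  have h := integral_comp_neg_Iic (-z) (fun x => (√(2 * Real.pi))⁻¹ * Real.exp (-x ^ 2 / 2))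
  have h' := intervalIntegral.integral_Iic_add_Ioi (b := z) (μ := volume)
    integrable_pdf.integrableOn integrable_pdf.integrableOn
  have htot : ∫ x, (√(2 * Real.pi))⁻¹ * Real.exp (-x ^ 2 / 2) = 1 := by
    have := integral_gaussianPDFReal_eq_one 0 (v := 1) one_ne_zero
    simpa [gaussianPDFReal] using this
  simp only [neg_neg, even_two, Even.neg_pow] at h
  rw [htot, ← Phi_eq, ← h, ← Phi_eq] at h'
  linarith

lemma mills_eq (z : ℝ) : mills z = √(2 * Real.pi) * Real.exp (z ^ 2 / 2) * (1 - Phi z) := by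
  rw [one_sub_Phi]
  have h1 : √(2 * Real.pi) ≠ 0 := by positivity
  have h2 : Real.exp (z ^ 2 / 2) * Real.exp (-z ^ 2 / 2) = 1 := by
    rw [← Real.exp_add, ← Real.exp_zero]; congr 1; ring
  calc mills z = (√(2 * Real.pi) * (√(2 * Real.pi))⁻¹)
        * (Real.exp (z ^ 2 / 2) * Real.exp (-z ^ 2 / 2)) * mills z := by
        rw [h2, mul_inv_cancel₀ h1]; ring
    _ = _ := by ring

lemma hasDerivAt_Phi (z : ℝ) :
    HasDerivAt Phi ((√(2 * Real.pi))⁻¹ * Real.exp (-z ^ 2 / 2)) z := by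
  have hc : Continuous fun x : ℝ => (√(2 * Real.pi))⁻¹ * Real.exp (-x ^ 2 / 2) := by fun_prop
  have h : Phi = fun z => Phi 0 + ∫ x in (0 : ℝ)..z, (√(2 * Real.pi))⁻¹ * Real.exp (-x ^ 2 / 2) := by
    ext z
    rw [Phi_eq, Phi_eq, ← intervalIntegral.integral_Iic_sub_Iic
      integrable_pdf.integrableOn integrable_pdf.integrableOn]
    ring
  rw [h]
  exact (hc.integral_hasStrictDerivAt 0 z).hasDerivAt.const_add _

lemma continuous_Phi : Continuous Phi :=
  continuous_iff_continuousAt.2 fun z => (hasDerivAt_Phi z).continuousAt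

lemma hasDerivAt_mills (z : ℝ) : HasDerivAt mills (z * mills z - 1) z := by
  have h1 : HasDerivAt (fun z : ℝ => √(2 * Real.pi) * Real.exp (z ^ 2 / 2))
      (√(2 * Real.pi) * (Real.exp (z ^ 2 / 2) * z)) z := by
    have := (((hasDerivAt_id z).pow 2).div_const 2).exp.const_mul √(2 * Real.pi)
    convert! this using 1
    simp
  have h := h1.mul ((hasDerivAt_Phi z).const_sub 1)
  have h0 : mills = fun z => √(2 * Real.pi) * Real.exp (z ^ 2 / 2) * (1 - Phi z) :=
    funext mills_eq
  rw [h0]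
  convert! h using 1
  have h1 : √(2 * Real.pi) * (√(2 * Real.pi))⁻¹ = 1 := mul_inv_cancel₀ (by positivity)
  have h2 : Real.exp (z ^ 2 / 2) * Real.exp (-z ^ 2 / 2) = 1 := by
    rw [← Real.exp_add, ← Real.exp_zero]; congr 1; ring
  have h3 : √(2 * Real.pi) * Real.exp (z ^ 2 / 2) * -((√(2 * Real.pi))⁻¹ * Real.exp (-z ^ 2 / 2))
      = -1 := by
    calc _ = -((√(2 * Real.pi) * (√(2 * Real.pi))⁻¹)
        * (Real.exp (z ^ 2 / 2) * Real.exp (-z ^ 2 / 2))) := by ring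
      _ = -1 := by rw [h1, h2]; ring
  rw [h3]; ring

/-- The mills ratio at `-z` and at `z` are related through `Φ`. -/
lemma mills_neg_mul (z : ℝ) : (1 - Phi z) * mills (-z) = Phi z * mills z := by
  rw [mills_eq, mills_eq z, Phi_neg]; simp; ring

/-! ### Stein's equation for half-lines -/

/-- The solution of Stein's equation for the indicator of `(-∞, z]`. -/
noncomputable def stein (z w : ℝ) : ℝ :=
  if w ≤ z then (1 - Phi z) * mills (-w) else Phi z * mills w

/-- The derivative of the solution of Stein's equation. -/
noncomputable def steinD (z w : ℝ) : ℝ :=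
  w * stein z w + (if w ≤ z then 1 else 0) - Phi z

lemma continuous_mills : Continuous mills :=
  continuous_iff_continuousAt.2 fun z => (hasDerivAt_mills z).continuousAt

lemma continuous_stein (z : ℝ) : Continuous (stein z) := by
  unfold stein
  refine Continuous.if_le ?_ ?_ continuous_id continuous_const ?_
  · exact continuous_const.mul (continuous_mills.comp continuous_neg)
  · exact continuous_const.mul continuous_mills
  · intro x hx
    rw [hx, mills_neg_mul]

lemma measurable_steinD (z : ℝ) : Measurable (steinD z) := by
  unfold steinD
  have h := (continuous_stein z).measurable
  have h2 : Measurable fun w : ℝ => if w ≤ z then (1 : ℝ) else 0 :=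
    Measurable.ite measurableSet_Iic measurable_const measurable_const
  fun_prop

lemma stein_nonneg (z w : ℝ) : 0 ≤ stein z w := by
  unfold stein
  split_ifs
  · exact mul_nonneg (by linarith [Phi_le_one z]) (mills_nonneg _)
  · exact mul_nonneg (Phi_nonneg z) (mills_nonneg _)

/-- Each branch is monotone towards `z`, so the solution peaks at `w = z`, where both branches agree
by `mills_neg_mul`. -/
lemma stein_le (z w : ℝ) : stein z w ≤ Phi z * mills z := by
  have h1 := Phi_le_one z
  unfold stein
  split_ifs with h
  · rw [← mills_neg_mul]
    exact mul_le_mul_of_nonneg_left (mills_antitone (by linarith)) (by linarith)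
  · exact mul_le_mul_of_nonneg_left (mills_antitone (by linarith)) (Phi_nonneg z)

/-- The peak value is at most `mills 0 = √(π/2) < 1.26`: directly for `z ≥ 0`, and through the
mirrored form of the same value for `z ≤ 0`. -/
lemma stein_le_const (z w : ℝ) : stein z w ≤ 1.26 := by
  have h1 := Phi_le_one z
  have h0 := Phi_nonneg z
  refine ((stein_le z w).trans ?_).trans mills_zero_le
  rcases le_total 0 z with hz | hz
  · nlinarith [mills_antitone hz, mills_nonneg 0, mills_nonneg z]
  · rw [← mills_neg_mul]
    nlinarith [mills_antitone (show 0 ≤ -z by linarith), mills_nonneg 0, mills_nonneg (-z)]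

lemma mul_mills_le_one (v : ℝ) : v * mills v ≤ 1 := by
  rw [mul_mills]; linarith [millsQ_nonneg v]

lemma stein_le_inv {z : ℝ} (hz : 0 < z) (w : ℝ) : stein z w ≤ 1 / z := by
  refine (stein_le z w).trans ?_
  rw [le_div_iff₀ hz]
  nlinarith [mul_mills_le_one z, mul_nonneg hz.le (mills_nonneg z), Phi_le_one z, Phi_nonneg z]

lemma steinD_of_le {z w : ℝ} (h : w ≤ z) : steinD z w = (1 - Phi z) * millsQ (-w) := by
  have := mul_mills (-w)
  simp only [steinD, stein, if_pos h]
  linear_combination -(1 - Phi z) * this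

lemma steinD_of_lt {z w : ℝ} (h : z < w) : steinD z w = -(Phi z * millsQ w) := by
  have := mul_mills w
  simp only [steinD, stein, if_neg (not_le.2 h)]
  linear_combination (Phi z) * this

/-- Expanding `millsQ (-w)` gives `(1 - Φ(w)) · 1 + Φ(w) · w mills(w)`, a convex combination of
numbers at most one. -/
lemma one_sub_Phi_mul_millsQ_le (w : ℝ) : (1 - Phi w) * millsQ (-w) ≤ 1 := by
  have h := mul_mills (-w)
  have h2 := mills_neg_mul w
  have h3 := mul_mills_le_one w
  have : (1 - Phi w) * millsQ (-w) = (1 - Phi w) + w * mills w * Phi w := by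
    have : millsQ (-w) = 1 + w * mills (-w) := by linarith
    rw [this]; linear_combination w * h2
  rw [this]
  nlinarith [Phi_nonneg w]

lemma abs_steinD_le (z w : ℝ) : |steinD z w| ≤ 1 := by
  rcases le_or_gt w z with h | h
  · rw [steinD_of_le h, abs_of_nonneg (mul_nonneg (by linarith [Phi_le_one z]) (millsQ_nonneg _))]
    refine le_trans ?_ (one_sub_Phi_mul_millsQ_le w)
    exact mul_le_mul_of_nonneg_right (by linarith [Phi_mono h]) (millsQ_nonneg _)
  · rw [steinD_of_lt h, abs_neg, abs_of_nonneg (mul_nonneg (Phi_nonneg z) (millsQ_nonneg _))]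
    have := one_sub_Phi_mul_millsQ_le (-w)
    rw [Phi_neg, neg_neg, sub_sub_cancel] at this
    exact le_trans (mul_le_mul_of_nonneg_right (Phi_mono h.le) (millsQ_nonneg _)) this

/-- Only the derivative jumps at `z`; the solution is continuous there, so the fundamental theorem
of calculus holds across the exceptional point. -/
lemma stein_sub (z a b : ℝ) : stein z b - stein z a = ∫ w in a..b, steinD z w := by
  have hint : IntervalIntegrable (steinD z) volume a b := by
    refine (intervalIntegrable_const (c := (1 : ℝ))).mono_fun
      (measurable_steinD z).aestronglyMeasurable (ae_of_all _ fun w => ?_)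
    simpa using abs_steinD_le z w
  refine (integral_eq_of_hasDerivAt_off_countable (stein z) (steinD z) (countable_singleton z)
    (continuous_stein z).continuousOn ?_ hint).symm
  rintro w ⟨-, hw⟩
  rcases lt_or_gt_of_ne (show w ≠ z from hw) with h | h
  · rw [steinD_of_le h.le]
    have : HasDerivAt (fun w => (1 - Phi z) * mills (-w)) ((1 - Phi z) * millsQ (-w)) w := by
      have h1 := ((hasDerivAt_mills (-w)).comp w (hasDerivAt_neg w)).const_mul (1 - Phi z)
      convert! h1 using 1
      rw [mul_mills]; ring
    refine this.congr_of_eventuallyEq ?_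
    filter_upwards [Iio_mem_nhds h] with x hx
    simp [stein, le_of_lt (mem_Iio.1 hx)]
  · rw [steinD_of_lt h]
    have : HasDerivAt (fun w => Phi z * mills w) (-(Phi z * millsQ w)) w := by
      convert! (hasDerivAt_mills w).const_mul (Phi z) using 1
      rw [mul_mills]; ring
    refine this.congr_of_eventuallyEq ?_
    filter_upwards [Ioi_mem_nhds h] with x hx
    simp [stein, not_le.2 (mem_Ioi.1 hx)]

lemma abs_stein_sub_le (z a b : ℝ) : |stein z b - stein z a| ≤ |b - a| := by
  rw [stein_sub]
  simpa using intervalIntegral.norm_integral_le_of_norm_le_const (a := a) (b := b) (C := 1)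
    (f := steinD z) fun w _ => abs_steinD_le z w

lemma mul_stein_of_le {z w : ℝ} (h : w ≤ z) :
    w * stein z w = (1 - Phi z) * (millsQ (-w) - 1) := by
  have := mul_mills (-w)
  simp only [stein, if_pos h]; linear_combination -(1 - Phi z) * this

lemma mul_stein_of_ge {z w : ℝ} (h : z ≤ w) : w * stein z w = Phi z * (1 - millsQ w) := by
  have := mul_mills w
  have h2 : stein z w = Phi z * mills w := by
    rcases h.eq_or_lt with rfl | h
    · simp [stein, mills_neg_mul]
    · simp [stein, not_le.2 h]
  rw [h2]; linear_combination (Phi z) * this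

/-- On either side of `z` the product is affine in a monotone `millsQ`, and the two pieces share the
point `z`. Monotonicity is the source of the one-sided estimates in `abs_meanD_sub_le`. -/
lemma mul_stein_mono (z : ℝ) : Monotone fun w => w * stein z w := by
  have h1 : MonotoneOn (fun w => w * stein z w) (Iic z) := fun a ha b hb hab => by
    simp only [mul_stein_of_le ha, mul_stein_of_le hb]
    exact mul_le_mul_of_nonneg_left (by linarith [millsQ_antitone (neg_le_neg hab)])
      (by linarith [Phi_le_one z])
  have h2 : MonotoneOn (fun w => w * stein z w) (Ici z) := fun a ha b hb hab => by
    simp only [mul_stein_of_ge ha, mul_stein_of_ge hb]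
    exact mul_le_mul_of_nonneg_left (by linarith [millsQ_antitone hab]) (Phi_nonneg z)
  exact h1.Iic_union_Ici h2

lemma mul_stein_le (z w : ℝ) : w * stein z w ≤ Phi z := by
  have h := mul_stein_mono z (le_max_left w z)
  refine h.trans ?_
  simp only [mul_stein_of_ge (le_max_right w z)]
  nlinarith [Phi_nonneg z, millsQ_nonneg (max w z)]

lemma le_mul_stein (z w : ℝ) : Phi z - 1 ≤ w * stein z w := by
  have h := mul_stein_mono z (min_le_left w z)
  refine le_trans ?_ h
  simp only [mul_stein_of_le (min_le_right w z)]
  nlinarith [Phi_le_one z, millsQ_nonneg (-min w z)]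

lemma abs_mul_stein_sub_le (z w u : ℝ) :
    |(w + u) * stein z (w + u) - w * stein z w| ≤ (|w| + 1.26) * |u| := by
  have h : (w + u) * stein z (w + u) - w * stein z w
      = w * (stein z (w + u) - stein z w) + u * stein z (w + u) := by ring
  have h1 := abs_stein_sub_le z w (w + u)
  rw [add_sub_cancel_left] at h1
  have h2 : |stein z (w + u)| ≤ 1.26 := by
    rw [abs_of_nonneg (stein_nonneg _ _)]; exact stein_le_const _ _
  rw [h]
  refine (abs_add_le _ _).trans ?_
  rw [abs_mul, abs_mul]
  nlinarith [abs_nonneg w, abs_nonneg u]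

/-- Far to the left of `z` the solution of Stein's equation and its derivative are negligible. -/
lemma exists_stein_left_bound : ∃ C : ℝ, 0 < C ∧ ∀ z : ℝ, 1 ≤ z → ∀ w ≤ z / 2,
    stein z w ≤ C * (z ^ 8)⁻¹ ∧ |steinD z w| ≤ C * (z ^ 8)⁻¹ := by
  -- For `w ≤ z/2` the factor `1 - Φ(z)`, of order `exp(-z²/2)`, beats the growth `exp(z²/8)` of
  -- `mills (-w)`. The ninth power is extracted from the exponential because `millsQ` costs one
  -- extra factor `z`; the constant is deliberately crude.
  refine ⟨3 * (16 ^ 9 * 40320) , by norm_num, fun z hz w hw => ?_⟩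
  have hwz : w ≤ z := by linarith
  have hs : 0 < √(2 * Real.pi) := by positivity
  have hs1 : √(2 * Real.pi) ≤ 2.6 := by
    rw [Real.sqrt_le_left (by norm_num)]; linarith [Real.pi_lt_d2]
  have hs2 : (1 : ℝ) ≤ √(2 * Real.pi) := by
    rw [Real.one_le_sqrt]; linarith [Real.pi_gt_three]
  have htail : 1 - Phi z ≤ 1.26 * Real.exp (-z ^ 2 / 2) := by
    rw [one_sub_Phi]
    have h1 : mills z ≤ 1.26 := (mills_antitone (by linarith)).trans mills_zero_le
    have h2 : (√(2 * Real.pi))⁻¹ ≤ 1 := inv_le_one_of_one_le₀ hs2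
    have h3 := Real.exp_pos (-z ^ 2 / 2)
    calc (√(2 * Real.pi))⁻¹ * Real.exp (-z ^ 2 / 2) * mills z
        ≤ 1 * Real.exp (-z ^ 2 / 2) * 1.26 := by gcongr; exact mills_nonneg z
      _ = _ := by ring
  have hM : mills (-w) ≤ 2.6 * Real.exp (z ^ 2 / 8) := by
    refine (mills_antitone (show -(z / 2) ≤ -w by linarith)).trans ?_
    rw [mills_eq]
    have : (-(z / 2)) ^ 2 / 2 = z ^ 2 / 8 := by ring
    rw [this]
    have h3 := Real.exp_pos (z ^ 2 / 8)
    have h4 := Phi_nonneg (-(z / 2))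
    nlinarith [mul_pos hs h3]
  have hQ : millsQ (-w) ≤ z * (2.6 * Real.exp (z ^ 2 / 8)) := by
    refine (millsQ_antitone (show -(z / 2) ≤ -w by linarith)).trans ?_
    have h5 := mul_mills (-(z / 2))
    have h6 : mills (-(z / 2)) ≤ 2.6 * Real.exp (z ^ 2 / 8) := by
      rw [mills_eq]
      have : (-(z / 2)) ^ 2 / 2 = z ^ 2 / 8 := by ring
      rw [this]
      have h3 := Real.exp_pos (z ^ 2 / 8)
      have h4 := Phi_nonneg (-(z / 2))
      nlinarith [mul_pos hs h3]
    have h7 : (1 : ℝ) ≤ Real.exp (z ^ 2 / 8) := Real.one_le_exp (by positivity)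
    nlinarith
  have he : Real.exp (-z ^ 2 / 2) * Real.exp (z ^ 2 / 8) ≤ (16 ^ 9 * 40320 / 2) * (z ^ 9)⁻¹ := by
    rw [← Real.exp_add]
    have h1 : z / 8 ≤ -(-z ^ 2 / 2 + z ^ 2 / 8) := by nlinarith
    have h2 := Real.pow_div_factorial_le_exp (z / 8) (by linarith) 9
    have h3 : Real.exp (-z ^ 2 / 2 + z ^ 2 / 8) * Real.exp (z / 8) ≤ 1 := by
      rw [← Real.exp_add, Real.exp_le_one_iff]; linarith
    have h4 : (0 : ℝ) < z ^ 9 := by positivity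
    rw [← div_eq_mul_inv, le_div_iff₀ h4]
    have h5 := Real.exp_pos (-z ^ 2 / 2 + z ^ 2 / 8)
    have h6 : (z / 8) ^ 9 / (Nat.factorial 9 : ℝ) = z ^ 9 / (8 ^ 9 * 362880) := by
      rw [show Nat.factorial 9 = 362880 from rfl, div_pow, div_div]; norm_num
    rw [h6, div_le_iff₀ (by norm_num)] at h2
    nlinarith
  have hp : 0 ≤ 1 - Phi z := by linarith [Phi_le_one z]
  have hz9 : (z ^ 9)⁻¹ * z = (z ^ 8)⁻¹ := by
    field_simp
  have hz8 : (0 : ℝ) < (z ^ 9)⁻¹ := by positivity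
  have hE : 0 < Real.exp (-z ^ 2 / 2) := Real.exp_pos _
  have key : (1 - Phi z) * (z * (2.6 * Real.exp (z ^ 2 / 8)))
      ≤ 3 * (16 ^ 9 * 40320) * (z ^ 8)⁻¹ := by
    calc (1 - Phi z) * (z * (2.6 * Real.exp (z ^ 2 / 8)))
        ≤ (1.26 * Real.exp (-z ^ 2 / 2)) * (z * (2.6 * Real.exp (z ^ 2 / 8))) := by gcongr
      _ = 3.276 * z * (Real.exp (-z ^ 2 / 2) * Real.exp (z ^ 2 / 8)) := by ring
      _ ≤ 3.276 * z * ((16 ^ 9 * 40320 / 2) * (z ^ 9)⁻¹) := by gcongr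
      _ = 1.638 * (16 ^ 9 * 40320) * ((z ^ 9)⁻¹ * z) := by ring
      _ ≤ _ := by rw [hz9]; gcongr; norm_num
  constructor
  · refine le_trans ?_ key
    simp only [stein, if_pos hwz]
    refine mul_le_mul_of_nonneg_left (hM.trans ?_) hp
    have := Real.exp_pos (z ^ 2 / 8)
    nlinarith
  · rw [steinD_of_le hwz, abs_of_nonneg (mul_nonneg hp (millsQ_nonneg _))]
    exact (mul_le_mul_of_nonneg_left hQ hp).trans key

/-! ### Disjoint blocks of coordinates of an i.i.d. sample -/

/-- The law of an i.i.d. sample indexed by `ι`. -/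
noncomputable abbrev iid (ι : Type*) [Fintype ι] (μ : Measure ℝ) : Measure (ι → ℝ) :=
  Measure.pi fun _ => μ

section Independence

variable {ι : Type*} [Fintype ι] {μ : Measure ℝ} [IsProbabilityMeasure μ]

/-- Coordinates outside `U` are filled with zero, which changes nothing for a function that ignores
them. Independence of coordinate blocks thereby passes to functions specified by `DependsOn`. -/
lemma exists_measurable_factor {δ : Type*} [MeasurableSpace δ] {H : (ι → ℝ) → δ} {U : Set ι}
    [Fintype U] (hH : Measurable H) (hU : DependsOn H U) :
    ∃ H' : (U.toFinset → ℝ) → δ, Measurable H' ∧ H = H' ∘ fun x (i : U.toFinset) => x i := by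
  classical
  refine ⟨fun r => H fun i => if h : i ∈ U.toFinset then r ⟨i, h⟩ else 0,
    hH.comp (measurable_pi_lambda _ fun i => ?_), funext fun x => hU fun i hi => ?_⟩
  · by_cases h : i ∈ U.toFinset
    · simpa only [h, dite_true] using measurable_pi_apply _
    · simpa only [h, dite_false] using measurable_const
  · simp [hi]

/-- Functions of disjoint blocks of an i.i.d. sample are independent. -/
lemma indepFun_of_dependsOn {β γ : Type*} [MeasurableSpace β] [MeasurableSpace γ]
    {F : (ι → ℝ) → β} {G : (ι → ℝ) → γ} (hF : Measurable F) (hG : Measurable G) {S T : Set ι}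
    (hFS : DependsOn F S) (hGT : DependsOn G T) (hST : Disjoint S T) :
    IndepFun F G (iid ι μ) := by
  classical
  have hi : iIndepFun (fun i (x : ι → ℝ) => x i) (iid ι μ) :=
    iIndepFun_pi (X := fun _ => id) fun _ => aemeasurable_id
  have h := hi.indepFun_finset S.toFinset T.toFinset (Set.disjoint_toFinset.2 hST)
    fun i => measurable_pi_apply i
  obtain ⟨F', hF', rfl⟩ := exists_measurable_factor hF hFS
  obtain ⟨G', hG', rfl⟩ := exists_measurable_factor hG hGT
  exact h.comp hF' hG'

lemma dependsOn_eval {β : Type*} (φ : ℝ → β) (i : ι) :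
    DependsOn (fun x : ι → ℝ => φ (x i)) {i} := fun x y h => by
  simp [h i rfl]

lemma dependsOn_sum (φ : ℝ → ℝ) (I : Finset ι) :
    DependsOn (fun x : ι → ℝ => ∑ i ∈ I, φ (x i)) (I : Set ι) := fun x y h =>
  Finset.sum_congr rfl fun i hi => by rw [h i hi]

lemma dependsOn_indicator {B : Set (ι → ℝ)} {S : Set ι} (h : DependsOn (fun x => x ∈ B) S) :
    DependsOn (B.indicator fun _ => (1 : ℝ)) S := fun x y hxy => by
  have := h hxy
  by_cases hx : x ∈ B
  · have hy : y ∈ B := by simpa [hx] using this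
    simp [hx, hy]
  · have hy : y ∉ B := by simpa [hx] using this
    simp [hx, hy]

/-- Expectations of products of functions of disjoint blocks factor. -/
lemma integral_mul_of_dependsOn {F G : (ι → ℝ) → ℝ} (hF : Measurable F) (hG : Measurable G)
    {S T : Set ι} (hFS : DependsOn F S) (hGT : DependsOn G T) (hST : Disjoint S T) :
    ∫ x, F x * G x ∂iid ι μ = (∫ x, F x ∂iid ι μ) * ∫ x, G x ∂iid ι μ :=
  (indepFun_of_dependsOn hF hG hFS hGT hST).integral_fun_mul_eq_mul_integral
    hF.aestronglyMeasurable hG.aestronglyMeasurable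

lemma integral_eval {φ : ℝ → ℝ} (hφ : Measurable φ) (i : ι) :
    ∫ x, φ (x i) ∂iid ι μ = ∫ a, φ a ∂μ :=
  integral_comp_eval (μ := fun _ : ι => μ) hφ.aestronglyMeasurable

lemma memLp_eval {φ : ℝ → ℝ} {p : ENNReal} (hφ : MemLp φ p μ) (i : ι) :
    MemLp (fun x : ι → ℝ => φ (x i)) p (iid ι μ) :=
  hφ.comp_measurePreserving (measurePreserving_eval (fun _ : ι => μ) i)

lemma integrable_eval {φ : ℝ → ℝ} (hφ : Integrable φ μ) (i : ι) :
    Integrable (fun x : ι → ℝ => φ (x i)) (iid ι μ) :=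
  memLp_one_iff_integrable.1 (memLp_eval (memLp_one_iff_integrable.2 hφ) i)

lemma memLp_sum_eval {φ : ℝ → ℝ} {p : ENNReal} (hφ : MemLp φ p μ) (I : Finset ι) :
    MemLp (fun x : ι → ℝ => ∑ i ∈ I, φ (x i)) p (iid ι μ) :=
  memLp_finsetSum I fun i _ => memLp_eval hφ i

lemma integral_sum_eval {φ : ℝ → ℝ} (hm : Measurable φ) (hφ : Integrable φ μ) (I : Finset ι) :
    ∫ x, ∑ i ∈ I, φ (x i) ∂iid ι μ = I.card * ∫ a, φ a ∂μ := by
  rw [integral_finsetSum _ fun i _ => integrable_eval hφ i]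
  simp [integral_eval hm]

lemma variance_sum_eval {φ : ℝ → ℝ} (hm : Measurable φ) (hφ : MemLp φ 2 μ) (I : Finset ι) :
    Var[fun x : ι → ℝ => ∑ i ∈ I, φ (x i); iid ι μ] = I.card * Var[φ; μ] := by
  have h : (fun x : ι → ℝ => ∑ i ∈ I, φ (x i)) = ∑ i ∈ I, fun x : ι → ℝ => φ (x i) := by
    ext x; simp
  rw [h, IndepFun.variance_sum]
  · have : ∀ i : ι, Var[fun x : ι → ℝ => φ (x i); iid ι μ] = Var[φ; μ] := fun i => by
      change Var[φ ∘ (fun x : ι → ℝ => x i); Measure.pi fun _ => μ] = _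
      rw [← variance_map, (measurePreserving_eval (fun _ : ι => μ) i).map_eq]
      · exact hm.aemeasurable
      · exact (measurable_pi_apply i).aemeasurable
    simp [this]
  · exact fun i _ => memLp_eval hφ i
  · exact fun i _ j _ hij => indepFun_of_dependsOn (hm.comp (measurable_pi_apply i))
      (hm.comp (measurable_pi_apply j)) (dependsOn_eval φ i) (dependsOn_eval φ j) (by simpa using hij)

lemma integral_sum_eval_sq {φ : ℝ → ℝ} (hm : Measurable φ) (hφ : MemLp φ 2 μ)
    (h0 : ∫ a, φ a ∂μ = 0) (I : Finset ι) :
    ∫ x, (∑ i ∈ I, φ (x i)) ^ 2 ∂iid ι μ = I.card * ∫ a, φ a ^ 2 ∂μ := by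
  have h := variance_sum_eval hm hφ I
  rw [variance_of_integral_eq_zero (memLp_sum_eval hφ I).aestronglyMeasurable.aemeasurable,
    variance_of_integral_eq_zero hm.aemeasurable h0] at h
  · exact h
  · rw [integral_sum_eval hm (hφ.integrable (by norm_num)), h0, mul_zero]

end Independence

/-! ### Second-moment inequalities -/

section L2

variable {α : Type*} [MeasurableSpace α] {P : Measure α}

lemma integral_abs_mul_le {f g : α → ℝ} (hf : MemLp f 2 P) (hg : MemLp g 2 P) :
    ∫ x, |f x * g x| ∂P ≤ √(∫ x, f x ^ 2 ∂P) * √(∫ x, g x ^ 2 ∂P) := by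
  have h := integral_mul_norm_le_Lp_mul_Lq (μ := P) (f := f) (g := g) (p := 2) (q := 2)
    (by constructor <;> norm_num) (by simpa using hf) (by simpa using hg)
  simpa [abs_mul, Real.sqrt_eq_rpow] using h

lemma integral_abs_le_sqrt [IsProbabilityMeasure P] {f : α → ℝ} (hf : MemLp f 2 P) :
    ∫ x, |f x| ∂P ≤ √(∫ x, f x ^ 2 ∂P) := by
  simpa using integral_abs_mul_le hf (memLp_const (1 : ℝ))

lemma sq_integral_le [IsProbabilityMeasure P] {f : α → ℝ} (hf : MemLp f 2 P) :
    (∫ x, f x ∂P) ^ 2 ≤ ∫ x, f x ^ 2 ∂P := by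
  have h := (abs_integral_le_integral_abs (f := f) (μ := P)).trans (integral_abs_le_sqrt hf)
  have := Real.sq_sqrt (integral_nonneg (fun x => sq_nonneg (f x)) : 0 ≤ ∫ x, f x ^ 2 ∂P)
  rw [← sq_abs, ← this]
  exact pow_le_pow_left₀ (abs_nonneg _) h 2

/-- For an integrable variable, the mean positive part of the deviation below the mean is at most
half the standard deviation. -/
lemma integral_pos_part_sub_le [IsProbabilityMeasure P] {U : α → ℝ} (hU : MemLp U 2 P) :
    ∫ x, max ((∫ y, U y ∂P) - U x) 0 ∂P ≤ √(Var[U; P]) / 2 := by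
  set m := ∫ y, U y ∂P
  have hI := hU.integrable (by norm_num)
  have hd : MemLp (fun x => U x - m) 2 P := hU.sub (memLp_const m)
  -- The signed part has mean zero, so only half of the mean absolute deviation remains; this factor
  -- `1/2` enters the constant `1.5` of the concentration inequality.
  have h1 : ∀ x, max (m - U x) 0 = (|U x - m| - (U x - m)) / 2 := fun x => by
    rcases le_total m (U x) with h | h
    · rw [max_eq_right (by linarith), abs_of_nonneg (by linarith)]; ring
    · rw [max_eq_left (by linarith), abs_of_nonpos (by linarith)]; ring
  simp_rw [h1]
  rw [integral_div, integral_sub (hd.integrable (by norm_num)).abs (hd.integrable (by norm_num)),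
    integral_sub hI (integrable_const m)]
  have h2 := integral_abs_le_sqrt hd
  rw [variance_eq_integral hU.aestronglyMeasurable.aemeasurable]
  simp only [integral_const, probReal_univ, smul_eq_mul, one_mul]
  change _ ≤ √(∫ x, (U x - m) ^ 2 ∂P) / 2
  have : ∫ x, U x ∂P = m := rfl
  linarith

end L2

/-! ### The clamped linear test function -/

section Clamp

/-- Clamp `w` to `[lo, hi]` and centre at the midpoint. -/
noncomputable def clampMid (lo hi w : ℝ) : ℝ := max lo (min hi w) - (lo + hi) / 2

lemma abs_clampMid_le {lo hi : ℝ} (h : lo ≤ hi) (w : ℝ) : |clampMid lo hi w| ≤ (hi - lo) / 2 := by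
  rw [clampMid, abs_le]
  have h1 := le_max_left lo (min hi w)
  have h2 : max lo (min hi w) ≤ hi := max_le h (min_le_left _ _)
  constructor <;> linarith

lemma abs_clampMid_le' (lo hi w : ℝ) : |clampMid lo hi w| ≤ 2 * (|lo| + |hi|) := by
  rw [clampMid, abs_le]
  have h1 := le_max_left lo (min hi w)
  have h2 : max lo (min hi w) ≤ max lo hi := max_le_max_left _ (min_le_left _ _)
  have h3 : max lo hi ≤ |lo| + |hi| :=
    max_le (by linarith [le_abs_self lo, abs_nonneg hi]) (by linarith [le_abs_self hi, abs_nonneg lo])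
  have := neg_abs_le lo
  have := neg_abs_le hi
  have := le_abs_self lo
  have := le_abs_self hi
  constructor <;> linarith

/-- In either endpoint the clamp has slope `0` or `1` and the midpoint has slope `1/2`, so the
centred clamp has slope `±1/2`. Centring therefore halves the cost of changing the endpoints. -/
lemma abs_clampMid_sub_le (lo hi lo' hi' w : ℝ) :
    |clampMid lo hi w - clampMid lo' hi' w| ≤ (|lo - lo'| + |hi - hi'|) / 2 := by
  have a1 := le_abs_self (lo - lo')
  have a2 := neg_abs_le (lo - lo')
  have a3 := le_abs_self (hi - hi')
  have a4 := neg_abs_le (hi - hi')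
  unfold clampMid
  rw [abs_le]
  rcases max_cases lo (min hi w) with h | h <;> rcases max_cases lo' (min hi' w) with h' | h' <;>
  rcases min_cases hi w with k | k <;> rcases min_cases hi' w with k' | k' <;>
  constructor <;> linarith [h.1, h.2, h'.1, h'.2, k.1, k.2, k'.1, k'.2]

lemma clampMid_mono (lo hi : ℝ) : Monotone (clampMid lo hi) := fun _ _ h =>
  sub_le_sub_right (max_le_max_left _ (min_le_min_left _ h)) _

lemma mul_clampMid_sub_nonneg (lo hi w ξ : ℝ) :
    0 ≤ ξ * (clampMid lo hi w - clampMid lo hi (w - ξ)) := by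
  rcases le_total 0 ξ with h | h
  · exact mul_nonneg h (sub_nonneg.2 (clampMid_mono lo hi (by linarith)))
  · exact mul_nonneg_of_nonpos_of_nonpos h (sub_nonpos.2 (clampMid_mono lo hi (by linarith)))

/-- From a point of `[a, b]`, a step of length at most `δ` stays in the enlarged window, where the
clamp is the identity up to a constant; a longer step still moves the clamp by at least `δ`. -/
lemma abs_mul_min_le_mul_clampMid_sub {a b δ w : ℝ} (hδ : 0 ≤ δ) (ha : a ≤ w) (hb : w ≤ b) (ξ : ℝ) :
    |ξ| * min |ξ| δ ≤
      ξ * (clampMid (a - δ) (b + δ) w - clampMid (a - δ) (b + δ) (w - ξ)) := by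
  have h1 : max (a - δ) (min (b + δ) w) = w := by
    rw [min_eq_right (by linarith), max_eq_right (by linarith)]
  unfold clampMid
  rw [h1]
  rcases le_total 0 ξ with h | h
  · rw [abs_of_nonneg h, min_eq_right (show w - ξ ≤ b + δ by linarith)]
    refine mul_le_mul_of_nonneg_left ?_ h
    rcases max_cases (a - δ) (w - ξ) with k | k <;> rcases min_cases ξ δ with k' | k' <;>
    linarith [k.1, k.2, k'.1, k'.2]
  · rw [abs_of_nonpos h, max_eq_right (le_min (by linarith) (by linarith))]
    have : min (-ξ) δ ≤ min (b + δ) (w - ξ) - w := by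
      rcases min_cases (b + δ) (w - ξ) with k | k <;> rcases min_cases (-ξ) δ with k' | k' <;>
      linarith [k.1, k.2, k'.1, k'.2]
    nlinarith

end Clamp

/-! ### The randomized concentration inequality -/

section Concentration

variable {ι : Type*} [Fintype ι] [DecidableEq ι] {μ : Measure ℝ} [IsProbabilityMeasure μ]
  {φ : ℝ → ℝ}

/-- The truncated second moment `E|φ| min(|φ|, δ)`. -/
noncomputable def truncMoment (μ : Measure ℝ) (φ : ℝ → ℝ) (δ : ℝ) : ℝ :=
  ∫ a, |φ a| * min |φ a| δ ∂μ

lemma memLp_trunc (hm : Measurable φ) (hφ : MemLp φ 2 μ) {δ : ℝ} (hδ : 0 ≤ δ) :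
    MemLp (fun a => |φ a| * min |φ a| δ) 2 μ := by
  refine (hφ.const_mul δ).mono (by fun_prop) (ae_of_all _ fun a => ?_)
  have h0 : 0 ≤ min |φ a| δ := le_min (abs_nonneg _) hδ
  simp only [norm_mul, Real.norm_eq_abs, abs_abs, abs_of_nonneg h0, abs_of_nonneg hδ]
  rw [mul_comm]
  exact mul_le_mul_of_nonneg_right (min_le_right _ _) (abs_nonneg _)

/-- Since `|φ| min(|φ|, δ) ≤ δ |φ|`, the sum has standard deviation at most `δ √(|I| E φ²)`, of
which `integral_pos_part_sub_le` takes half. -/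
lemma integral_deficit_le (hm : Measurable φ) (hφ : MemLp φ 2 μ) {δ : ℝ} (hδ : 0 ≤ δ)
    (I : Finset ι) :
    ∫ x, max (I.card * truncMoment μ φ δ - ∑ i ∈ I, |φ (x i)| * min |φ (x i)| δ) 0 ∂iid ι μ
      ≤ δ * √(I.card * ∫ a, φ a ^ 2 ∂μ) / 2 := by
  have hk := memLp_trunc hm hφ hδ
  have hkm : Measurable fun a => |φ a| * min |φ a| δ := by fun_prop
  have h := integral_pos_part_sub_le (memLp_sum_eval (ι := ι) hk I)
  rw [integral_sum_eval hkm (hk.integrable (by norm_num)), variance_sum_eval hkm hk] at h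
  refine h.trans ?_
  have h1 : Var[fun a => |φ a| * min |φ a| δ; μ] ≤ δ ^ 2 * ∫ a, φ a ^ 2 ∂μ := by
    refine (variance_le_expectation_sq hkm.aestronglyMeasurable).trans ?_
    rw [← integral_const_mul]
    refine integral_mono hk.integrable_sq (hφ.integrable_sq.const_mul _) fun a => ?_
    have h0 : 0 ≤ min |φ a| δ := le_min (abs_nonneg _) hδ
    simp only [Pi.pow_apply, mul_pow, sq_abs]
    rw [mul_comm]
    exact mul_le_mul_of_nonneg_right (pow_le_pow_left₀ h0 (min_le_right _ _) 2) (sq_nonneg _)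
  have h2 : √(I.card * Var[fun a => |φ a| * min |φ a| δ; μ])
      ≤ δ * √(I.card * ∫ a, φ a ^ 2 ∂μ) := by
    rw [← Real.sqrt_sq hδ, ← Real.sqrt_mul (sq_nonneg δ)]
    refine Real.sqrt_le_sqrt ?_
    rw [Real.sqrt_sq hδ]
    calc (I.card : ℝ) * Var[fun a => |φ a| * min |φ a| δ; μ]
        ≤ I.card * (δ ^ 2 * ∫ a, φ a ^ 2 ∂μ) := by gcongr
      _ = _ := by ring
  linarith

/-- A randomized concentration inequality: `W = ∑_{i ∈ I} φ(xᵢ) + V` is unlikely to fall into a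
short random interval `[D₁, D₂]`, even on an event `B` determined by the other coordinates. -/
theorem randomized_concentration (hm : Measurable φ) (hφ : MemLp φ 2 μ) (h0 : ∫ a, φ a ∂μ = 0)
    (I : Finset ι) {δ : ℝ} (hδ : 0 ≤ δ) {V D₁ D₂ : (ι → ℝ) → ℝ} {E₁ E₂ : ι → (ι → ℝ) → ℝ}
    {B : Set (ι → ℝ)} (hB : MeasurableSet B) (hBd : DependsOn (fun x => x ∈ B) (I : Set ι)ᶜ)
    (hV : Measurable V) (hVd : DependsOn V (I : Set ι)ᶜ)
    (hD₁ : Measurable D₁) (hD₂ : Measurable D₂)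
    (hE₁ : ∀ i ∈ I, Measurable (E₁ i)) (hE₂ : ∀ i ∈ I, Measurable (E₂ i))
    (hD₁' : MemLp D₁ 2 (iid ι μ)) (hD₂' : MemLp D₂ 2 (iid ι μ))
    (hE₁' : ∀ i ∈ I, MemLp (E₁ i) 2 (iid ι μ)) (hE₂' : ∀ i ∈ I, MemLp (E₂ i) 2 (iid ι μ))
    (hE₁d : ∀ i ∈ I, DependsOn (E₁ i) {i}ᶜ) (hE₂d : ∀ i ∈ I, DependsOn (E₂ i) {i}ᶜ)
    (hle : ∀ x, D₁ x ≤ D₂ x) :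
    I.card * truncMoment μ φ δ * (iid ι μ).real
        (B ∩ {x | D₁ x ≤ ∑ i ∈ I, φ (x i) + V x ∧ ∑ i ∈ I, φ (x i) + V x ≤ D₂ x}) ≤
      ∫ x in B, |∑ i ∈ I, φ (x i)| * ((D₂ x - D₁ x) / 2 + δ) ∂iid ι μ
      + (∑ i ∈ I, ∫ x in B, |φ (x i)| * (|D₁ x - E₁ i x| + |D₂ x - E₂ i x|) ∂iid ι μ) / 2
      + (iid ι μ).real B * (δ * √(I.card * ∫ a, φ a ^ 2 ∂μ) / 2) := by
  set π := iid ι μ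
  set S : (ι → ℝ) → ℝ := fun x => ∑ i ∈ I, φ (x i) with hS
  set W : (ι → ℝ) → ℝ := fun x => S x + V x with hW
  set b : (ι → ℝ) → ℝ := B.indicator fun _ => 1 with hb
  have hφi : ∀ i, Measurable fun x : ι → ℝ => φ (x i) := fun i => hm.comp (measurable_pi_apply i)
  have hSm : Measurable S := Finset.measurable_sum I fun i _ => hφi i
  have hWm : Measurable W := hSm.add hV
  have hbm : Measurable b := measurable_const.indicator hB
  have hb0 : ∀ x, 0 ≤ b x := fun x => indicator_nonneg (fun _ _ => zero_le_one) x
  have hb1 : ∀ x, b x ≤ 1 := fun x => indicator_le' (fun _ _ => le_rfl) (fun _ _ => zero_le_one) x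
  have hbset : ∀ f : (ι → ℝ) → ℝ, ∫ x in B, f x ∂π = ∫ x, b x * f x ∂π := fun f => by
    rw [← integral_indicator hB]
    congr 1; ext x
    by_cases hx : x ∈ B <;> simp [hb, hx]
  have hmulb : ∀ {f : (ι → ℝ) → ℝ}, Integrable f π → Integrable (fun x => b x * f x) π :=
    fun {f} hf => hf.bdd_mul hbm.aestronglyMeasurable (c := 1)
      (ae_of_all _ fun x => by rw [Real.norm_eq_abs, abs_of_nonneg (hb0 x)]; exact hb1 x)
  set T : Set (ι → ℝ) := {x | D₁ x ≤ W x ∧ W x ≤ D₂ x} with hT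
  have hTm : MeasurableSet T := (measurableSet_le hD₁ hWm).inter (measurableSet_le hWm hD₂)
  set Wi : ι → (ι → ℝ) → ℝ := fun i x => W x - φ (x i) with hWi
  have hWid : ∀ i ∈ I, DependsOn (Wi i) {i}ᶜ := by
    intro i hi x y hxy
    have hVxy : V x = V y := hVd fun j hj => hxy j (by
      rintro rfl; exact hj hi)
    have : ∀ z : ι → ℝ, Wi i z = ∑ j ∈ I.erase i, φ (z j) + V z := fun z => by
      simp only [hWi, hW, hS, ← Finset.add_sum_erase I (fun j => φ (z j)) hi]; ring
    rw [this, this, hVxy]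
    congr 1
    exact Finset.sum_congr rfl fun j hj => by
      rw [hxy j (by simpa using (Finset.mem_erase.1 hj).1)]
  have hWim : ∀ i, Measurable (Wi i) := fun i => hWm.sub (hφi i)
  have hclm : ∀ {f g h : (ι → ℝ) → ℝ}, Measurable f → Measurable g → Measurable h →
      Measurable fun x => clampMid (f x - δ) (g x + δ) (h x) := by
    intro f g h hf hg hh
    unfold clampMid
    fun_prop
  have hclL : ∀ {f g h : (ι → ℝ) → ℝ}, Measurable f → Measurable g → Measurable h →
      MemLp f 2 π → MemLp g 2 π → MemLp (fun x => clampMid (f x - δ) (g x + δ) (h x)) 2 π := by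
    intro f g h hf hg hh hf' hg'
    have hd : MemLp (fun _ : ι → ℝ => δ) 2 π := memLp_const δ
    refine (((hf'.sub hd).norm.add (hg'.add hd).norm).const_mul 2).mono
      (hclm hf hg hh).aestronglyMeasurable (ae_of_all _ fun x => ?_)
    refine (abs_clampMid_le' _ _ _).trans (le_abs_self _)
  have hφL : ∀ i, MemLp (fun x : ι → ℝ => φ (x i)) 2 π := fun i => memLp_eval hφ i
  -- the centred terms vanish
  have hA : ∀ i ∈ I, ∫ x, b x * (φ (x i) * clampMid (E₁ i x - δ) (E₂ i x + δ) (Wi i x)) ∂π = 0 := by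
    intro i hi
    have hdep : DependsOn (fun x => b x * clampMid (E₁ i x - δ) (E₂ i x + δ) (Wi i x)) {i}ᶜ := by
      intro x y hxy
      have h1 : b x = b y := dependsOn_indicator hBd fun j hj => hxy j (by
        rintro rfl; exact hj hi)
      simp only [h1, hE₁d i hi hxy, hE₂d i hi hxy, hWid i hi hxy]
    have := integral_mul_of_dependsOn (μ := μ) (hφi i)
      (hbm.mul (hclm (hE₁ i hi) (hE₂ i hi) (hWim i))) (dependsOn_eval φ i) hdep
      disjoint_compl_right
    rw [integral_eval hm, h0, zero_mul] at this
    rw [← this]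
    congr 1; ext x; simp only [Pi.mul_apply]; ring
  set U : (ι → ℝ) → ℝ := fun x => ∑ i ∈ I, |φ (x i)| * min |φ (x i)| δ with hU
  have hUL : MemLp U 2 π := memLp_sum_eval (memLp_trunc hm hφ hδ) I
  have hUm : Measurable U := Finset.measurable_sum I fun i _ => by
    have := hφi i; fun_prop
  set u : ℝ := I.card * truncMoment μ φ δ with hu
  have hIS : Integrable (fun x => |S x| * ((D₂ x - D₁ x) / 2 + δ)) π := by
    have h1 : MemLp (fun x => |S x|) 2 π := (memLp_sum_eval hφ I).abs
    have h2 : MemLp (fun x => (D₂ x - D₁ x) / 2 + δ) 2 π := by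
      have := ((hD₂'.sub hD₁').const_mul (1 / 2)).add (memLp_const δ)
      refine (memLp_congr_ae (ae_of_all _ fun x => ?_)).1 this
      simp [Pi.add_apply]; ring
    exact h1.integrable_mul h2
  have hIE : ∀ i ∈ I, Integrable
      (fun x => |φ (x i)| * (|D₁ x - E₁ i x| + |D₂ x - E₂ i x|)) π := fun i hi =>
    (hφL i).abs.integrable_mul ((hD₁'.sub (hE₁' i hi)).abs.add (hD₂'.sub (hE₂' i hi)).abs)
  have hIA : ∀ i ∈ I, Integrable
      (fun x => b x * (φ (x i) * clampMid (E₁ i x - δ) (E₂ i x + δ) (Wi i x))) π := fun i hi =>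
    hmulb ((hφL i).integrable_mul (hclL (hE₁ i hi) (hE₂ i hi) (hWim i) (hE₁' i hi) (hE₂' i hi)))
  have hdefI : Integrable (fun x => max (u - U x) 0) π :=
    ((integrable_const u).sub (hUL.integrable (by norm_num))).pos_part
  -- pointwise inequality
  have hpt : ∀ x, (B ∩ T).indicator (fun _ => u) x ≤
      b x * (|S x| * ((D₂ x - D₁ x) / 2 + δ))
        - ∑ i ∈ I, b x * (φ (x i) * clampMid (E₁ i x - δ) (E₂ i x + δ) (Wi i x))
        + (∑ i ∈ I, b x * (|φ (x i)| * (|D₁ x - E₁ i x| + |D₂ x - E₂ i x|))) / 2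
        + b x * max (u - U x) 0 := by
    intro x
    by_cases hxB : x ∈ B
    swap
    · have : b x = 0 := by simp [hb, hxB]
      simp [this, hxB]
    have hbx : b x = 1 := by simp [hb, hxB]
    -- The product `S f(W)` is at most `|S|` times half the window length. From below, subtracting
    -- `φ(xᵢ) f(Wi)`, with endpoints `E₁ i`, `E₂ i` to make its mean vanish, leaves nonnegative
    -- increments that add up to at least `U` on the event `T`.
    set f := clampMid (D₁ x - δ) (D₂ x + δ) with hf
    have e1 : S x * f (W x) ≤ |S x| * ((D₂ x - D₁ x) / 2 + δ) := by
      refine (le_abs_self _).trans ?_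
      rw [abs_mul]
      refine mul_le_mul_of_nonneg_left ?_ (abs_nonneg _)
      refine (abs_clampMid_le (by linarith [hle x]) _).trans (le_of_eq (by ring))
    have e2 : ∀ i ∈ I, φ (x i) * clampMid (E₁ i x - δ) (E₂ i x + δ) (Wi i x)
        ≤ φ (x i) * f (Wi i x) + |φ (x i)| * (|D₁ x - E₁ i x| + |D₂ x - E₂ i x|) / 2 := by
      intro i hi
      have h1 := abs_clampMid_sub_le (E₁ i x - δ) (E₂ i x + δ) (D₁ x - δ) (D₂ x + δ) (Wi i x)
      rw [show E₁ i x - δ - (D₁ x - δ) = -(D₁ x - E₁ i x) by ring,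
        show E₂ i x + δ - (D₂ x + δ) = -(D₂ x - E₂ i x) by ring, abs_neg, abs_neg] at h1
      have h2 : φ (x i) * (clampMid (E₁ i x - δ) (E₂ i x + δ) (Wi i x) - f (Wi i x))
          ≤ |φ (x i)| * ((|D₁ x - E₁ i x| + |D₂ x - E₂ i x|) / 2) := by
        refine (le_abs_self _).trans ?_
        rw [abs_mul]
        exact mul_le_mul_of_nonneg_left h1 (abs_nonneg _)
      linarith
    have e3 := Finset.sum_le_sum e2
    rw [Finset.sum_add_distrib, ← Finset.sum_div] at e3
    have e4 : S x * f (W x) - ∑ i ∈ I, φ (x i) * f (Wi i x)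
        = ∑ i ∈ I, φ (x i) * (f (W x) - f (Wi i x)) := by
      simp only [hS, Finset.sum_mul, ← Finset.sum_sub_distrib, mul_sub]
    have hWix : ∀ i, Wi i x = W x - φ (x i) := fun i => rfl
    have e5 : 0 ≤ ∑ i ∈ I, φ (x i) * (f (W x) - f (Wi i x)) :=
      Finset.sum_nonneg fun i _ => mul_clampMid_sub_nonneg _ _ _ _
    simp only [hbx, one_mul]
    by_cases hxT : x ∈ T
    · rw [indicator_of_mem (show x ∈ B ∩ T from ⟨hxB, hxT⟩)]
      have e6 : U x ≤ ∑ i ∈ I, φ (x i) * (f (W x) - f (Wi i x)) :=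
        Finset.sum_le_sum fun i _ => abs_mul_min_le_mul_clampMid_sub hδ hxT.1 hxT.2 _
      have e7 := le_max_left (u - U x) 0
      linarith
    · rw [indicator_of_notMem (fun h => hxT h.2)]
      have e7 := le_max_right (u - U x) 0
      linarith
  have hlhs : ∫ x, (B ∩ T).indicator (fun _ => u) x ∂π = u * π.real (B ∩ T) := by
    rw [integral_indicator (hB.inter hTm), setIntegral_const, smul_eq_mul, mul_comm]
  have hdef : ∫ x, b x * max (u - U x) 0 ∂π ≤ π.real B * (δ * √(I.card * ∫ a, φ a ^ 2 ∂μ) / 2) := by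
    -- The deficit uses the coordinates in `I` and `B` the remaining ones, so the factor `P(B)`
    -- splits off exactly.
    have hdepU : DependsOn (fun x => max (u - U x) 0) (I : Set ι) := fun x y hxy => by
      have : U x = U y := dependsOn_sum (fun a => |φ a| * min |φ a| δ) I hxy
      simp only [this]
    rw [integral_mul_of_dependsOn hbm (by fun_prop) (dependsOn_indicator hBd) hdepU
      disjoint_compl_left]
    have : ∫ x, b x ∂π = π.real B := by
      rw [hb, integral_indicator hB]; simp
    rw [this]
    exact mul_le_mul_of_nonneg_left (integral_deficit_le hm hφ hδ I) measureReal_nonneg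
  have hi1 := hmulb hIS
  have hi2 := integrable_finsetSum I hIA
  have hi3 := (integrable_finsetSum I fun i hi => hmulb (hIE i hi)).div_const 2
  have hi4 := hmulb hdefI
  have hmain := integral_mono (μ := π)
    ((integrable_const u).indicator (hB.inter hTm)) (((hi1.sub hi2).add hi3).add hi4) hpt
  rw [hlhs] at hmain
  simp only [Pi.add_apply, Pi.sub_apply] at hmain
  have k1 := integral_add ((hi1.sub hi2).add hi3) hi4
  have k2 := integral_add (hi1.sub hi2) hi3
  simp only [Pi.add_apply, Pi.sub_apply] at k1 k2
  rw [k1, k2, integral_sub hi1 hi2, integral_finsetSum I hIA, Finset.sum_eq_zero hA, integral_div,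
    integral_finsetSum I fun i hi => hmulb (hIE i hi)] at hmain
  simp only [hbset]
  linarith

end Concentration

/-! ### Normalized sums and the Lyapunov ratio -/

/-- `φ` is centred, and the sum of `φ` over an i.i.d. sample indexed by `ι` has variance one and
finite absolute moments of order `p`. -/
structure Normalized (ι : Type*) [Fintype ι] (μ : Measure ℝ) (φ : ℝ → ℝ) (p : ℝ) : Prop where
  measurable : Measurable φ
  memLp : MemLp φ 2 μ
  mean : ∫ a, φ a ∂μ = 0
  second : Fintype.card ι * ∫ a, φ a ^ 2 ∂μ = 1
  integrable : Integrable (fun a => |φ a| ^ p) μ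
  two_lt : 2 < p
  le_three : p ≤ 3

/-- The Lyapunov ratio `∑ E|φ(Xᵢ)|^p`. -/
noncomputable def lyap (ι : Type*) [Fintype ι] (μ : Measure ℝ) (φ : ℝ → ℝ) (p : ℝ) : ℝ :=
  Fintype.card ι * ∫ a, |φ a| ^ p ∂μ

section

variable {ι : Type*} [Fintype ι] {μ : Measure ℝ} [IsProbabilityMeasure μ] {φ : ℝ → ℝ} {p : ℝ}

lemma lyap_nonneg : 0 ≤ lyap ι μ φ p :=
  mul_nonneg (Nat.cast_nonneg _) (integral_nonneg fun _ => by positivity)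

/-- An event and a function determined by disjoint blocks of coordinates decouple. -/
lemma setIntegral_of_dependsOn {B : Set (ι → ℝ)} {F : (ι → ℝ) → ℝ} {S T : Set ι}
    (hB : MeasurableSet B) (hF : Measurable F) (hBd : DependsOn (fun x => x ∈ B) S)
    (hFd : DependsOn F T) (hST : Disjoint S T) :
    ∫ x in B, F x ∂iid ι μ = (iid ι μ).real B * ∫ x, F x ∂iid ι μ := by
  have h1 : B.indicator F = fun x => B.indicator (fun _ => (1 : ℝ)) x * F x := by
    ext x; by_cases hx : x ∈ B <;> simp [hx]
  rw [← integral_indicator hB, h1, integral_mul_of_dependsOn (measurable_const.indicator hB) hF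
    (dependsOn_indicator hBd) hFd hST, integral_indicator hB]
  simp

lemma measurable_sum_eval (hm : Measurable φ) (I : Finset ι) :
    Measurable fun x : ι → ℝ => ∑ i ∈ I, φ (x i) :=
  Finset.measurable_sum I fun i _ => hm.comp (measurable_pi_apply i)

lemma dependsOn_abs_sum (φ : ℝ → ℝ) (I : Finset ι) :
    DependsOn (fun x : ι → ℝ => |∑ i ∈ I, φ (x i)|) (I : Set ι) := fun x y hxy => by
  have : ∑ i ∈ I, φ (x i) = ∑ i ∈ I, φ (y i) := dependsOn_sum φ I hxy
  simp only [this]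

namespace Normalized

variable (h : Normalized ι μ φ p)
include h

lemma card_pos : (0 : ℝ) < Fintype.card ι := by
  rcases (Nat.cast_nonneg (α := ℝ) (Fintype.card ι)).eq_or_lt with h0 | h0
  · have := h.second; rw [← h0] at this; simp at this
  · exact h0

lemma one_le_card : (1 : ℝ) ≤ Fintype.card ι := by
  have := h.card_pos
  exact_mod_cast this

lemma second_eq : ∫ a, φ a ^ 2 ∂μ = (Fintype.card ι : ℝ)⁻¹ :=
  eq_inv_of_mul_eq_one_right h.second

lemma neg : Normalized ι μ (fun a => -φ a) p where
  measurable := h.measurable.neg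
  memLp := h.memLp.neg
  mean := by rw [integral_neg, h.mean, neg_zero]
  second := by simpa using h.second
  integrable := by simpa using h.integrable
  two_lt := h.two_lt
  le_three := h.le_three

lemma integral_abs_le : ∫ a, |φ a| ∂μ ≤ (√(Fintype.card ι))⁻¹ := by
  have := integral_abs_le_sqrt h.memLp
  rwa [h.second_eq, Real.sqrt_inv] at this

/-- Lyapunov's inequality. -/
lemma inv_sqrt_card_le : (√(Fintype.card ι))⁻¹ ≤ lyap ι μ φ p := by
  set n : ℝ := (Fintype.card ι : ℝ)
  have hn : 0 < n := h.card_pos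
  have hn1 : 1 ≤ n := h.one_le_card
  have hp := h.two_lt
  have hp' := h.le_three
  -- Bernoulli's inequality with exponent `p/2` at `nφ² - 1`, which has mean zero; integration gives
  -- `1 ≤ n^(p/2) E|φ|^p`, and `p ≤ 3` then allows `n^(p/2)` to be replaced by `n √n`.
  have hpt : ∀ a, 1 + p / 2 * (n * φ a ^ 2 - 1) ≤ n ^ (p / 2) * |φ a| ^ p := by
    intro a
    have h1 := one_add_mul_self_le_rpow_one_add (s := n * φ a ^ 2 - 1) (p := p / 2)
      (by nlinarith [mul_nonneg hn.le (sq_nonneg (φ a))]) (by linarith)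
    have e : (φ a ^ 2) ^ (p / 2) = |φ a| ^ p := by
      rw [← sq_abs, ← Real.rpow_natCast, ← Real.rpow_mul (abs_nonneg _)]
      congr 1; push_cast; ring
    rwa [add_sub_cancel, Real.mul_rpow hn.le (sq_nonneg _), e] at h1
  have hi : Integrable (fun a => φ a ^ 2) μ := h.memLp.integrable_sq
  have hi2 : Integrable (fun a => n * φ a ^ 2 - 1) μ :=
    (hi.const_mul n).sub (integrable_const 1)
  have hm := integral_mono ((integrable_const (1 : ℝ)).add (hi2.const_mul (p / 2)))
    (h.integrable.const_mul (n ^ (p / 2))) hpt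
  simp only [Pi.add_apply] at hm
  rw [integral_add (integrable_const _) (hi2.const_mul _), integral_const_mul, integral_const_mul,
    integral_sub (hi.const_mul n) (integrable_const 1), integral_const_mul, h.second] at hm
  simp only [integral_const, probReal_univ, smul_eq_mul, mul_one, sub_self, mul_zero,
    add_zero] at hm
  have h2 : n ^ (p / 2) ≤ √n * n := by
    have : √n * n = n ^ (3 / 2 : ℝ) := by
      rw [Real.sqrt_eq_rpow]; nth_rewrite 2 [← Real.rpow_one n]
      rw [← Real.rpow_add hn]; congr 1; norm_num
    rw [this]
    exact Real.rpow_le_rpow_of_exponent_le hn1 (by linarith)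
  have h3 : 0 ≤ ∫ a, |φ a| ^ p ∂μ := integral_nonneg fun _ => by positivity
  rw [inv_le_iff_one_le_mul₀ (by positivity), lyap]
  calc 1 ≤ n ^ (p / 2) * ∫ a, |φ a| ^ p ∂μ := hm
    _ ≤ √n * n * ∫ a, |φ a| ^ p ∂μ := by gcongr
    _ = _ := by ring

lemma lyap_pos : 0 < lyap ι μ φ p := lt_of_lt_of_le (by have := h.card_pos; positivity)
  h.inv_sqrt_card_le

/-- Comparison of a truncated moment with the Lyapunov ratio. -/
lemma integral_le_lyap {k : ℝ → ℝ} {c : ℝ} (hk : ∀ a, k a ≤ c * |φ a| ^ p)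
    (hki : Integrable k μ) : ∫ a, k a ∂μ ≤ c * lyap ι μ φ p / Fintype.card ι := by
  have := integral_mono hki (h.integrable.const_mul c) hk
  rw [integral_const_mul] at this
  have hn := h.card_pos
  rw [lyap]
  refine this.trans (le_of_eq ?_)
  field_simp

/-- With `x = |φ|`, truncation at `L/2` loses at most `x³/(2L)` when `x ≤ 1`, because `x (x - L)² ≥
0`. When `x ≥ 1` the loss is at most `x²`, and `1/(2L) ≥ 1` suffices. In both cases the loss is at
most `x^p/(2L)`, whose integral is half of `E φ² = 1/n`. -/
lemma half_le_truncMoment (hL : lyap ι μ φ p ≤ 1 / 2) :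
    1 / (2 * (Fintype.card ι : ℝ)) ≤ truncMoment μ φ (lyap ι μ φ p / 2) := by
  set L := lyap ι μ φ p
  have hL0 : 0 < L := h.lyap_pos
  have hn := h.card_pos
  have hp := h.two_lt
  have hp' := h.le_three
  have ht := memLp_trunc h.measurable h.memLp (show 0 ≤ L / 2 by positivity)
  have hti := ht.integrable (by norm_num)
  have hpt : ∀ a, φ a ^ 2 - |φ a| * min |φ a| (L / 2) ≤ 1 / (2 * L) * |φ a| ^ p := by
    intro a
    set x := |φ a|
    have hx : 0 ≤ x := abs_nonneg _
    rw [← sq_abs]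
    change x ^ 2 - _ ≤ _
    have hcoef : 1 ≤ 1 / (2 * L) := by rw [le_div_iff₀ (by positivity)]; linarith
    rcases le_total x 1 with h1 | h1
    · have h2 : x ^ 3 ≤ x ^ p := by
        rcases hx.eq_or_lt with h0 | h0
        · rw [← h0, Real.zero_rpow (by linarith)]; norm_num
        · rw [← Real.rpow_natCast]
          exact Real.rpow_le_rpow_of_exponent_ge h0 h1 (by push_cast; exact hp')
      have h3 : x ^ 2 - x * min x (L / 2) ≤ 1 / (2 * L) * x ^ 3 := by
        rw [one_div, ← div_eq_inv_mul, le_div_iff₀ (by positivity)]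
        rcases min_cases x (L / 2) with k | k <;> rw [k.1]
        · nlinarith [pow_nonneg hx 3]
        · nlinarith [mul_nonneg hx (sq_nonneg (x - L))]
      exact h3.trans (mul_le_mul_of_nonneg_left h2 (by positivity))
    · have h2 : x ^ 2 ≤ x ^ p := by
        rw [← Real.rpow_natCast]
        exact Real.rpow_le_rpow_of_exponent_le h1 (by push_cast; linarith)
      have h3 : 0 ≤ x * min x (L / 2) := mul_nonneg hx (le_min hx (by positivity))
      nlinarith [Real.rpow_nonneg hx p]
  have h1 := h.integral_le_lyap hpt (h.memLp.integrable_sq.sub hti)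
  rw [integral_sub h.memLp.integrable_sq hti, h.second_eq] at h1
  have h2 : 1 / (2 * L) * L / (Fintype.card ι : ℝ) = 1 / (2 * (Fintype.card ι : ℝ)) := by
    field_simp
  rw [show lyap ι μ φ p = L from rfl, h2] at h1
  have h3 : (Fintype.card ι : ℝ)⁻¹ = 1 / (2 * (Fintype.card ι : ℝ)) + 1 / (2 * (Fintype.card ι : ℝ)) := by
    field_simp; norm_num
  rw [truncMoment]; linarith

lemma integral_sq_sum (I : Finset ι) :
    ∫ x, (∑ i ∈ I, φ (x i)) ^ 2 ∂iid ι μ = I.card / Fintype.card ι := by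
  rw [integral_sum_eval_sq h.measurable h.memLp h.mean, h.second_eq, div_eq_mul_inv]

lemma card_div_le_one (I : Finset ι) : (I.card : ℝ) / Fintype.card ι ≤ 1 := by
  rw [div_le_one h.card_pos]
  exact_mod_cast I.card_le_univ

lemma integral_abs_sum_le (I : Finset ι) :
    ∫ x, |∑ i ∈ I, φ (x i)| ∂iid ι μ ≤ √(I.card / Fintype.card ι) := by
  rw [← h.integral_sq_sum I]
  exact integral_abs_le_sqrt (memLp_sum_eval h.memLp I)

/-- Concentration of `∑_{i ∈ I} φ(xᵢ) + V` on an event `B`, where `V` and `B` are determined by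
the coordinates outside `I`. -/
lemma concentration [DecidableEq ι] (hL : lyap ι μ φ p ≤ 1 / 2) {I : Finset ι} (hI : I.Nonempty)
    {V : (ι → ℝ) → ℝ} {B : Set (ι → ℝ)} (hB : MeasurableSet B)
    (hBd : DependsOn (fun x => x ∈ B) (I : Set ι)ᶜ)
    (hV : Measurable V) (hVd : DependsOn V (I : Set ι)ᶜ) {a b : ℝ} (hab : a ≤ b) :
    (iid ι μ).real (B ∩ {x | a ≤ ∑ i ∈ I, φ (x i) + V x ∧ ∑ i ∈ I, φ (x i) + V x ≤ b}) ≤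
      (iid ι μ).real B * (√(Fintype.card ι / I.card) * (b - a + 1.5 * lyap ι μ φ p)) := by
  set L := lyap ι μ φ p
  have hL0 : 0 < L := h.lyap_pos
  have hn := h.card_pos
  have hIc : (0 : ℝ) < I.card := by exact_mod_cast hI.card_pos
  have hδ : 0 ≤ L / 2 := by positivity
  have hc := randomized_concentration h.measurable h.memLp h.mean I hδ (D₁ := fun _ => a)
    (D₂ := fun _ => b) (E₁ := fun _ _ => a) (E₂ := fun _ _ => b) hB hBd hV hVd
    measurable_const measurable_const (fun _ _ => measurable_const) (fun _ _ => measurable_const)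
    (memLp_const a) (memLp_const b) (fun _ _ => memLp_const a) (fun _ _ => memLp_const b)
    (fun i _ => (dependsOn_const a).mono (empty_subset _))
    (fun i _ => (dependsOn_const b).mono (empty_subset _)) (fun _ => hab)
  set R := (iid ι μ).real
    (B ∩ {x | a ≤ ∑ i ∈ I, φ (x i) + V x ∧ ∑ i ∈ I, φ (x i) + V x ≤ b})
  set s := √((I.card : ℝ) / Fintype.card ι) with hs
  have hspos : 0 < s := by positivity
  have hs2 : s ^ 2 = I.card / Fintype.card ι := Real.sq_sqrt (by positivity)
  simp only [sub_self, abs_zero, add_zero, mul_zero, integral_zero, Finset.sum_const_zero,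
    zero_div] at hc
  rw [integral_mul_const, h.second_eq, ← div_eq_mul_inv] at hc
  have hBint : ∫ x in B, |∑ i ∈ I, φ (x i)| ∂iid ι μ ≤ (iid ι μ).real B * s := by
    rw [setIntegral_of_dependsOn hB (measurable_sum_eval h.measurable I).abs hBd
      (dependsOn_abs_sum φ I) disjoint_compl_left]
    exact mul_le_mul_of_nonneg_left (h.integral_abs_sum_le I) measureReal_nonneg
  have hu := h.half_le_truncMoment hL
  have hR : 0 ≤ R := measureReal_nonneg
  -- The enlarged window contributes `δ` and the deficit `δ/2`, with `δ = L/2`.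
  have hsum : s ^ 2 / 2 * R ≤ (iid ι μ).real B * s * ((b - a) / 2 + 1.5 * (L / 2)) := by
    have h1 : s ^ 2 / 2 ≤ I.card * truncMoment μ φ (L / 2) := by
      rw [hs2]
      refine le_trans (le_of_eq ?_) (mul_le_mul_of_nonneg_left hu hIc.le)
      field_simp
    have h2 : (∫ x in B, |∑ i ∈ I, φ (x i)| ∂iid ι μ) * ((b - a) / 2 + L / 2)
        ≤ (iid ι μ).real B * s * ((b - a) / 2 + L / 2) :=
      mul_le_mul_of_nonneg_right hBint (by linarith)
    have h3 := mul_le_mul_of_nonneg_right h1 hR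
    linarith
  have hinv : √((Fintype.card ι : ℝ) / I.card) = s⁻¹ := by
    rw [hs, ← Real.sqrt_inv, inv_div]
  rw [hinv]
  have h4 : R = (s ^ 2 / 2 * R) * (2 / s ^ 2) := by field_simp
  rw [h4]
  calc (s ^ 2 / 2 * R) * (2 / s ^ 2)
      ≤ ((iid ι μ).real B * s * ((b - a) / 2 + 1.5 * (L / 2))) * (2 / s ^ 2) := by gcongr
    _ = _ := by field_simp

end Normalized
end

/-! ### Leave-one-out sums and Stein's identity -/

section

variable {ι : Type*} [Fintype ι] [DecidableEq ι] {μ : Measure ℝ} [IsProbabilityMeasure μ]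
  {φ : ℝ → ℝ} {p : ℝ}

/-- Integration in one coordinate separately. -/
lemma integral_eval_prod {Y : (ι → ℝ) → ℝ} (hY : Measurable Y) {i : ι} (hYd : DependsOn Y {i}ᶜ)
    {G : ℝ → ℝ → ℝ} (hG : Measurable (Function.uncurry G))
    (hi : Integrable (fun x => G (x i) (Y x)) (iid ι μ)) :
    Integrable (fun a => ∫ x, G a (Y x) ∂iid ι μ) μ ∧
    ∫ x, G (x i) (Y x) ∂iid ι μ = ∫ a, ∫ x, G a (Y x) ∂iid ι μ ∂μ := by
  have hind : IndepFun (fun x : ι → ℝ => x i) Y (iid ι μ) :=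
    indepFun_of_dependsOn (measurable_pi_apply i) hY (dependsOn_eval id i) hYd disjoint_compl_right
  have hmap := hind.map_prod_eq_prod_map_map (measurable_pi_apply i).aemeasurable hY.aemeasurable
  rw [(measurePreserving_eval (fun _ : ι => μ) i).map_eq] at hmap
  have hpm : Measurable fun x : ι → ℝ => (x i, Y x) := (measurable_pi_apply i).prodMk hY
  have hi' : Integrable (Function.uncurry G) (μ.prod ((iid ι μ).map Y)) := by
    rw [← hmap, integrable_map_measure hG.aestronglyMeasurable hpm.aemeasurable]
    exact hi
  have hin : ∀ a, ∫ x, G a (Y x) ∂iid ι μ = ∫ w, G a w ∂(iid ι μ).map Y := fun a =>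
    (integral_map hY.aemeasurable (hG.comp measurable_prodMk_left).aestronglyMeasurable).symm
  have : IsProbabilityMeasure ((iid ι μ).map Y) := Measure.isProbabilityMeasure_map hY.aemeasurable
  simp_rw [hin]
  refine ⟨hi'.integral_prod_left, ?_⟩
  have h1 : ∫ x, G (x i) (Y x) ∂iid ι μ
      = ∫ q, Function.uncurry G q ∂(iid ι μ).map (fun x => (x i, Y x)) :=
    (integral_map hpm.aemeasurable hG.aestronglyMeasurable).symm
  rw [h1, hmap, integral_prod _ hi']
  rfl

/-- The sum with one summand deleted. -/
noncomputable def sumDel (φ : ℝ → ℝ) (i : ι) (x : ι → ℝ) : ℝ := ∑ j ∈ Finset.univ.erase i, φ (x j)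

lemma sumDel_add (φ : ℝ → ℝ) (i : ι) (x : ι → ℝ) : sumDel φ i x + φ (x i) = ∑ j, φ (x j) := by
  rw [sumDel, add_comm, Finset.add_sum_erase _ (fun j => φ (x j)) (Finset.mem_univ i)]

lemma measurable_sumDel (hm : Measurable φ) (i : ι) : Measurable (sumDel φ i) :=
  measurable_sum_eval hm _

lemma dependsOn_sumDel (φ : ℝ → ℝ) (i : ι) : DependsOn (sumDel (ι := ι) φ i) {i}ᶜ :=
  (dependsOn_sum φ (Finset.univ.erase i)).mono fun j hj => by simpa using hj

/-- The mean of the derivative of the Stein solution at the sum with the summand `i` replaced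
by `t`. -/
noncomputable def meanD (μ : Measure ℝ) (φ : ℝ → ℝ) (i : ι) (z t : ℝ) : ℝ :=
  ∫ x, steinD z (sumDel φ i x + t) ∂iid ι μ

lemma integrable_steinD_comp {Y : (ι → ℝ) → ℝ} (hY : Measurable Y) (z : ℝ) :
    Integrable (fun x => steinD z (Y x)) (iid ι μ) :=
  (integrable_const (1 : ℝ)).mono' ((measurable_steinD z).comp hY).aestronglyMeasurable
    (ae_of_all _ fun _ => abs_steinD_le _ _)

lemma abs_meanD_le (i : ι) (z t : ℝ) : |meanD μ φ i z t| ≤ 1 := by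
  simpa [Real.norm_eq_abs, meanD] using norm_integral_le_of_norm_le_const (μ := iid ι μ) (C := 1)
    (f := fun x => steinD z (sumDel φ i x + t)) (ae_of_all _ fun x => abs_steinD_le _ _)

lemma measurable_meanD (hm : Measurable φ) (i : ι) (z : ℝ) : Measurable (meanD μ φ i z) := by
  have : Measurable fun q : ℝ × (ι → ℝ) => steinD z (sumDel φ i q.2 + q.1) :=
    (measurable_steinD z).comp (((measurable_sumDel hm i).comp measurable_snd).add measurable_fst)
  exact (this.stronglyMeasurable.integral_prod_right').measurable

lemma intervalIntegrable_meanD (hm : Measurable φ) (i : ι) (z a b : ℝ) :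
    IntervalIntegrable (meanD μ φ i z) volume a b :=
  (intervalIntegrable_const (c := (1 : ℝ))).mono_fun
    (measurable_meanD hm i z).aestronglyMeasurable
    (ae_of_all _ fun t => by simpa using abs_meanD_le i z t)

lemma integral_meanD (hm : Measurable φ) (i : ι) (z : ℝ) :
    Integrable (fun a => meanD μ φ i z (φ a)) μ ∧
    ∫ x, steinD z (∑ j, φ (x j)) ∂iid ι μ = ∫ a, meanD μ φ i z (φ a) ∂μ := by
  have hG : Measurable (Function.uncurry fun a w => steinD z (w + φ a)) :=
    (measurable_steinD z).comp (measurable_snd.add (hm.comp measurable_fst))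
  have h := integral_eval_prod (μ := μ) (measurable_sumDel hm i) (dependsOn_sumDel φ i) hG
    (integrable_steinD_comp ((measurable_sumDel hm i).add (hm.comp (measurable_pi_apply i))) z)
  simp only [sumDel_add] at h
  exact h

namespace Normalized

variable (h : Normalized ι μ φ p)
include h

/-- By independence `φ(xᵢ) f(W - φ(xᵢ))` has mean zero. Subtracting it leaves an increment of `f`,
hence an integral of `f'`, and Fubini averages over the other coordinates first. -/
lemma integral_mul_stein (i : ι) (z : ℝ) :
    Integrable (fun a => φ a * ∫ t in (0 : ℝ)..φ a, meanD μ φ i z t) μ ∧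
    ∫ x, φ (x i) * stein z (∑ j, φ (x j)) ∂iid ι μ
      = ∫ a, φ a * (∫ t in (0 : ℝ)..φ a, meanD μ φ i z t) ∂μ := by
  have hm := h.measurable
  have hYm := measurable_sumDel (ι := ι) hm i
  have hs := (continuous_stein z).measurable
  have hφi : Measurable fun x : ι → ℝ => φ (x i) := hm.comp (measurable_pi_apply i)
  have hφI : Integrable (fun x : ι → ℝ => φ (x i)) (iid ι μ) :=
    integrable_eval (h.memLp.integrable (by norm_num)) i
  have hbd : ∀ {Y : (ι → ℝ) → ℝ}, Measurable Y →
      Integrable (fun x => φ (x i) * stein z (Y x)) (iid ι μ) := fun {Y} hY =>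
    hφI.mul_bdd (c := 1.26) (hs.comp hY).aestronglyMeasurable
      (ae_of_all _ fun x => by
        rw [Real.norm_eq_abs, abs_of_nonneg (stein_nonneg _ _)]; exact stein_le_const _ _)
  have h1 : ∫ x, φ (x i) * stein z (sumDel φ i x) ∂iid ι μ = 0 := by
    rw [integral_mul_of_dependsOn hφi (G := fun x => stein z (sumDel φ i x)) (hs.comp hYm)
      (dependsOn_eval φ i)
      (fun x y hxy => by simp only [dependsOn_sumDel φ i hxy] :
        DependsOn (fun x => stein z (sumDel φ i x)) {i}ᶜ)
      disjoint_compl_right, integral_eval hm, h.mean, zero_mul]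
  have hG : Measurable (Function.uncurry fun a w =>
      φ a * (stein z (w + φ a) - stein z w)) := by
    have : Measurable (φ ∘ (Prod.fst : ℝ × ℝ → ℝ)) := hm.comp measurable_fst
    exact this.mul ((hs.comp (measurable_snd.add this)).sub (hs.comp measurable_snd))
  have hint : Integrable (fun x => φ (x i) *
      (stein z (sumDel φ i x + φ (x i)) - stein z (sumDel φ i x))) (iid ι μ) := by
    simp only [mul_sub]
    exact (hbd (hYm.add hφi)).sub (hbd hYm)
  have h2 := integral_eval_prod (μ := μ) hYm (dependsOn_sumDel φ i) hG hint
  have h3 : ∀ a, ∫ x, φ a * (stein z (sumDel φ i x + φ a) - stein z (sumDel φ i x)) ∂iid ι μ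
      = φ a * ∫ t in (0 : ℝ)..φ a, meanD μ φ i z t := by
    intro a
    rw [integral_const_mul]
    congr 1
    have h4 : ∀ x : ι → ℝ, stein z (sumDel φ i x + φ a) - stein z (sumDel φ i x)
        = ∫ t in (0 : ℝ)..φ a, steinD z (sumDel φ i x + t) := fun x => by
      rw [stein_sub, intervalIntegral.integral_comp_add_left (fun t => steinD z t), add_zero]
    simp_rw [h4, meanD]
    refine (intervalIntegral_integral_swap ?_).symm
    have : IsFiniteMeasure (volume.restrict (uIoc (0 : ℝ) (φ a))) :=
      ⟨by simp [uIoc]⟩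
    refine (integrable_const (1 : ℝ)).mono' ?_ (ae_of_all _ fun q => abs_steinD_le _ _)
    exact ((measurable_steinD z).comp ((hYm.comp measurable_snd).add
      measurable_fst)).aestronglyMeasurable
  simp_rw [h3] at h2
  refine ⟨h2.1, ?_⟩
  rw [← h2.2]
  have h5 := integral_sub (hbd (hYm.add hφi)) (hbd hYm)
  simp only [Pi.add_apply, sumDel_add, h1, sub_zero] at h5
  simp only [mul_sub, sumDel_add]
  exact h5.symm

/-- Stein's identity for the distribution function of the normalized sum. -/
lemma stein_identity (z : ℝ) :
    (iid ι μ).real {x | ∑ i, φ (x i) ≤ z} - Phi z =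
      ∑ i : ι, ∫ a, φ a * (∫ t in (0 : ℝ)..φ a,
        ((∫ b, meanD μ φ i z (φ b) ∂μ) - meanD μ φ i z t)) ∂μ := by
  have hm := h.measurable
  have hWm : Measurable fun x : ι → ℝ => ∑ j, φ (x j) := measurable_sum_eval hm _
  set M := ∫ x, steinD z (∑ j, φ (x j)) ∂iid ι μ with hM
  have hMi : ∀ i, ∫ b, meanD μ φ i z (φ b) ∂μ = M := fun i => (integral_meanD hm i z).2.symm
  have hs := (continuous_stein z).measurable
  have hφs : ∀ i, Integrable (fun x : ι → ℝ => φ (x i) * stein z (∑ j, φ (x j))) (iid ι μ) :=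
    fun i => (integrable_eval (h.memLp.integrable (by norm_num)) i).mul_bdd (c := 1.26)
      (hs.comp hWm).aestronglyMeasurable (ae_of_all _ fun x => by
        rw [Real.norm_eq_abs, abs_of_nonneg (stein_nonneg _ _)]; exact stein_le_const _ _)
  have hset : MeasurableSet {x : ι → ℝ | ∑ i, φ (x i) ≤ z} := measurableSet_le hWm measurable_const
  have hM2 : M = (∑ i : ι, ∫ x, φ (x i) * stein z (∑ j, φ (x j)) ∂iid ι μ)
      + (iid ι μ).real {x | ∑ i, φ (x i) ≤ z} - Phi z := by
    have e : ∀ x : ι → ℝ, steinD z (∑ j, φ (x j)) = (∑ i, φ (x i) * stein z (∑ j, φ (x j)))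
        + {x : ι → ℝ | ∑ i, φ (x i) ≤ z}.indicator (fun _ => (1 : ℝ)) x - Phi z := fun x => by
      rw [steinD, Finset.sum_mul]
      simp [indicator]
    rw [hM]
    simp_rw [e]
    have i1 := integrable_finsetSum Finset.univ fun i _ => hφs i
    have i2 : Integrable ({x : ι → ℝ | ∑ i, φ (x i) ≤ z}.indicator (fun _ => (1 : ℝ))) (iid ι μ) :=
      (integrable_const _).indicator hset
    have k1 := integral_sub (i1.add i2) (integrable_const (Phi z))
    simp only [Pi.add_apply] at k1
    rw [k1, integral_add i1 i2, integral_finsetSum _ fun i _ => hφs i, integral_indicator hset]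
    simp
  -- The normalization `n E φ² = 1` gives `E f'(W)` the same shape as `E W f(W)`, so the two can be
  -- compared summand by summand.
  have hMsum : M = ∑ i : ι, ∫ a, φ a * (∫ t in (0 : ℝ)..φ a, M) ∂μ := by
    have : ∀ a, φ a * (∫ t in (0 : ℝ)..φ a, M) = M * φ a ^ 2 := fun a => by
      simp; ring
    simp_rw [this]
    rw [integral_const_mul, Finset.sum_const, Finset.card_univ, nsmul_eq_mul, mul_left_comm,
      h.second, mul_one]
  have : (iid ι μ).real {x | ∑ i, φ (x i) ≤ z} - Phi z
      = M - ∑ i : ι, ∫ x, φ (x i) * stein z (∑ j, φ (x j)) ∂iid ι μ := by linarith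
  rw [this]
  nth_rewrite 1 [hMsum]
  rw [← Finset.sum_sub_distrib]
  refine Finset.sum_congr rfl fun i _ => ?_
  rw [(h.integral_mul_stein i z).2, ← integral_sub _ (h.integral_mul_stein i z).1]
  · refine integral_congr_ae (ae_of_all _ fun a => ?_)
    simp only
    rw [← mul_sub, hMi, intervalIntegral.integral_sub intervalIntegrable_const
      (intervalIntegrable_meanD hm i z _ _)]
  · have : ∀ a, φ a * (∫ t in (0 : ℝ)..φ a, M) = M * φ a ^ 2 := fun a => by
      simp; ring
    simp_rw [this]
    exact h.memLp.integrable_sq.const_mul M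

end Normalized
end

/-! ### The uniform Berry–Esseen bound for sums -/

section

variable {ι : Type*} [Fintype ι] [DecidableEq ι] {μ : Measure ℝ} [IsProbabilityMeasure μ]
  {φ : ℝ → ℝ} {p : ℝ}

/-- The mean of `w ↦ w f(w)` at the sum with one summand replaced by `u`. -/
noncomputable def meanH (μ : Measure ℝ) (φ : ℝ → ℝ) (i : ι) (z u : ℝ) : ℝ :=
  ∫ x, (sumDel φ i x + u) * stein z (sumDel φ i x + u) ∂iid ι μ

/-- The distribution function at `z` of the sum with one summand replaced by `u`. -/
noncomputable def meanP (μ : Measure ℝ) (φ : ℝ → ℝ) (i : ι) (z u : ℝ) : ℝ :=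
  (iid ι μ).real {x | sumDel φ i x + u ≤ z}

lemma abs_mul_stein_le (z w : ℝ) : |w * stein z w| ≤ 1 := by
  rw [abs_le]
  constructor <;> linarith [mul_stein_le z w, le_mul_stein z w, Phi_nonneg z, Phi_le_one z]

lemma integrable_mul_stein_comp {Y : (ι → ℝ) → ℝ} (hY : Measurable Y) (z : ℝ) :
    Integrable (fun x => Y x * stein z (Y x)) (iid ι μ) :=
  (integrable_const (1 : ℝ)).mono'
    (hY.mul ((continuous_stein z).measurable.comp hY)).aestronglyMeasurable
    (ae_of_all _ fun _ => abs_mul_stein_le _ _)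

/-- Stein's equation splits the derivative into an increasing part with Lipschitz control at zero
and a decreasing distribution function, which has no smoothness of its own and needs concentration.
-/
lemma meanD_eq (hm : Measurable φ) (i : ι) (z u : ℝ) :
    meanD μ φ i z u = meanH μ φ i z u + meanP μ φ i z u - Phi z := by
  have hY : Measurable fun x : ι → ℝ => sumDel φ i x + u := (measurable_sumDel hm i).add_const u
  have hset : MeasurableSet {x : ι → ℝ | sumDel φ i x + u ≤ z} := measurableSet_le hY measurable_const
  have e : ∀ x : ι → ℝ, steinD z (sumDel φ i x + u)
      = (sumDel φ i x + u) * stein z (sumDel φ i x + u)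
        + {x : ι → ℝ | sumDel φ i x + u ≤ z}.indicator (fun _ => (1 : ℝ)) x - Phi z := fun x => by
    simp [steinD, indicator]
  have i1 := integrable_mul_stein_comp (μ := μ) hY z
  have i2 : Integrable ({x : ι → ℝ | sumDel φ i x + u ≤ z}.indicator (fun _ => (1 : ℝ))) (iid ι μ) :=
    (integrable_const _).indicator hset
  rw [meanD]
  simp_rw [e]
  have k1 := integral_sub (i1.add i2) (integrable_const (Phi z))
  simp only [Pi.add_apply] at k1
  rw [k1, integral_add i1 i2, integral_indicator hset, meanH, meanP]
  simp

lemma meanH_mono (hm : Measurable φ) (i : ι) (z : ℝ) : Monotone (meanH μ φ i z) := fun u v huv =>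
  integral_mono (integrable_mul_stein_comp ((measurable_sumDel hm i).add_const u) z)
    (integrable_mul_stein_comp ((measurable_sumDel hm i).add_const v) z)
    fun x => mul_stein_mono z (by linarith)

lemma meanH_le (hm : Measurable φ) (i : ι) (z u : ℝ) : meanH μ φ i z u ≤ Phi z := by
  have := integral_mono (integrable_mul_stein_comp (μ := μ)
    ((measurable_sumDel hm i).add_const u) z) (integrable_const (Phi z))
    fun x => mul_stein_le z (sumDel φ i x + u)
  simpa [meanH] using this

lemma le_meanH (hm : Measurable φ) (i : ι) (z u : ℝ) : Phi z - 1 ≤ meanH μ φ i z u := by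
  have := integral_mono (integrable_const (Phi z - 1)) (integrable_mul_stein_comp (μ := μ)
    ((measurable_sumDel hm i).add_const u) z) fun x => le_mul_stein z (sumDel φ i x + u)
  simpa [meanH] using this

lemma meanP_anti (i : ι) (z : ℝ) : Antitone (meanP μ φ i z) := fun u v huv =>
  measureReal_mono fun x (hx : sumDel φ i x + v ≤ z) =>
    show sumDel φ i x + u ≤ z by linarith

/-- A bound on integrals of functions of at most linear growth near zero. -/
lemma abs_integral_le_of_growth {f : ℝ → ℝ} {A c : ℝ}
    (hfi : ∀ a b, IntervalIntegrable f volume a b)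
    (hf : ∀ t, |f t| ≤ A + (if |t| ≤ 1 then 2 * c * |t| else c)) (x : ℝ) :
    |∫ t in (0 : ℝ)..x, f t| ≤ A * |x| + c * min (x ^ 2) |x| := by
  -- The profile `2c|t|` up to `1` and `c` beyond integrates exactly to `c min(x², |x|)`, which
  -- after multiplication by `|x|` is at most `c |x|^p` for every `2 < p ≤ 3`.
  have key : ∀ {f : ℝ → ℝ}, (∀ a b, IntervalIntegrable f volume a b) →
      (∀ t, |f t| ≤ A + (if |t| ≤ 1 then 2 * c * |t| else c)) → ∀ x, 0 ≤ x →
      |∫ t in (0 : ℝ)..x, f t| ≤ A * x + c * min (x ^ 2) x := by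
    intro f hfi hf x hx
    have h1 : ∀ y, 0 ≤ y → y ≤ 1 → |∫ t in (0 : ℝ)..y, f t| ≤ A * y + c * y ^ 2 := by
      intro y hy hy1
      have := intervalIntegral.norm_integral_le_of_norm_le (μ := volume) (f := f)
        (g := fun t => A + 2 * c * t) hy
        (ae_of_all _ fun t ht => by
          have h2 := hf t
          have ht0 : |t| = t := abs_of_pos ht.1
          rw [ht0, if_pos (ht.2.trans hy1)] at h2
          exact h2) (Continuous.intervalIntegrable (by fun_prop) _ _)
      refine this.trans (le_of_eq ?_)
      rw [intervalIntegral.integral_add intervalIntegrable_const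
        (Continuous.intervalIntegrable (by fun_prop) _ _), intervalIntegral.integral_const_mul,
        integral_id, intervalIntegral.integral_const]
      simp only [sub_zero, smul_eq_mul]; ring
    rcases le_total x 1 with hx1 | hx1
    · rw [min_eq_left (by nlinarith)]
      exact h1 x hx hx1
    · rw [min_eq_right (by nlinarith)]
      rw [← intervalIntegral.integral_add_adjacent_intervals (hfi 0 1) (hfi 1 x)]
      have h2 := h1 1 zero_le_one le_rfl
      have h3 : |∫ t in (1 : ℝ)..x, f t| ≤ (A + c) * |x - 1| :=
        intervalIntegral.norm_integral_le_of_norm_le_const (C := A + c) (f := f) fun t ht => by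
          rw [uIoc_of_le hx1] at ht
          have h4 := hf t
          have h5 : ¬ |t| ≤ 1 := not_le.2 (ht.1.trans_le (le_abs_self t))
          rwa [if_neg h5] at h4
      rw [abs_of_nonneg (show 0 ≤ x - 1 by linarith)] at h3
      refine (abs_add_le _ _).trans ?_
      nlinarith
  rcases le_total 0 x with hx | hx
  · rw [abs_of_nonneg hx]; exact key hfi hf x hx
  · have h1 := key (f := fun t => f (-t)) (fun a b => by
        simpa using (hfi (-a) (-b)).comp_mul_left (c := -1))
      (fun t => by simpa using hf (-t)) (-x) (by linarith)
    rw [intervalIntegral.integral_comp_neg, neg_neg, neg_zero, intervalIntegral.integral_symm,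
      abs_neg] at h1
    rw [abs_of_nonpos hx]
    simpa using h1

namespace Normalized

variable (h : Normalized ι μ φ p)
include h

lemma integral_abs_sumDel_le (i : ι) : ∫ x, |sumDel φ i x| ∂iid ι μ ≤ 1 := by
  refine (h.integral_abs_sum_le (Finset.univ.erase i)).trans ?_
  rw [Real.sqrt_le_one]
  exact h.card_div_le_one _

lemma abs_meanH_sub_le (i : ι) (z u : ℝ) :
    |meanH μ φ i z u - meanH μ φ i z 0| ≤ 2.26 * |u| := by
  have hm := h.measurable
  have hY := measurable_sumDel (ι := ι) hm i
  have i1 : Integrable (fun x => |sumDel φ i x|) (iid ι μ) :=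
    ((memLp_sum_eval h.memLp (Finset.univ.erase i)).integrable (by norm_num)).abs
  rw [meanH, meanH, ← integral_sub (integrable_mul_stein_comp (hY.add_const u) z)
    (integrable_mul_stein_comp (hY.add_const 0) z)]
  refine abs_integral_le_integral_abs.trans ?_
  have h1 : ∫ x, |(sumDel φ i x + u) * stein z (sumDel φ i x + u)
      - (sumDel φ i x + 0) * stein z (sumDel φ i x + 0)| ∂iid ι μ
      ≤ ∫ x, (|sumDel φ i x| + 1.26) * |u| ∂iid ι μ :=
    integral_mono ((integrable_mul_stein_comp (hY.add_const u) z).sub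
      (integrable_mul_stein_comp (hY.add_const 0) z)).abs
      ((i1.add (integrable_const _)).mul_const _) fun x => by
        simpa using abs_mul_stein_sub_le z (sumDel φ i x) u
  rw [integral_mul_const, integral_add i1 (integrable_const _)] at h1
  simp only [integral_const, probReal_univ, smul_eq_mul, one_mul] at h1
  have h2 := h.integral_abs_sumDel_le i
  nlinarith [abs_nonneg u]

/-- For `u ≤ v` the difference is at most the probability that the deleted sum lies in `[z - v, z -
u]`. Concentration of the remaining `n - 1` summands applies, and `κ` absorbs `√(n/(n-1))`. -/
lemma meanP_sub_le (hL : lyap ι μ φ p ≤ 1 / 2) {κ : ℝ}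
    (hκ : Fintype.card ι ≤ κ ^ 2 * (Fintype.card ι - 1)) (hκ0 : 0 ≤ κ)
    (hn : (1 : ℝ) < Fintype.card ι) (i : ι) (z u v : ℝ) :
    meanP μ φ i z u - meanP μ φ i z v ≤ κ * (max (v - u) 0 + 1.5 * lyap ι μ φ p) := by
  have hL0 := h.lyap_pos
  rcases le_total v u with huv | huv
  · rw [max_eq_right (by linarith)]
    have := meanP_anti (μ := μ) (φ := φ) i z huv
    have : 0 ≤ κ * (0 + 1.5 * lyap ι μ φ p) := by positivity
    linarith
  rw [max_eq_left (by linarith)]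
  have hm := h.measurable
  have hY := measurable_sumDel (ι := ι) hm i
  have hcard : ((Finset.univ.erase i).card : ℝ) = Fintype.card ι - 1 := by
    rw [Finset.card_erase_of_mem (Finset.mem_univ i), Finset.card_univ, Nat.cast_sub]
    · simp
    · exact_mod_cast hn.le
  have hne : (Finset.univ.erase i).Nonempty := by
    rw [← Finset.card_pos]; have : (0 : ℝ) < (Finset.univ.erase i).card := by rw [hcard]; linarith
    exact_mod_cast this
  have hc := h.concentration hL hne (V := fun _ => 0) (B := univ) MeasurableSet.univ
    (fun _ _ _ => rfl) measurable_const (fun _ _ _ => rfl) (a := z - v) (b := z - u) (by linarith)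
  rw [hcard] at hc
  simp only [add_zero, univ_inter, probReal_univ, one_mul] at hc
  have hs : √((Fintype.card ι : ℝ) / (Fintype.card ι - 1)) ≤ κ := by
    rw [Real.sqrt_le_left hκ0, div_le_iff₀ (by linarith)]; exact hκ
  have h1 : meanP μ φ i z u - meanP μ φ i z v
      ≤ (iid ι μ).real {x | z - v ≤ sumDel φ i x ∧ sumDel φ i x ≤ z - u} := by
    rw [sub_le_iff_le_add, add_comm, meanP, meanP]
    refine le_trans (measureReal_mono fun x (hx : sumDel φ i x + u ≤ z) => ?_) (measureReal_union_le _ _)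
    by_cases hxv : sumDel φ i x + v ≤ z
    · exact Or.inl hxv
    · exact Or.inr ⟨by linarith [not_le.1 hxv], by linarith⟩
  refine (h1.trans hc).trans ?_
  rw [show z - u - (z - v) = v - u by ring]
  exact mul_le_mul_of_nonneg_right hs (by linarith)

/-- In the first bound a positive `u` is felt only through `meanH`, with slope `2.26`, and a
negative `u` only through `meanP`, with slope `1.02`; `1.64|u| + 0.62u` records both, and the second
bound reverses the roles. When `u` is later averaged over a centred variable, the term `0.62u`
disappears. Further, `1.53 = 1.02 · 1.5`. In `v` the worse slope `2.26 = 2 · 1.13` is used up to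
`|v| = 1`, after which the boundedness of `meanH` and `meanP` takes over. -/
lemma abs_meanD_sub_le (hL : lyap ι μ φ p ≤ 1 / 2)
    (hκ : Fintype.card ι ≤ (1.02 : ℝ) ^ 2 * (Fintype.card ι - 1))
    (hn : (1 : ℝ) < Fintype.card ι) (i : ι) (z u v : ℝ) :
    meanD μ φ i z u - meanD μ φ i z v ≤ 1.64 * |u| + 0.62 * u + 1.53 * lyap ι μ φ p
        + (if |v| ≤ 1 then 2 * 1.13 * |v| else 1.13) ∧
    meanD μ φ i z v - meanD μ φ i z u ≤ 1.64 * |u| - 0.62 * u + 1.53 * lyap ι μ φ p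
        + (if |v| ≤ 1 then 2 * 1.13 * |v| else 1.13) := by
  have hm := h.measurable
  have hL0 := h.lyap_pos
  have p1 := h.meanP_sub_le hL hκ (by norm_num) hn i z u v
  have p2 := h.meanP_sub_le hL hκ (by norm_num) hn i z v u
  have hH := meanH_mono (μ := μ) hm i z
  have hu := h.abs_meanH_sub_le i z u
  have hv := h.abs_meanH_sub_le i z v
  have P0 : ∀ t, 0 ≤ meanP μ φ i z t := fun t => measureReal_nonneg
  have P1 : ∀ t, meanP μ φ i z t ≤ 1 := fun t => measureReal_le_one
  have q1 := P0 u
  have q2 := P0 v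
  have q3 := P1 u
  have q4 := P1 v
  have r1 := meanH_le (μ := μ) hm i z 0
  have r2 := meanH_le (μ := μ) hm i z v
  have r3 := le_meanH (μ := μ) hm i z 0
  have r4 := le_meanH (μ := μ) hm i z v
  simp only [meanD_eq hm]
  set L := lyap ι μ φ p
  set Hu := meanH μ φ i z u
  set Hv := meanH μ φ i z v
  set H0 := meanH μ φ i z 0
  have hu1 := (abs_le.1 hu).1
  have hu2 := (abs_le.1 hu).2
  have hv1 := (abs_le.1 hv).1
  have hv2 := (abs_le.1 hv).2
  have su : (0 ≤ u ∧ |u| = u ∧ H0 ≤ Hu ∧ max u 0 = u ∧ max (-u) 0 = 0) ∨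
      (u ≤ 0 ∧ |u| = -u ∧ Hu ≤ H0 ∧ max u 0 = 0 ∧ max (-u) 0 = -u) := by
    rcases le_total 0 u with k | k
    · exact Or.inl ⟨k, abs_of_nonneg k, hH k, max_eq_left k, max_eq_right (by linarith)⟩
    · exact Or.inr ⟨k, abs_of_nonpos k, hH k, max_eq_right k, max_eq_left (by linarith)⟩
  have sv : (0 ≤ v ∧ |v| = v ∧ H0 ≤ Hv ∧ max v 0 = v ∧ max (-v) 0 = 0) ∨
      (v ≤ 0 ∧ |v| = -v ∧ Hv ≤ H0 ∧ max v 0 = 0 ∧ max (-v) 0 = -v) := by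
    rcases le_total 0 v with k | k
    · exact Or.inl ⟨k, abs_of_nonneg k, hH k, max_eq_left k, max_eq_right (by linarith)⟩
    · exact Or.inr ⟨k, abs_of_nonpos k, hH k, max_eq_right k, max_eq_left (by linarith)⟩
  have m1 : max (v - u) 0 ≤ max v 0 + max (-u) 0 :=
    max_le (by linarith [le_max_left v 0, le_max_left (-u) 0])
      (by linarith [le_max_right v 0, le_max_right (-u) 0])
  have m2 : max (u - v) 0 ≤ max u 0 + max (-v) 0 :=
    max_le (by linarith [le_max_left u 0, le_max_left (-v) 0])
      (by linarith [le_max_right u 0, le_max_right (-v) 0])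
  rcases su with ⟨a1, a2, a3, a4, a5⟩ | ⟨a1, a2, a3, a4, a5⟩ <;>
  rcases sv with ⟨b1, b2, b3, b4, b5⟩ | ⟨b1, b2, b3, b4, b5⟩ <;>
  split_ifs with hs <;> constructor <;> linarith

/-- The Berry–Esseen theorem for normalized sums of i.i.d. variables with finite moments of
order `p`. -/
theorem berry_esseen (hL : 6.1 * lyap ι μ φ p ≤ 1) (z : ℝ) :
    |(iid ι μ).real {x | ∑ i, φ (x i) ≤ z} - Phi z| ≤ 4.3 * lyap ι μ φ p := by
  have hm := h.measurable
  have hL0 := h.lyap_pos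
  have hn0 := h.card_pos
  have hsq := h.inv_sqrt_card_le
  have hE := h.integral_abs_le
  set L := lyap ι μ φ p with hLdef
  set n : ℝ := (Fintype.card ι : ℝ) with hndef
  -- Lyapunov's inequality `1/√n ≤ L` and `6.1 L ≤ 1` force `√n ≥ 6.1`, which makes `κ = 1.02`
  -- admissible.
  have hn37 : 37 < n := by
    have h1 : 1 ≤ L * √n := by
      rwa [inv_le_iff_one_le_mul₀ (by positivity)] at hsq
    have h2 : (6.1 : ℝ) ≤ √n := by nlinarith [Real.sqrt_nonneg n]
    have h3 := Real.sq_sqrt hn0.le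
    nlinarith
  have hκ : n ≤ (1.02 : ℝ) ^ 2 * (n - 1) := by norm_num; linarith
  have hb := fun i : ι => h.abs_meanD_sub_le (by linarith) hκ (by linarith) i
  -- Here `E|φ| ≤ 1/√n ≤ L` and `E φ = 0`, so the constant is `1.64 + 1.53 = 3.17`.
  have hmean : ∀ i : ι, ∀ t, |(∫ b, meanD μ φ i z (φ b) ∂μ) - meanD μ φ i z t|
      ≤ 3.17 * L + (if |t| ≤ 1 then 2 * 1.13 * |t| else 1.13) := by
    intro i t
    set ϕ : ℝ := if |t| ≤ 1 then 2 * 1.13 * |t| else 1.13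
    have hI := (integral_meanD (ι := ι) (μ := μ) hm i z).1
    have hφ := h.memLp.integrable (by norm_num)
    have c1 : ∫ b, (meanD μ φ i z (φ b) - meanD μ φ i z t) ∂μ
        ≤ ∫ b, (1.64 * |φ b| + 0.62 * φ b + (1.53 * L + ϕ)) ∂μ :=
      integral_mono (hI.sub (integrable_const _)) (((hφ.abs.const_mul _).add (hφ.const_mul _)).add
        (integrable_const _)) fun b => ((hb i z (φ b) t).1).trans (le_of_eq (by ring))
    have c2 : ∫ b, (meanD μ φ i z t - meanD μ φ i z (φ b)) ∂μ
        ≤ ∫ b, (1.64 * |φ b| + (-0.62) * φ b + (1.53 * L + ϕ)) ∂μ :=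
      integral_mono ((integrable_const _).sub hI) (((hφ.abs.const_mul _).add (hφ.const_mul _)).add
        (integrable_const _)) fun b => ((hb i z (φ b) t).2).trans (le_of_eq (by ring))
    have e : ∀ c : ℝ, ∫ b, (1.64 * |φ b| + c * φ b + (1.53 * L + ϕ)) ∂μ
        = 1.64 * (∫ b, |φ b| ∂μ) + (1.53 * L + ϕ) := fun c => by
      have k1 := integral_add ((hφ.abs.const_mul 1.64).add (hφ.const_mul c))
        (integrable_const (1.53 * L + ϕ))
      simp only [Pi.add_apply] at k1
      rw [k1, integral_add (hφ.abs.const_mul _) (hφ.const_mul c), integral_const_mul,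
        integral_const_mul, h.mean]
      simp
    rw [e, integral_sub hI (integrable_const _)] at c1
    rw [e, integral_sub (integrable_const _) hI] at c2
    simp only [integral_const, probReal_univ, smul_eq_mul, one_mul] at c1 c2
    rw [abs_le]
    constructor <;> linarith
  rw [h.stein_identity z]
  -- The second moment contributes `3.17` and the `p`-th moment `1.13`, in total `4.3`.
  have hterm : ∀ i : ι, |∫ a, φ a * (∫ t in (0 : ℝ)..φ a,
      ((∫ b, meanD μ φ i z (φ b) ∂μ) - meanD μ φ i z t)) ∂μ| ≤ 4.3 * L / n := by
    intro i
    have hg : ∀ a, |φ a * (∫ t in (0 : ℝ)..φ a,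
        ((∫ b, meanD μ φ i z (φ b) ∂μ) - meanD μ φ i z t))|
        ≤ 3.17 * L * φ a ^ 2 + 1.13 * |φ a| ^ p := by
      intro a
      have h1 := abs_integral_le_of_growth (A := 3.17 * L) (c := 1.13)
        (fun a b => intervalIntegrable_const.sub (intervalIntegrable_meanD hm i z a b))
        (hmean i) (φ a)
      rw [abs_mul]
      have h2 : |φ a| * min (φ a ^ 2) |φ a| ≤ |φ a| ^ p := by
        have hx := abs_nonneg (φ a)
        rw [← sq_abs]
        set x := |φ a|
        rcases le_total x 1 with k | k
        · have h3 : x ^ 3 ≤ x ^ p := by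
            rcases hx.eq_or_lt with h0 | h0
            · rw [← h0, Real.zero_rpow (by linarith [h.two_lt])]; norm_num
            · rw [← Real.rpow_natCast]
              exact Real.rpow_le_rpow_of_exponent_ge h0 k (by push_cast; exact h.le_three)
          refine le_trans ?_ h3
          rw [show x ^ 3 = x * x ^ 2 by ring]
          exact mul_le_mul_of_nonneg_left (min_le_left _ _) hx
        · have h3 : x ^ 2 ≤ x ^ p := by
            rw [← Real.rpow_natCast]
            exact Real.rpow_le_rpow_of_exponent_le k (by push_cast; linarith [h.two_lt])
          refine le_trans ?_ h3
          rw [sq]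
          exact mul_le_mul_of_nonneg_left (min_le_right _ _) hx
      have h4 := mul_le_mul_of_nonneg_left h1 (abs_nonneg (φ a))
      have h5 : |φ a| * |φ a| = φ a ^ 2 := by rw [← sq, sq_abs]
      nlinarith
    have h6 := norm_integral_le_of_norm_le (f := fun a => φ a * (∫ t in (0 : ℝ)..φ a,
        ((∫ b, meanD μ φ i z (φ b) ∂μ) - meanD μ φ i z t)))
      (g := fun a => 3.17 * L * φ a ^ 2 + 1.13 * |φ a| ^ p)
      ((h.memLp.integrable_sq.const_mul (3.17 * L)).add (h.integrable.const_mul 1.13))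
      (ae_of_all μ hg)
    rw [integral_add (h.memLp.integrable_sq.const_mul _) (h.integrable.const_mul _),
      integral_const_mul, integral_const_mul, h.second_eq] at h6
    refine h6.trans (le_of_eq ?_)
    have h7 : ∫ a, |φ a| ^ p ∂μ = L / n := by
      rw [hLdef, lyap, mul_div_cancel_left₀ _ hn0.ne']
    rw [h7]; ring
  refine (Finset.abs_sum_le_sum_abs _ _).trans ((Finset.sum_le_sum fun i _ => hterm i).trans ?_)
  rw [Finset.sum_const, Finset.card_univ, nsmul_eq_mul, mul_div_cancel₀ _ hn0.ne']

end Normalized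
end

/-! ### Tails and concentration far out, without large summands -/

lemma exp_le_quadratic {u M : ℝ} (hM : 0 ≤ M) (hu : u ≤ M) :
    Real.exp u ≤ 1 + u + u ^ 2 * Real.exp M := by
  have hM1 : 1 ≤ Real.exp M := Real.one_le_exp hM
  rcases le_total 0 u with h | h
  · have h1 : Real.exp u * (1 - u) ≤ 1 := by
      have := Real.add_one_le_exp (-u)
      have h2 := Real.exp_pos u
      have h3 : Real.exp u * Real.exp (-u) = 1 := by rw [← Real.exp_add]; simp
      nlinarith
    have h2 : Real.exp u ≤ Real.exp M := Real.exp_le_exp.2 hu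
    nlinarith [mul_nonneg h h, mul_le_mul_of_nonneg_left h2 (mul_nonneg h h)]
  · have h1 : Real.exp u * (1 - u) ≤ 1 := by
      have := Real.add_one_le_exp (-u)
      have h2 := Real.exp_pos u
      have h3 : Real.exp u * Real.exp (-u) = 1 := by rw [← Real.exp_add]; simp
      nlinarith
    have h2 : Real.exp u ≤ 1 + u + u ^ 2 := by
      have h4 : 1 ≤ (1 + u + u ^ 2) * (1 - u) := by nlinarith [mul_nonneg (sq_nonneg u) (neg_nonneg.2 h)]
      by_contra hc
      push Not at hc
      nlinarith [mul_lt_mul_of_pos_right hc (show 0 < 1 - u by linarith)]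
    nlinarith [sq_nonneg u]

/-- Apply `log r ≤ r - 1` to `r = √y`. For the tilt `t = log y / y` this says `t² y ≤ 4`, the
second-order bound in `real_farEvent_le`. -/
lemma sq_log_le {y : ℝ} (hy : 1 ≤ y) : Real.log y ^ 2 ≤ 4 * y := by
  have h0 : 0 < √y := by positivity
  have h1 : Real.log y = 2 * Real.log √y := by rw [Real.log_sqrt (by linarith)]; ring
  have h2 := Real.log_le_sub_one_of_pos h0
  have h3 := Real.sq_sqrt (show 0 ≤ y by linarith)
  have h4 := Real.log_nonneg hy
  nlinarith

/-- The constant in the tail bound for sums without large summands. -/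
noncomputable def tailC : ℝ := Real.exp 4 * 8 ^ 8

lemma tailC_pos : 0 < tailC := by unfold tailC; positivity

section

variable {ι : Type*} [Fintype ι] [DecidableEq ι] {μ : Measure ℝ} [IsProbabilityMeasure μ]
  {φ : ℝ → ℝ} {p : ℝ}

/-- The event that the sum over `J` is at least `x` although no summand exceeds `x / 8`. -/
def farEvent (φ : ℝ → ℝ) (J : Finset ι) (x : ℝ) : Set (ι → ℝ) :=
  {ω | x ≤ ∑ j ∈ J, φ (ω j) ∧ ∀ j ∈ J, φ (ω j) ≤ x / 8}

/-- The event that no summand in `J` exceeds `y`. -/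
def smallEvent (φ : ℝ → ℝ) (J : Finset ι) (y : ℝ) : Set (ι → ℝ) := {ω | ∀ j ∈ J, φ (ω j) ≤ y}

lemma measurableSet_smallEvent (hm : Measurable φ) (J : Finset ι) (y : ℝ) :
    MeasurableSet (smallEvent φ J y) := by
  have : smallEvent φ J y = ⋂ j ∈ J, {ω : ι → ℝ | φ (ω j) ≤ y} := by
    ext; simp [smallEvent]
  rw [this]
  exact Finset.measurableSet_biInter J fun j _ =>
    measurableSet_le (hm.comp (measurable_pi_apply j)) measurable_const

lemma measurableSet_farEvent (hm : Measurable φ) (J : Finset ι) (x : ℝ) :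
    MeasurableSet (farEvent φ J x) :=
  (measurableSet_le measurable_const (measurable_sum_eval hm J)).inter
    (measurableSet_smallEvent hm J (x / 8))

lemma dependsOn_farEvent (φ : ℝ → ℝ) (J : Finset ι) (x : ℝ) :
    DependsOn (fun ω => ω ∈ farEvent φ J x) (J : Set ι) := fun a b hab => by
  have h1 : ∑ j ∈ J, φ (a j) = ∑ j ∈ J, φ (b j) := dependsOn_sum φ J hab
  have h2 : ∀ j ∈ J, φ (a j) = φ (b j) := fun j hj => by rw [hab j hj]
  simp only [farEvent, mem_ofPred_eq, h1, eq_iff_iff, and_congr_right_iff]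
  intro _
  exact forall₂_congr fun j hj => by rw [h2 j hj]

lemma farEvent_mono_of_small (J : Finset ι) {x y : ℝ} (hy : y ≤ x / 8) :
    smallEvent φ J y ∩ {ω | x ≤ ∑ j ∈ J, φ (ω j)} ⊆ farEvent φ J x := fun _ hω =>
  ⟨hω.2, fun j hj => (hω.1 j hj).trans hy⟩

namespace Normalized

variable (h : Normalized ι μ φ p)
include h

/-- A sum without large summands has light tails. -/
theorem real_farEvent_le (J : Finset ι) {x : ℝ} (hx : 8 ≤ x) :
    (iid ι μ).real (farEvent φ J x) ≤ tailC * (x ^ 8)⁻¹ := by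
  have hm := h.measurable
  have hn := h.card_pos
  set y := x / 8 with hy
  have hy1 : 1 ≤ y := by rw [hy]; linarith
  have hy0 : 0 < y := by linarith
  -- The tilt satisfies `exp(ty) = y`, so truncated exponentials are bounded by `y`. Their means are
  -- at most `1 + 4 E φ² ≤ exp(4/n)`, and `exp(-tx) = y^(-8)` because `x = 8y`.
  set t := Real.log y / y with ht
  have ht0 : 0 ≤ t := div_nonneg (Real.log_nonneg hy1) hy0.le
  have hty : t * y = Real.log y := by rw [ht]; field_simp
  set k : ι → ℝ → ℝ := fun i a =>
    if i ∈ J then (if φ a ≤ y then Real.exp (t * φ a) else 0) else 1 with hk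
  have hk0 : ∀ i a, 0 ≤ k i a := fun i a => by
    simp only [hk]; split_ifs <;> positivity
  have hkm : ∀ i, Measurable (k i) := fun i => by
    by_cases hi : i ∈ J
    · simp only [hk, hi, if_true]
      exact Measurable.ite (measurableSet_le hm measurable_const)
        (Real.measurable_exp.comp (hm.const_mul t)) measurable_const
    · simp only [hk, hi, if_false]; exact measurable_const
  have hkb : ∀ i a, k i a ≤ y := fun i a => by
    simp only [hk]; split_ifs with h1 h2
    · calc Real.exp (t * φ a) ≤ Real.exp (t * y) :=
          Real.exp_le_exp.2 (mul_le_mul_of_nonneg_left h2 ht0)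
        _ = y := by rw [hty, Real.exp_log hy0]
    · exact hy0.le
    · exact hy1
  have hki : ∀ i, Integrable (k i) μ := fun i =>
    (integrable_const y).mono' (hkm i).aestronglyMeasurable (ae_of_all _ fun a => by
      rw [Real.norm_eq_abs, abs_of_nonneg (hk0 i a)]; exact hkb i a)
  have hkint : ∀ i, ∫ a, k i a ∂μ ≤ Real.exp (4 / Fintype.card ι) := fun i => by
    have hpt : ∀ a, k i a ≤ 1 + (if i ∈ J then t else 0) * φ a + 4 * φ a ^ 2 := by
      intro a
      by_cases hi : i ∈ J
      swap
      · simp only [hk, hi, if_false]; nlinarith [sq_nonneg (φ a)]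
      simp only [hk, hi, if_true]
      split_ifs with h2
      · have h3 := exp_le_quadratic (u := t * φ a) (M := t * y) (mul_nonneg ht0 hy0.le)
          (mul_le_mul_of_nonneg_left h2 ht0)
        rw [hty, Real.exp_log hy0] at h3
        have h4 : t ^ 2 * y ≤ 4 := by
          have h5 := sq_log_le hy1
          rw [← hty] at h5
          have : (t ^ 2 * y) * y ≤ 4 * y := by nlinarith
          exact le_of_mul_le_mul_right this hy0
        nlinarith [sq_nonneg (φ a)]
      · have : 0 ≤ t * φ a := mul_nonneg ht0 (by linarith)
        nlinarith [sq_nonneg (φ a)]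
    have hφ := h.memLp.integrable (by norm_num)
    have i1 : Integrable (fun a => 1 + (if i ∈ J then t else 0) * φ a) μ :=
      (integrable_const 1).add (hφ.const_mul _)
    have h5 := integral_mono (hki i) (i1.add (h.memLp.integrable_sq.const_mul 4)) hpt
    simp only [Pi.add_apply] at h5
    rw [integral_add i1 (h.memLp.integrable_sq.const_mul 4),
      integral_add (integrable_const 1) (hφ.const_mul _), integral_const_mul, integral_const_mul,
      h.mean, h.second_eq] at h5
    simp only [integral_const, probReal_univ, smul_eq_mul, mul_one, mul_zero, add_zero] at h5
    refine h5.trans ?_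
    rw [← div_eq_mul_inv]
    linarith [Real.add_one_le_exp (4 / (Fintype.card ι : ℝ))]
  have hprod : ∫ ω, ∏ i, k i (ω i) ∂iid ι μ ≤ Real.exp 4 := by
    rw [iid, integral_fintype_prod_eq_prod]
    calc ∏ i, ∫ a, k i a ∂μ ≤ ∏ _i : ι, Real.exp (4 / Fintype.card ι) :=
          Finset.prod_le_prod (fun i _ => integral_nonneg (hk0 i)) fun i _ => hkint i
      _ = Real.exp 4 := by
          rw [Finset.prod_const, Finset.card_univ, ← Real.exp_nat_mul]
          congr 1; field_simp
  have hpt : ∀ ω, (farEvent φ J x).indicator (fun _ => (1 : ℝ)) ω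
      ≤ Real.exp (-(t * x)) * ∏ i, k i (ω i) := by
    intro ω
    by_cases hω : ω ∈ farEvent φ J x
    swap
    · rw [indicator_of_notMem hω]
      exact mul_nonneg (Real.exp_pos _).le (Finset.prod_nonneg fun i _ => hk0 i _)
    rw [indicator_of_mem hω]
    have h6 : ∏ i, k i (ω i) = Real.exp (t * ∑ j ∈ J, φ (ω j)) := by
      rw [Finset.mul_sum, Real.exp_sum, ← Finset.prod_subset (Finset.subset_univ J)]
      · exact Finset.prod_congr rfl fun j hj => by simp [hk, hj, hω.2 j hj, hy]
      · intro j _ hj; simp [hk, hj]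
    rw [h6, ← Real.exp_add]
    refine Real.one_le_exp ?_
    have := mul_le_mul_of_nonneg_left hω.1 ht0
    linarith
  have hkI : Integrable (fun ω => ∏ i, k i (ω i)) (iid ι μ) :=
    Integrable.fintype_prod (f := k) hki
  have hmain := integral_mono ((integrable_const (1 : ℝ)).indicator
    (measurableSet_farEvent hm J x)) (hkI.const_mul (Real.exp (-(t * x)))) hpt
  rw [integral_indicator (measurableSet_farEvent hm J x), integral_const_mul] at hmain
  simp only [integral_const, smul_eq_mul, mul_one, measureReal_restrict_apply, univ_inter,
    MeasurableSet.univ] at hmain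
  refine hmain.trans ?_
  have h7 : Real.exp (-(t * x)) = 8 ^ 8 * (x ^ 8)⁻¹ := by
    have : t * x = 8 * Real.log y := by rw [← hty, hy]; ring
    rw [this, Real.exp_neg, show (8 : ℝ) * Real.log y = (8 : ℕ) * Real.log y by norm_num,
      Real.exp_nat_mul, Real.exp_log hy0, hy, div_pow, inv_div, div_eq_mul_inv]
  rw [h7, tailC]
  calc 8 ^ 8 * (x ^ 8)⁻¹ * ∫ ω, ∏ i, k i (ω i) ∂iid ι μ
      ≤ 8 ^ 8 * (x ^ 8)⁻¹ * Real.exp 4 := by gcongr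
    _ = _ := by ring

/-- Markov's inequality for a single summand. -/
lemma real_large_le {y : ℝ} (hy : 0 < y) :
    μ.real {a | y < |φ a|} ≤ lyap ι μ φ p * y ^ (-p) / Fintype.card ι := by
  have hm := h.measurable
  have hset : MeasurableSet {a | y < |φ a|} := measurableSet_lt measurable_const hm.abs
  have hpt : ∀ a, {a | y < |φ a|}.indicator (fun _ => (1 : ℝ)) a ≤ y ^ (-p) * |φ a| ^ p := by
    intro a
    by_cases ha : y < |φ a|
    · rw [indicator_of_mem (show a ∈ {a | y < |φ a|} from ha), Real.rpow_neg hy.le,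
        ← div_eq_inv_mul, one_le_div (by positivity)]
      exact Real.rpow_le_rpow hy.le ha.le (by linarith [h.two_lt])
    · rw [indicator_of_notMem (show a ∉ {a | y < |φ a|} from ha)]; positivity
  have h1 := h.integral_le_lyap hpt ((integrable_const _).indicator hset)
  rw [integral_indicator hset] at h1
  simp only [integral_const, smul_eq_mul, mul_one, measureReal_restrict_apply, univ_inter,
    MeasurableSet.univ] at h1
  rwa [mul_comm (y ^ (-p))] at h1

lemma real_compl_smallEvent_le (J : Finset ι) {y : ℝ} (hy : 0 < y) :
    (iid ι μ).real (smallEvent φ J y)ᶜ ≤ lyap ι μ φ p * y ^ (-p) := by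
  have hm := h.measurable
  have hn := h.card_pos
  have hset : MeasurableSet {a | y < |φ a|} := measurableSet_lt measurable_const hm.abs
  have h1 : (smallEvent φ J y)ᶜ ⊆ ⋃ j ∈ J, {ω : ι → ℝ | y < |φ (ω j)|} := fun ω hω => by
    simp only [smallEvent, mem_compl_iff, mem_ofPred_eq, not_forall, not_le] at hω
    obtain ⟨j, hj, hlt⟩ := hω
    exact mem_biUnion hj (hlt.trans_le (le_abs_self _))
  refine (measureReal_mono h1 (measure_ne_top _ _)).trans ((measureReal_biUnion_finset_le _ _).trans ?_)
  have h2 : ∀ j, (iid ι μ).real {ω : ι → ℝ | y < |φ (ω j)|} = μ.real {a | y < |φ a|} := fun j =>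
    (measurePreserving_eval (fun _ : ι => μ) j).measureReal_preimage hset.nullMeasurableSet
  simp only [h2]
  rw [Finset.sum_const, nsmul_eq_mul]
  have h3 := h.real_large_le hy
  have h4 : (J.card : ℝ) ≤ Fintype.card ι := by exact_mod_cast J.card_le_univ
  calc (J.card : ℝ) * μ.real {a | y < |φ a|}
      ≤ Fintype.card ι * (lyap ι μ φ p * y ^ (-p) / Fintype.card ι) := by gcongr
    _ = _ := by field_simp

/-- Concentration without a restriction on the Lyapunov ratio. -/
lemma concentration' {I : Finset ι} (hI : (Fintype.card ι : ℝ) ≤ 4 * I.card)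
    {V : (ι → ℝ) → ℝ} {B : Set (ι → ℝ)} (hB : MeasurableSet B)
    (hBd : DependsOn (fun x => x ∈ B) (I : Set ι)ᶜ)
    (hV : Measurable V) (hVd : DependsOn V (I : Set ι)ᶜ) {a b : ℝ} (hab : a ≤ b) :
    (iid ι μ).real (B ∩ {x | a ≤ ∑ i ∈ I, φ (x i) + V x ∧ ∑ i ∈ I, φ (x i) + V x ≤ b}) ≤
      (iid ι μ).real B * (2 * (b - a + 2 * lyap ι μ φ p)) := by
  have hL0 := h.lyap_pos
  have hn := h.card_pos
  have hB0 : 0 ≤ (iid ι μ).real B := measureReal_nonneg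
  rcases le_total (lyap ι μ φ p) (1 / 2) with hL | hL
  · have hIpos : (0 : ℝ) < I.card := by linarith
    refine (h.concentration hL (Finset.card_pos.1 (by exact_mod_cast hIpos)) hB hBd hV hVd
      hab).trans ?_
    refine mul_le_mul_of_nonneg_left ?_ hB0
    have hs : √((Fintype.card ι : ℝ) / I.card) ≤ 2 := by
      rw [Real.sqrt_le_left (by norm_num), div_le_iff₀ hIpos]; linarith
    exact mul_le_mul hs (by linarith) (by linarith) (by norm_num)
  -- For `L ≥ 1/2` the second factor on the right exceeds one.
  · refine (measureReal_mono inter_subset_left).trans ?_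
    nlinarith

/-- Concentration of the full sum over `J ∪ J'` in a short interval far out in the right tail. -/
lemma real_far_interval_le {S : Finset ι} (hS : ∃ J J' : Finset ι, Disjoint J J' ∧ J ∪ J' = S ∧
      (Fintype.card ι : ℝ) ≤ 4 * J.card ∧ (Fintype.card ι : ℝ) ≤ 4 * J'.card)
    {x a b : ℝ} (hx : 8 ≤ x) (hxa : 2 * x ≤ a) (hab : a ≤ b) :
    (iid ι μ).real (smallEvent φ S (x / 8) ∩ {ω | a ≤ ∑ i ∈ S, φ (ω i) ∧ ∑ i ∈ S, φ (ω i) ≤ b}) ≤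
      tailC * (x ^ 8)⁻¹ * (4 * (b - a + 2 * lyap ι μ φ p)) := by
  obtain ⟨J, J', hd, rfl, hJ, hJ'⟩ := hS
  have hL0 := h.lyap_pos
  have hm := h.measurable
  have key : ∀ J J' : Finset ι, Disjoint J J' → (Fintype.card ι : ℝ) ≤ 4 * J'.card →
      (iid ι μ).real (farEvent φ J x ∩ {ω | a ≤ ∑ i ∈ J', φ (ω i) + ∑ i ∈ J, φ (ω i) ∧
        ∑ i ∈ J', φ (ω i) + ∑ i ∈ J, φ (ω i) ≤ b})
      ≤ tailC * (x ^ 8)⁻¹ * (2 * (b - a + 2 * lyap ι μ φ p)) := by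
    intro J J' hd hJ'
    have hsub : (J : Set ι) ⊆ (J' : Set ι)ᶜ := fun i hi hi' =>
      Finset.disjoint_left.1 hd hi hi'
    refine (h.concentration' hJ' (measurableSet_farEvent hm J x)
      ((dependsOn_farEvent φ J x).mono hsub) (measurable_sum_eval hm J)
      ((dependsOn_sum φ J).mono hsub) hab).trans ?_
    exact mul_le_mul_of_nonneg_right (h.real_farEvent_le J hx) (by linarith)
  -- A sum of at least `2x` has a half of at least `x`. That half makes the event rare, and the
  -- other, independent half makes the interval unlikely.
  have hsub : smallEvent φ (J ∪ J') (x / 8) ∩ {ω | a ≤ ∑ i ∈ J ∪ J', φ (ω i) ∧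
      ∑ i ∈ J ∪ J', φ (ω i) ≤ b} ⊆
      (farEvent φ J x ∩ {ω | a ≤ ∑ i ∈ J', φ (ω i) + ∑ i ∈ J, φ (ω i) ∧
        ∑ i ∈ J', φ (ω i) + ∑ i ∈ J, φ (ω i) ≤ b}) ∪
      (farEvent φ J' x ∩ {ω | a ≤ ∑ i ∈ J, φ (ω i) + ∑ i ∈ J', φ (ω i) ∧
        ∑ i ∈ J, φ (ω i) + ∑ i ∈ J', φ (ω i) ≤ b}) := by
    rintro ω ⟨h1, h2⟩
    simp only [mem_ofPred_eq, Finset.sum_union hd] at h2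
    rcases le_total x (∑ i ∈ J, φ (ω i)) with h3 | h3
    · exact Or.inl ⟨⟨h3, fun j hj => h1 j (Finset.mem_union_left _ hj)⟩, by
        simpa only [mem_ofPred_eq, add_comm] using h2⟩
    · exact Or.inr ⟨⟨by linarith [h2.1], fun j hj => h1 j (Finset.mem_union_right _ hj)⟩, h2⟩
  refine (measureReal_mono hsub).trans ((measureReal_union_le _ _).trans ?_)
  have k1 := key J J' hd hJ'
  have k2 := key J' J hd.symm hJ
  linarith

end Normalized

/-- A large set of indices splits into two comparable halves. -/
lemma exists_halves {S : Finset ι} (hι : 4 ≤ Fintype.card ι) (hS : Fintype.card ι ≤ S.card + 1) :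
    ∃ J J' : Finset ι, Disjoint J J' ∧ J ∪ J' = S ∧
      (Fintype.card ι : ℝ) ≤ 4 * J.card ∧ (Fintype.card ι : ℝ) ≤ 4 * J'.card := by
  obtain ⟨J, hJS, hJ⟩ := Finset.exists_subset_card_eq (show S.card / 2 ≤ S.card by omega)
  refine ⟨J, S \ J, Finset.disjoint_sdiff, Finset.union_sdiff_of_subset hJS, ?_, ?_⟩
  · have : Fintype.card ι ≤ 4 * J.card := by omega
    exact_mod_cast this
  · have h2 : (S \ J).card = S.card - J.card := Finset.card_sdiff_of_subset hJS
    have : Fintype.card ι ≤ 4 * (S \ J).card := by omega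
    exact_mod_cast this

end

/-! ### The nonuniform Berry–Esseen bound for sums -/

/-- The constant in the bounds for the Stein solution far to the left of `z`. -/
noncomputable def steinC : ℝ := exists_stein_left_bound.choose

lemma steinC_pos : 0 < steinC := exists_stein_left_bound.choose_spec.1

lemma stein_left_le {z w : ℝ} (hz : 1 ≤ z) (hw : w ≤ z / 2) :
    stein z w ≤ steinC * (z ^ 8)⁻¹ :=
  (exists_stein_left_bound.choose_spec.2 z hz w hw).1

lemma abs_steinD_left_le {z w : ℝ} (hz : 1 ≤ z) (hw : w ≤ z / 2) :
    |steinD z w| ≤ steinC * (z ^ 8)⁻¹ :=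
  (exists_stein_left_bound.choose_spec.2 z hz w hw).2

lemma abs_mul_stein_sub_le_one (z v w : ℝ) : |v * stein z v - w * stein z w| ≤ 1 := by
  rw [abs_le]
  constructor <;> linarith [mul_stein_le z w, le_mul_stein z w, mul_stein_le z v, le_mul_stein z v]

lemma abs_mul_stein_sub_left_le {z w u : ℝ} (hz : 1 ≤ z) (hw : w ≤ z / 4) (hu : |u| ≤ z / 4) :
    |(w + u) * stein z (w + u) - w * stein z w| ≤ (|w| + 1) * (|u| * (steinC * (z ^ 8)⁻¹)) := by
  have hu' := le_abs_self u
  have h1 : |stein z (w + u) - stein z w| ≤ steinC * (z ^ 8)⁻¹ * |u| := by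
    rw [stein_sub]
    have := intervalIntegral.norm_integral_le_of_norm_le_const (a := w) (b := w + u)
      (C := steinC * (z ^ 8)⁻¹) (f := steinD z) fun t ht => by
        refine abs_steinD_left_le hz ?_
        have : t ≤ max w (w + u) := (mem_Ioc.1 ht).2
        refine this.trans (max_le (by linarith) (by linarith))
    simpa using this
  have h2 : stein z (w + u) ≤ steinC * (z ^ 8)⁻¹ := stein_left_le hz (by linarith)
  have h3 : |stein z (w + u)| ≤ steinC * (z ^ 8)⁻¹ := by rwa [abs_of_nonneg (stein_nonneg _ _)]
  have e : (w + u) * stein z (w + u) - w * stein z w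
      = w * (stein z (w + u) - stein z w) + u * stein z (w + u) := by ring
  rw [e]
  refine (abs_add_le _ _).trans ?_
  rw [abs_mul, abs_mul]
  have := mul_le_mul_of_nonneg_left h1 (abs_nonneg w)
  have := mul_le_mul_of_nonneg_left h3 (abs_nonneg u)
  linarith

section

variable {ι : Type*} [Fintype ι] [DecidableEq ι] {μ : Measure ℝ} [IsProbabilityMeasure μ]
  {φ : ℝ → ℝ} {p : ℝ}

lemma intervalIntegral_meanD_eq (hm : Measurable φ) (i : ι) (z u : ℝ) :
    ∫ t in (0 : ℝ)..u, meanD μ φ i z t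
      = ∫ x, (stein z (sumDel φ i x + u) - stein z (sumDel φ i x)) ∂iid ι μ := by
  have hYm := measurable_sumDel (ι := ι) hm i
  have h4 : ∀ x : ι → ℝ, stein z (sumDel φ i x + u) - stein z (sumDel φ i x)
      = ∫ t in (0 : ℝ)..u, steinD z (sumDel φ i x + t) := fun x => by
    rw [stein_sub, intervalIntegral.integral_comp_add_left (fun t => steinD z t), add_zero]
  simp_rw [h4, meanD]
  refine intervalIntegral_integral_swap ?_
  have : IsFiniteMeasure (volume.restrict (uIoc (0 : ℝ) u)) := ⟨by simp [uIoc]⟩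
  refine (integrable_const (1 : ℝ)).mono' ?_ (ae_of_all _ fun q => abs_steinD_le _ _)
  exact ((measurable_steinD z).comp ((hYm.comp measurable_snd).add
    measurable_fst)).aestronglyMeasurable

/-- The integral is an averaged increment of the Stein solution, whose values lie in `[0, 1/z]`. The
bound does not grow with `u`, as required for large summands. -/
lemma abs_intervalIntegral_meanD_le (hm : Measurable φ) (i : ι) {z : ℝ} (hz : 0 < z) (u : ℝ) :
    |∫ t in (0 : ℝ)..u, meanD μ φ i z t| ≤ 1 / z := by
  rw [intervalIntegral_meanD_eq hm]
  have := norm_integral_le_of_norm_le_const (μ := iid ι μ) (C := 1 / z)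
    (f := fun x => stein z (sumDel φ i x + u) - stein z (sumDel φ i x)) (ae_of_all _ fun x => by
      rw [Real.norm_eq_abs, abs_le]
      constructor <;> linarith [stein_nonneg z (sumDel φ i x), stein_nonneg z (sumDel φ i x + u),
        stein_le_inv hz (sumDel φ i x), stein_le_inv hz (sumDel φ i x + u)])
  simpa using this

/-- The constant in the local bounds for `meanH`. -/
noncomputable def farHC : ℝ := 2 * steinC + 2.26 * (256 * √tailC)

/-- The constant in the local bounds for `meanD`. -/
noncomputable def farDC : ℝ := farHC + 8 * (8 ^ 8 * tailC)

lemma farHC_pos : 0 < farHC := by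
  unfold farHC; have := steinC_pos; positivity

lemma farDC_pos : 0 < farDC := by
  unfold farDC; have := farHC_pos; have := tailC_pos; positivity

namespace Normalized

variable (h : Normalized ι μ φ p)
include h

/-- There are three regimes. If some summand exceeds `z/64`, the change is at most one and the
probability is `O(L z^(-p))`. If the deleted sum is at most `z/4`, the Stein solution is negligible.
Otherwise the far event occurs; Cauchy–Schwarz leaves the square root of its probability, of order
`z^(-4)`. -/
lemma abs_meanH_sub_far_le (i : ι) {z u : ℝ} (hz : 64 ≤ z) (hu : |u| ≤ z / 64) :
    |meanH μ φ i z u - meanH μ φ i z 0| ≤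
      lyap ι μ φ p * (z / 64) ^ (-p) + farHC * (|u| * (z ^ 4)⁻¹) := by
  have hm := h.measurable
  have hY := measurable_sumDel (ι := ι) hm i
  set S : Finset ι := Finset.univ.erase i
  set B := farEvent φ S (z / 4)
  have hB : MeasurableSet B := measurableSet_farEvent hm S _
  set A := (smallEvent φ S (z / 64))ᶜ
  have hA : MeasurableSet A := (measurableSet_smallEvent hm S _).compl
  have hYL : MemLp (sumDel φ i) 2 (iid ι μ) := memLp_sum_eval h.memLp S
  have i1 : Integrable (fun x => |sumDel φ i x|) (iid ι μ) := (hYL.integrable (by norm_num)).abs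
  have i2 : Integrable (fun x => |sumDel φ i x| + 1.26) (iid ι μ) := i1.add (integrable_const _)
  have i3 : Integrable (fun x => |sumDel φ i x| + 1) (iid ι μ) := i1.add (integrable_const _)
  have jA : Integrable (A.indicator fun _ => (1 : ℝ)) (iid ι μ) := (integrable_const _).indicator hA
  have jB := i2.indicator hB
  have hpt : ∀ x, |(sumDel φ i x + u) * stein z (sumDel φ i x + u)
      - (sumDel φ i x + 0) * stein z (sumDel φ i x + 0)| ≤ A.indicator (fun _ => (1 : ℝ)) x
        + (|sumDel φ i x| + 1) * (|u| * (steinC * (z ^ 8)⁻¹))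
        + B.indicator (fun x => |sumDel φ i x| + 1.26) x * |u| := by
    intro x
    simp only [add_zero]
    have n1 : 0 ≤ A.indicator (fun _ => (1 : ℝ)) x := indicator_nonneg (fun _ _ => zero_le_one) x
    have n2 : 0 ≤ (|sumDel φ i x| + 1) * (|u| * (steinC * (z ^ 8)⁻¹)) := by
      have := steinC_pos; positivity
    have n3 : 0 ≤ B.indicator (fun x => |sumDel φ i x| + 1.26) x :=
      indicator_nonneg (fun _ _ => by positivity) x
    have n4 := mul_nonneg n3 (abs_nonneg u)
    by_cases hxA : x ∈ A
    · rw [indicator_of_mem hxA] at n1 ⊢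
      linarith [abs_mul_stein_sub_le_one z (sumDel φ i x + u) (sumDel φ i x)]
    rcases le_total (sumDel φ i x) (z / 4) with hx | hx
    · linarith [abs_mul_stein_sub_left_le (by linarith) hx (by linarith : |u| ≤ z / 4)]
    · have hxB : x ∈ B := farEvent_mono_of_small S (y := z / 64) (by linarith)
        ⟨not_not.1 hxA, hx⟩
      rw [indicator_of_mem hxB]
      linarith [abs_mul_stein_sub_le z (sumDel φ i x) u]
  have hint := integral_mono ((integrable_mul_stein_comp (hY.add_const u) z).sub
      (integrable_mul_stein_comp (hY.add_const 0) z)).abs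
      ((jA.add (i3.mul_const _)).add (jB.mul_const _)) hpt
  have k1 := integral_add (jA.add (i3.mul_const (|u| * (steinC * (z ^ 8)⁻¹)))) (jB.mul_const |u|)
  simp only [Pi.add_apply] at k1 hint
  rw [k1, integral_add jA (i3.mul_const _), integral_mul_const, integral_mul_const,
    integral_indicator hA, integral_indicator hB, integral_add i1 (integrable_const _),
    integral_add i1.restrict (integrable_const _)] at hint
  simp only [integral_const, probReal_univ, smul_eq_mul, mul_one,
    measureReal_restrict_apply, univ_inter, MeasurableSet.univ] at hint
  rw [meanH, meanH, ← integral_sub (integrable_mul_stein_comp (hY.add_const u) z)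
    (integrable_mul_stein_comp (hY.add_const 0) z)]
  refine abs_integral_le_integral_abs.trans (hint.trans ?_)
  have b1 : (iid ι μ).real A ≤ lyap ι μ φ p * (z / 64) ^ (-p) :=
    h.real_compl_smallEvent_le S (by linarith)
  have b2 := h.integral_abs_sumDel_le i
  have b3 : (iid ι μ).real B ≤ (256 * √tailC * (z ^ 4)⁻¹) ^ 2 := by
    refine (h.real_farEvent_le S (by linarith)).trans (le_of_eq ?_)
    rw [mul_pow, mul_pow, Real.sq_sqrt tailC_pos.le]
    field_simp; norm_num
  have n5 : 0 ≤ 256 * √tailC * (z ^ 4)⁻¹ := by positivity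
  have b4 : √((iid ι μ).real B) ≤ 256 * √tailC * (z ^ 4)⁻¹ := Real.sqrt_le_iff.2 ⟨n5, b3⟩
  have b5 : (iid ι μ).real B ≤ √((iid ι μ).real B) := by
    have h0 : 0 ≤ (iid ι μ).real B := measureReal_nonneg
    have h1 : (iid ι μ).real B ≤ 1 := measureReal_le_one
    exact Real.le_sqrt_of_sq_le (by nlinarith)
  have b6 : ∫ x in B, |sumDel φ i x| ∂iid ι μ ≤ √((iid ι μ).real B) := by
    have hi : MemLp (B.indicator fun _ => (1 : ℝ)) 2 (iid ι μ) := (memLp_const 1).indicator hB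
    have := integral_abs_mul_le hi hYL
    have e1 : ∀ x, |B.indicator (fun _ => (1 : ℝ)) x * sumDel φ i x|
        = B.indicator (fun x => |sumDel φ i x|) x := fun x => by
      by_cases hx : x ∈ B <;> simp [hx]
    have e2 : ∀ x, B.indicator (fun _ => (1 : ℝ)) x ^ 2 = B.indicator (fun _ => (1 : ℝ)) x := fun x => by
      by_cases hx : x ∈ B <;> simp [hx]
    simp_rw [e1, e2] at this
    rw [integral_indicator hB, integral_indicator hB] at this
    simp only [integral_const, smul_eq_mul, mul_one, measureReal_restrict_apply, univ_inter,
      MeasurableSet.univ] at this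
    have hY2 : ∫ x, sumDel φ i x ^ 2 ∂iid ι μ ≤ 1 := by
      simp only [sumDel]
      rw [h.integral_sq_sum]; exact h.card_div_le_one _
    have := this.trans (mul_le_of_le_one_right (Real.sqrt_nonneg _) (Real.sqrt_le_one.2 hY2))
    exact this
  have b7 : (z ^ 8)⁻¹ ≤ (z ^ 4)⁻¹ := inv_anti₀ (by positivity)
    (pow_le_pow_right₀ (by linarith) (by norm_num))
  set U := |u| with hU
  have hU0 : 0 ≤ U := abs_nonneg u
  have hsC := steinC_pos
  have c1 : (∫ x, |sumDel φ i x| ∂iid ι μ + 1) * (U * (steinC * (z ^ 8)⁻¹))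
      ≤ 2 * (U * (steinC * (z ^ 4)⁻¹)) := by
    refine mul_le_mul (by linarith) (by gcongr) (by positivity) (by norm_num)
  have c2 : (∫ x in B, |sumDel φ i x| ∂iid ι μ + (iid ι μ).real B * 1.26) * U
      ≤ 2.26 * (256 * √tailC * (z ^ 4)⁻¹) * U := by
    refine mul_le_mul_of_nonneg_right (by linarith) hU0
  rw [farHC]
  linarith

/-- The change is at most the probability that the deleted sum lies within `|u|` of `z`. Here
`real_far_interval_le` is used at `x = z/8`; its condition `x ≥ 8` and the truncation level `x/8`
account for the two appearances of `64`. -/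
lemma abs_meanP_sub_far_le (hι : 4 ≤ Fintype.card ι) (i : ι) {z u : ℝ} (hz : 64 ≤ z)
    (hu : |u| ≤ z / 64) :
    |meanP μ φ i z u - meanP μ φ i z 0| ≤
      lyap ι μ φ p * (z / 64) ^ (-p)
        + 8 * (8 ^ 8 * tailC) * ((|u| + lyap ι μ φ p) * (z ^ 4)⁻¹) := by
  have hL0 := h.lyap_pos
  have hS : ∃ J J' : Finset ι, Disjoint J J' ∧ J ∪ J' = Finset.univ.erase i ∧
      (Fintype.card ι : ℝ) ≤ 4 * J.card ∧ (Fintype.card ι : ℝ) ≤ 4 * J'.card :=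
    exists_halves hι (by rw [Finset.card_erase_of_mem (Finset.mem_univ i), Finset.card_univ]; omega)
  set S : Finset ι := Finset.univ.erase i
  set R := (iid ι μ).real {x : ι → ℝ | z - |u| ≤ sumDel φ i x ∧ sumDel φ i x ≤ z + |u|} with hR
  have hu1 := le_abs_self u
  have hu2 := neg_abs_le u
  have step : ∀ v w : ℝ, |v| ≤ |u| → |w| ≤ |u| → meanP μ φ i z v ≤ meanP μ φ i z w + R := by
    intro v w hv hw
    rw [meanP, meanP]
    refine le_trans (measureReal_mono fun x (hx : sumDel φ i x + v ≤ z) => ?_)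
      (measureReal_union_le _ _)
    have := neg_abs_le v
    have := le_abs_self w
    by_cases hxv : sumDel φ i x + w ≤ z
    · exact Or.inl hxv
    · exact Or.inr ⟨by linarith [not_le.1 hxv], by linarith⟩
  have hb := h.real_far_interval_le hS (x := z / 8) (a := z - |u|) (b := z + |u|) (by linarith)
    (by linarith) (by linarith [abs_nonneg u])
  have hsm := h.real_compl_smallEvent_le S (y := z / 64) (by linarith)
  have hR2 : R ≤ (iid ι μ).real (smallEvent φ S (z / 8 / 8) ∩
      {ω | z - |u| ≤ ∑ i ∈ S, φ (ω i) ∧ ∑ i ∈ S, φ (ω i) ≤ z + |u|})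
      + (iid ι μ).real (smallEvent φ S (z / 64))ᶜ := by
    refine le_trans (measureReal_mono fun x hx => ?_) (measureReal_union_le _ _)
    by_cases hx2 : x ∈ smallEvent φ S (z / 64)
    · refine Or.inl ⟨?_, hx⟩
      rwa [div_div, show (8 : ℝ) * 8 = 64 by norm_num]
    · exact Or.inr hx2
  have e : tailC * ((z / 8) ^ 8)⁻¹ * (4 * (z + |u| - (z - |u|) + 2 * lyap ι μ φ p))
      = 8 * (8 ^ 8 * tailC) * ((|u| + lyap ι μ φ p) * (z ^ 8)⁻¹) := by
    field_simp; ring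
  have b7 : (z ^ 8)⁻¹ ≤ (z ^ 4)⁻¹ := inv_anti₀ (by positivity)
    (pow_le_pow_right₀ (by linarith) (by norm_num))
  have htC := tailC_pos
  have e2 : 8 * (8 ^ 8 * tailC) * ((|u| + lyap ι μ φ p) * (z ^ 8)⁻¹)
      ≤ 8 * (8 ^ 8 * tailC) * ((|u| + lyap ι μ φ p) * (z ^ 4)⁻¹) := by gcongr
  rw [e] at hb
  have s1 := step u 0 le_rfl (by simp)
  have s2 := step 0 u (by simp) le_rfl
  rw [abs_le]
  constructor <;> linarith

lemma abs_meanD_sub_far_le (hι : 4 ≤ Fintype.card ι) (i : ι) {z u : ℝ} (hz : 64 ≤ z)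
    (hu : |u| ≤ z / 64) :
    |meanD μ φ i z u - meanD μ φ i z 0| ≤
      2 * (lyap ι μ φ p * (z / 64) ^ (-p)) + farDC * ((|u| + lyap ι μ φ p) * (z ^ 4)⁻¹) := by
  have hm := h.measurable
  have hL0 := h.lyap_pos
  rw [meanD_eq hm, meanD_eq hm]
  have h1 := h.abs_meanH_sub_far_le i hz hu
  have h2 := h.abs_meanP_sub_far_le hι i hz hu
  have h3 : farHC * (|u| * (z ^ 4)⁻¹) ≤ farHC * ((|u| + lyap ι μ φ p) * (z ^ 4)⁻¹) := by
    have := farHC_pos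
    gcongr; linarith
  have e : meanH μ φ i z u + meanP μ φ i z u - Phi z - (meanH μ φ i z 0 + meanP μ φ i z 0 - Phi z)
    = (meanH μ φ i z u - meanH μ φ i z 0) + (meanP μ φ i z u - meanP μ φ i z 0) := by ring
  rw [e, farDC]
  refine (abs_add_le _ _).trans ?_
  linarith

/-- The Stein derivative at the full sum is small in the mean. -/
lemma abs_integral_meanD_le (i : ι) {z : ℝ} (hz : 1 ≤ z) :
    |∫ b, meanD μ φ i z (φ b) ∂μ| ≤ (steinC + 4) * (z ^ 2)⁻¹ := by
  have hm := h.measurable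
  have hz0 : 0 < z := by linarith
  have hsC := steinC_pos
  have hWm : Measurable fun x : ι → ℝ => ∑ j, φ (x j) := measurable_sum_eval hm _
  have hW2 : Integrable (fun x : ι → ℝ => (∑ j, φ (x j)) ^ 2) (iid ι μ) :=
    (memLp_sum_eval h.memLp Finset.univ).integrable_sq
  rw [← (integral_meanD hm i z).2]
  refine abs_integral_le_integral_abs.trans ?_
  have hpt : ∀ x : ι → ℝ, |steinD z (∑ j, φ (x j))|
      ≤ steinC * (z ^ 2)⁻¹ + 4 * (z ^ 2)⁻¹ * (∑ j, φ (x j)) ^ 2 := by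
    intro x
    rcases le_total (∑ j, φ (x j)) (z / 2) with hx | hx
    · have h1 := abs_steinD_left_le hz hx
      have h2 : (z ^ 8)⁻¹ ≤ (z ^ 2)⁻¹ := inv_anti₀ (by positivity)
        (pow_le_pow_right₀ hz (by norm_num))
      have h3 := mul_le_mul_of_nonneg_left h2 hsC.le
      have h4 : 0 ≤ 4 * (z ^ 2)⁻¹ * (∑ j, φ (x j)) ^ 2 := by positivity
      linarith
    · have h1 := abs_steinD_le z (∑ j, φ (x j))
      have h2 : 1 ≤ 4 * (z ^ 2)⁻¹ * (∑ j, φ (x j)) ^ 2 := by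
        have h3 : z ^ 2 ≤ 4 * (∑ j, φ (x j)) ^ 2 := by nlinarith
        calc (1 : ℝ) = (z ^ 2)⁻¹ * z ^ 2 := by field_simp
          _ ≤ (z ^ 2)⁻¹ * (4 * (∑ j, φ (x j)) ^ 2) := by gcongr
          _ = _ := by ring
      have h4 : 0 ≤ steinC * (z ^ 2)⁻¹ := by positivity
      linarith
  have h1 := integral_mono (integrable_steinD_comp hWm z).abs
    ((integrable_const (steinC * (z ^ 2)⁻¹)).add (hW2.const_mul (4 * (z ^ 2)⁻¹))) hpt
  simp only [Pi.add_apply] at h1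
  rw [integral_add (integrable_const _) (hW2.const_mul _),
    integral_const_mul (4 * (z ^ 2)⁻¹)] at h1
  simp only [integral_const, probReal_univ, smul_eq_mul, one_mul] at h1
  refine h1.trans ?_
  have h2 : ∫ x : ι → ℝ, (∑ j, φ (x j)) ^ 2 ∂iid ι μ ≤ 1 := by
    rw [h.integral_sq_sum]; exact h.card_div_le_one _
  have h3 : 0 ≤ 4 * (z ^ 2)⁻¹ := by positivity
  nlinarith

/-- The mean Stein derivative changes little over the bulk of the distribution of a summand. -/
lemma abs_integral_meanD_sub_le (hι : 4 ≤ Fintype.card ι) (i : ι) {z t : ℝ} (hz : 64 ≤ z)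
    (ht : |t| ≤ z / 64) :
    |(∫ b, meanD μ φ i z (φ b) ∂μ) - meanD μ φ i z t| ≤
      6 * (lyap ι μ φ p * (z / 64) ^ (-p)) + farDC * ((|t| + 3 * lyap ι μ φ p) * (z ^ 4)⁻¹) := by
  have hm := h.measurable
  have hL0 := h.lyap_pos
  have hK := farDC_pos
  set L := lyap ι μ φ p
  set q := (z / 64) ^ (-p) with hq
  have hq0 : 0 < q := Real.rpow_pos_of_pos (by linarith) _
  set A : Set ℝ := {a | z / 64 < |φ a|} with hA
  have hAm : MeasurableSet A := measurableSet_lt measurable_const hm.abs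
  have i0 := (integral_meanD (μ := μ) hm i z).1
  have i1 : Integrable (fun a => |φ a|) μ := (h.memLp.integrable (by norm_num)).abs
  have i2 : Integrable (fun a => (|φ a| + L) * (z ^ 4)⁻¹) μ :=
    (i1.add (integrable_const L)).mul_const _
  have jA : Integrable (A.indicator fun _ => (2 : ℝ)) μ := (integrable_const _).indicator hAm
  have j2 : Integrable (fun a => 2 * (L * q) + farDC * ((|φ a| + L) * (z ^ 4)⁻¹)) μ :=
    (integrable_const _).add (i2.const_mul _)
  have hpt : ∀ a, |meanD μ φ i z (φ a) - meanD μ φ i z 0| ≤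
      2 * (L * q) + farDC * ((|φ a| + L) * (z ^ 4)⁻¹) + A.indicator (fun _ => (2 : ℝ)) a := by
    intro a
    by_cases ha : a ∈ A
    · rw [indicator_of_mem ha]
      have h1 := abs_le.1 (abs_meanD_le (μ := μ) (φ := φ) i z (φ a))
      have h2 := abs_le.1 (abs_meanD_le (μ := μ) (φ := φ) i z 0)
      have h3 : 0 ≤ 2 * (L * q) + farDC * ((|φ a| + L) * (z ^ 4)⁻¹) := by positivity
      rw [abs_le]; constructor <;> linarith [h1.1, h1.2, h2.1, h2.2]
    · rw [indicator_of_notMem ha, add_zero]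
      exact h.abs_meanD_sub_far_le hι i hz (not_lt.1 ha)
  have hi := integral_mono (i0.sub (integrable_const _)).abs (j2.add jA) hpt
  simp only [Pi.add_apply] at hi
  rw [integral_add j2 jA, integral_add (integrable_const _) (i2.const_mul _),
    integral_const_mul farDC, integral_mul_const ((z ^ 4)⁻¹), integral_add i1 (integrable_const L),
    integral_indicator hAm] at hi
  simp only [integral_const, probReal_univ, smul_eq_mul, one_mul, measureReal_restrict_apply,
    univ_inter, MeasurableSet.univ] at hi
  have hE : ∫ a, |φ a| ∂μ ≤ L := h.integral_abs_le.trans h.inv_sqrt_card_le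
  have hPA : μ.real A ≤ L * q := by
    refine (h.real_large_le (y := z / 64) (by linarith)).trans ?_
    exact div_le_self (by positivity) h.one_le_card
  have h0 : |(∫ b, meanD μ φ i z (φ b) ∂μ) - meanD μ φ i z 0| ≤
      4 * (L * q) + farDC * ((L + L) * (z ^ 4)⁻¹) := by
    have e : (∫ b, meanD μ φ i z (φ b) ∂μ) - meanD μ φ i z 0
        = ∫ b, (meanD μ φ i z (φ b) - meanD μ φ i z 0) ∂μ := by
      rw [integral_sub i0 (integrable_const _)]; simp
    rw [e]
    refine abs_integral_le_integral_abs.trans (hi.trans ?_)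
    have : farDC * ((∫ a, |φ a| ∂μ + L) * (z ^ 4)⁻¹) ≤ farDC * ((L + L) * (z ^ 4)⁻¹) := by gcongr
    linarith
  have h1 := h.abs_meanD_sub_far_le hι i hz ht
  have e : (∫ b, meanD μ φ i z (φ b) ∂μ) - meanD μ φ i z t
      = ((∫ b, meanD μ φ i z (φ b) ∂μ) - meanD μ φ i z 0)
        - (meanD μ φ i z t - meanD μ φ i z 0) := by ring
  rw [e]
  refine (abs_sub _ _).trans ?_
  linarith

/-- **Nonuniform Berry–Esseen bound** for a normalized sum, far out in the tail. -/
theorem nonuniform_berry_esseen (hι : 4 ≤ Fintype.card ι) {z : ℝ} (hz : 64 ≤ z) :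
    |(iid ι μ).real {x | ∑ i, φ (x i) ≤ z} - Phi z| ≤
      (4 * farDC + steinC + 11) * (lyap ι μ φ p * (z / 64) ^ (-p)) := by
  have hm := h.measurable
  have hL0 := h.lyap_pos
  have hK := farDC_pos
  have hsC := steinC_pos
  have hn := h.card_pos
  have hp := h.two_lt
  have hp3 := h.le_three
  set L := lyap ι μ φ p with hL
  set y := z / 64 with hy
  have hy1 : 1 ≤ y := by rw [hy]; linarith
  have hy0 : 0 < y := by linarith
  have hzy : z = 64 * y := by rw [hy]; ring
  set q := y ^ (-p) with hq
  have hq0 : 0 < q := Real.rpow_pos_of_pos hy0 _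
  have hy4q : (y ^ 4)⁻¹ ≤ q := by
    rw [hq, ← Real.rpow_natCast, ← Real.rpow_neg hy0.le]
    exact Real.rpow_le_rpow_of_exponent_le hy1 (by push_cast; linarith)
  have hz4 : (z ^ 4)⁻¹ ≤ (y ^ 4)⁻¹ := by
    rw [hzy]; exact inv_anti₀ (by positivity) (pow_le_pow_left₀ hy0.le (by linarith) 4)
  have hz2 : (z ^ 2)⁻¹ ≤ (y ^ 2)⁻¹ := by
    rw [hzy]; exact inv_anti₀ (by positivity) (pow_le_pow_left₀ hy0.le (by linarith) 2)
  set D := 4 * farDC + steinC + 11 with hD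
  have hpt : ∀ (i : ι) (a : ℝ), |φ a * (∫ t in (0 : ℝ)..φ a,
      ((∫ b, meanD μ φ i z (φ b) ∂μ) - meanD μ φ i z t))| ≤
      (6 + 3 * farDC) * (L * q) * φ a ^ 2 + (farDC + steinC + 5) * q * |φ a| ^ p := by
    intro i a
    set M := ∫ b, meanD μ φ i z (φ b) ∂μ with hM
    set s := |φ a| / y with hs
    have hs0 : 0 ≤ s := by positivity
    have hφs : |φ a| = y * s := by rw [hs]; field_simp
    have hsp : s ^ p = q * |φ a| ^ p := by
      rw [hs, Real.div_rpow (abs_nonneg _) hy0.le, hq, Real.rpow_neg hy0.le]; ring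
    rw [abs_mul]
    -- A moderate insertion is covered by the local bound on the averaged derivative. A large one is
    -- charged to `|φ|^p`, using `|E f'(W)| = O(z^(-2))` and the bound `1/z` for increments of `f`.
    rcases le_or_gt (|φ a|) y with ha | ha
    · have hs1 : s ≤ 1 := by rw [hs, div_le_one hy0]; exact ha
      have h3 : s ^ 3 ≤ s ^ p := by
        rcases hs0.eq_or_lt with h0 | h0
        · rw [← h0, Real.zero_rpow (by linarith)]; norm_num
        · rw [← Real.rpow_natCast]
          exact Real.rpow_le_rpow_of_exponent_ge h0 hs1 (by push_cast; exact hp3)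
      have hI : |∫ t in (0 : ℝ)..φ a, (M - meanD μ φ i z t)| ≤
          (6 * (L * q) + farDC * ((|φ a| + 3 * L) * (z ^ 4)⁻¹)) * |φ a - 0| :=
        intervalIntegral.norm_integral_le_of_norm_le_const (f := fun t => M - meanD μ φ i z t)
          (C := 6 * (L * q) + farDC * ((|φ a| + 3 * L) * (z ^ 4)⁻¹)) fun t ht => by
          have ht' : |t| ≤ |φ a| := by
            rcases mem_uIoc.1 ht with k | k
            · rw [abs_of_pos k.1, abs_of_pos (k.1.trans_le k.2)]; exact k.2
            · rw [abs_of_nonpos k.2, abs_of_neg (k.1.trans_le k.2)]; linarith [k.1]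
          rw [Real.norm_eq_abs]
          refine (h.abs_integral_meanD_sub_le hι i hz (ht'.trans ha)).trans ?_
          have : farDC * ((|t| + 3 * L) * (z ^ 4)⁻¹) ≤ farDC * ((|φ a| + 3 * L) * (z ^ 4)⁻¹) := by
            gcongr
          linarith
      rw [sub_zero] at hI
      have hb : farDC * ((|φ a| + 3 * L) * (z ^ 4)⁻¹)
          ≤ farDC * (|φ a| * (y ^ 4)⁻¹ + 3 * L * q) := by
        have : (|φ a| + 3 * L) * (z ^ 4)⁻¹ ≤ |φ a| * (y ^ 4)⁻¹ + 3 * L * q := by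
          rw [add_mul]
          have := mul_le_mul_of_nonneg_left hz4 (abs_nonneg (φ a))
          have := mul_le_mul_of_nonneg_left (hz4.trans hy4q) (show 0 ≤ 3 * L by positivity)
          linarith
        gcongr
      have hc : |φ a| ^ 2 * (|φ a| * (y ^ 4)⁻¹) ≤ s ^ p := by
        have e : |φ a| ^ 2 * (|φ a| * (y ^ 4)⁻¹) = s ^ 3 * y⁻¹ := by
          rw [hφs]; field_simp
        rw [e]
        have : y⁻¹ ≤ 1 := inv_le_one_of_one_le₀ hy1
        have := mul_le_of_le_one_right (show 0 ≤ s ^ 3 by positivity) this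
        linarith
      have hd := mul_le_mul_of_nonneg_left hc hK.le
      have h5 : 0 ≤ (steinC + 5) * (q * |φ a| ^ p) := by positivity
      calc |φ a| * |∫ t in (0 : ℝ)..φ a, (M - meanD μ φ i z t)|
          ≤ |φ a| * ((6 * (L * q) + farDC * (|φ a| * (y ^ 4)⁻¹ + 3 * L * q)) * |φ a|) := by
            refine mul_le_mul_of_nonneg_left (hI.trans ?_) (abs_nonneg _)
            gcongr
        _ = (6 + 3 * farDC) * (L * q) * |φ a| ^ 2
            + farDC * (|φ a| ^ 2 * (|φ a| * (y ^ 4)⁻¹)) := by ring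
        _ ≤ _ := by rw [hsp, sq_abs] at hd; rw [sq_abs]; linarith
    · have hs1 : 1 ≤ s := by rw [hs, one_le_div hy0]; exact ha.le
      have h1 : s ≤ s ^ p := by
        nth_rewrite 1 [← Real.rpow_one s]
        exact Real.rpow_le_rpow_of_exponent_le hs1 (by linarith)
      have h2 : s ^ 2 ≤ s ^ p := by
        rw [← Real.rpow_natCast]
        exact Real.rpow_le_rpow_of_exponent_le hs1 (by push_cast; linarith)
      rw [intervalIntegral.integral_sub intervalIntegrable_const
        (intervalIntegrable_meanD hm i z _ _), intervalIntegral.integral_const, sub_zero,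
        smul_eq_mul]
      have hMb : |M| ≤ (steinC + 4) * (z ^ 2)⁻¹ := h.abs_integral_meanD_le i (by linarith)
      have hIb := abs_intervalIntegral_meanD_le (μ := μ) hm i (show 0 < z by linarith) (φ a)
      have ha1 : |φ a| * (|φ a| * |M|) ≤ (steinC + 4) * s ^ p := by
        calc |φ a| * (|φ a| * |M|) ≤ |φ a| * (|φ a| * ((steinC + 4) * (y ^ 2)⁻¹)) := by
              gcongr; exact hMb.trans (by gcongr)
          _ = (steinC + 4) * s ^ 2 := by rw [hφs]; field_simp
          _ ≤ _ := by gcongr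
      have ha2 : |φ a| * (1 / z) ≤ s ^ p := by
        refine le_trans ?_ h1
        rw [hs, mul_one_div]
        gcongr
        linarith
      have h6 : 0 ≤ (6 + 3 * farDC) * (L * q) * φ a ^ 2 := by positivity
      have h7 : 0 ≤ farDC * s ^ p := by positivity
      calc |φ a| * |φ a * M - ∫ t in (0 : ℝ)..φ a, meanD μ φ i z t|
          ≤ |φ a| * (|φ a| * |M| + 1 / z) := by
            refine mul_le_mul_of_nonneg_left ((abs_sub _ _).trans ?_) (abs_nonneg _)
            rw [abs_mul]; linarith
        _ ≤ (steinC + 4) * s ^ p + s ^ p := by rw [mul_add]; linarith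
        _ ≤ (6 + 3 * farDC) * (L * q) * φ a ^ 2 + (farDC + steinC + 5) * s ^ p := by linarith
        _ = _ := by rw [hsp]; ring
  rw [h.stein_identity z]
  refine (Finset.abs_sum_le_sum_abs _ _).trans ?_
  have hi : Integrable (fun a => (6 + 3 * farDC) * (L * q) * φ a ^ 2) μ :=
    h.memLp.integrable_sq.const_mul _
  have hj : Integrable (fun a => (farDC + steinC + 5) * q * |φ a| ^ p) μ :=
    h.integrable.const_mul _
  have hterm : ∀ i : ι, |∫ a, φ a * (∫ t in (0 : ℝ)..φ a,
      ((∫ b, meanD μ φ i z (φ b) ∂μ) - meanD μ φ i z t)) ∂μ| ≤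
      D * (L * q) / Fintype.card ι := by
    intro i
    have h1 := norm_integral_le_of_norm_le (μ := μ) (f := fun a => φ a * (∫ t in (0 : ℝ)..φ a,
      ((∫ b, meanD μ φ i z (φ b) ∂μ) - meanD μ φ i z t))) (hi.add hj) (ae_of_all _ fun a => hpt i a)
    simp only [Pi.add_apply] at h1
    rw [integral_add hi hj, integral_const_mul, integral_const_mul, h.second_eq] at h1
    refine h1.trans (le_of_eq ?_)
    have e : ∫ a, |φ a| ^ p ∂μ = L / Fintype.card ι := by rw [hL, lyap]; field_simp
    rw [e, hD]
    field_simp; ring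
  refine (Finset.sum_le_sum fun i _ => hterm i).trans (le_of_eq ?_)
  rw [Finset.sum_const, Finset.card_univ, nsmul_eq_mul]
  field_simp

end Normalized
end

/-! ### Sums with a remainder: the uniform bound -/

/-- `Δ` is a remainder of order `η` in mean square, and `E i` approximates `Δ` without using the
coordinate `i`. -/
structure SmallRemainder (ι : Type*) [Fintype ι] (μ : Measure ℝ) (Δ : (ι → ℝ) → ℝ)
    (E : ι → (ι → ℝ) → ℝ) (η : ℝ) : Prop where
  measurable : Measurable Δ
  memLp : MemLp Δ 2 (iid ι μ)
  measurable_loo : ∀ i, Measurable (E i)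
  memLp_loo : ∀ i, MemLp (E i) 2 (iid ι μ)
  dependsOn : ∀ i, DependsOn (E i) {i}ᶜ
  norm_le : √(∫ x, Δ x ^ 2 ∂iid ι μ) ≤ η
  norm_sub_le : ∀ i, √(∫ x, (Δ x - E i x) ^ 2 ∂iid ι μ) ≤ √2 * η / √(Fintype.card ι)

section

variable {ι : Type*} [Fintype ι] [DecidableEq ι] {μ : Measure ℝ} [IsProbabilityMeasure μ]
  {φ : ℝ → ℝ} {p : ℝ} {Δ : (ι → ℝ) → ℝ} {E : ι → (ι → ℝ) → ℝ} {η : ℝ}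

namespace SmallRemainder

lemma nonneg (hΔ : SmallRemainder ι μ Δ E η) : 0 ≤ η := (Real.sqrt_nonneg _).trans hΔ.norm_le

lemma neg (hΔ : SmallRemainder ι μ Δ E η) :
    SmallRemainder ι μ (fun x => -Δ x) (fun i x => -E i x) η where
  measurable := hΔ.measurable.neg
  memLp := hΔ.memLp.neg
  measurable_loo i := (hΔ.measurable_loo i).neg
  memLp_loo i := (hΔ.memLp_loo i).neg
  dependsOn i := fun x y hxy => by simp only [hΔ.dependsOn i hxy]
  norm_le := by simpa using hΔ.norm_le
  norm_sub_le i := by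
    have e : ∀ x, (-Δ x - -E i x) ^ 2 = (Δ x - E i x) ^ 2 := fun x => by ring
    simp_rw [e]
    exact hΔ.norm_sub_le i

end SmallRemainder

/-- Cauchy–Schwarz on an event. -/
lemma setIntegral_abs_mul_le {B : Set (ι → ℝ)} (hB : MeasurableSet B) {f g : (ι → ℝ) → ℝ}
    (hf : MemLp f 2 (iid ι μ)) (hg : MemLp g 2 (iid ι μ)) :
    ∫ x in B, |f x| * |g x| ∂iid ι μ ≤
      √(∫ x in B, f x ^ 2 ∂iid ι μ) * √(∫ x, g x ^ 2 ∂iid ι μ) := by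
  have h1 := integral_abs_mul_le (hf.indicator hB) hg
  have e1 : ∀ x, |B.indicator f x * g x| = B.indicator (fun x => |f x| * |g x|) x := fun x => by
    by_cases hx : x ∈ B <;> simp [hx, abs_mul]
  have e2 : ∀ x, B.indicator f x ^ 2 = B.indicator (fun x => f x ^ 2) x := fun x => by
    by_cases hx : x ∈ B <;> simp [hx]
  simp_rw [e1, e2] at h1
  rwa [integral_indicator hB, integral_indicator hB] at h1

namespace Normalized

variable (h : Normalized ι μ φ p) (hΔ : SmallRemainder ι μ Δ E η)
include h hΔ

/-- Concentration in a random interval whose length is the size of a remainder. -/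
lemma concentration_remainder (hL : lyap ι μ φ p ≤ 1 / 2) {I : Finset ι} (hI : I.Nonempty)
    {V : (ι → ℝ) → ℝ} {B : Set (ι → ℝ)} (hB : MeasurableSet B)
    (hBd : DependsOn (fun x => x ∈ B) (I : Set ι)ᶜ)
    (hV : Measurable V) (hVd : DependsOn V (I : Set ι)ᶜ) (z : ℝ) {α : ℝ} (hα : -1 ≤ α)
    (hα' : α ≤ 0) :
    (iid ι μ).real (B ∩ {x | z + α * |Δ x| ≤ ∑ i ∈ I, φ (x i) + V x ∧
        ∑ i ∈ I, φ (x i) + V x ≤ z + (α + 1) * |Δ x|}) ≤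
      √(Fintype.card ι / I.card) *
        (√((iid ι μ).real B) * η + 1.5 * lyap ι μ φ p * (iid ι μ).real B)
      + √2 * (√((iid ι μ).real B) * η) := by
  have hm := h.measurable
  set L := lyap ι μ φ p
  have hL0 : 0 < L := h.lyap_pos
  have hn := h.card_pos
  have hη := hΔ.nonneg
  have hIc : (0 : ℝ) < I.card := by exact_mod_cast hI.card_pos
  have hδ : 0 ≤ L / 2 := by positivity
  have mD : ∀ β : ℝ, Measurable fun x => z + β * |Δ x| := fun β =>
    (hΔ.measurable.abs.const_mul β).const_add z
  have mE : ∀ (β : ℝ) i, Measurable fun x => z + β * |E i x| := fun β i =>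
    ((hΔ.measurable_loo i).abs.const_mul β).const_add z
  have lD : ∀ β : ℝ, MemLp (fun x => z + β * |Δ x|) 2 (iid ι μ) := fun β =>
    (memLp_const z).add (hΔ.memLp.abs.const_mul β)
  have lE : ∀ (β : ℝ) i, MemLp (fun x => z + β * |E i x|) 2 (iid ι μ) := fun β i =>
    (memLp_const z).add ((hΔ.memLp_loo i).abs.const_mul β)
  have dE : ∀ (β : ℝ) i, DependsOn (fun x => z + β * |E i x|) {i}ᶜ := fun β i x y hxy => by
    simp only [hΔ.dependsOn i hxy]
  have hc := randomized_concentration h.measurable h.memLp h.mean I hδ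
    (D₁ := fun x => z + α * |Δ x|) (D₂ := fun x => z + (α + 1) * |Δ x|)
    (E₁ := fun i x => z + α * |E i x|) (E₂ := fun i x => z + (α + 1) * |E i x|) hB hBd hV hVd
    (mD _) (mD _) (fun i _ => mE _ i) (fun i _ => mE _ i)
    (lD _) (lD _) (fun i _ => lE _ i) (fun i _ => lE _ i)
    (fun i _ => dE _ i) (fun i _ => dE _ i)
    (fun x => by nlinarith [abs_nonneg (Δ x)])
  set R := (iid ι μ).real (B ∩ {x | z + α * |Δ x| ≤ ∑ i ∈ I, φ (x i) + V x ∧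
        ∑ i ∈ I, φ (x i) + V x ≤ z + (α + 1) * |Δ x|})
  set b := (iid ι μ).real B with hb
  have hb0 : 0 ≤ b := measureReal_nonneg
  set s := √((I.card : ℝ) / Fintype.card ι) with hs
  have hspos : 0 < s := by positivity
  have hs2 : s ^ 2 = I.card / Fintype.card ι := Real.sq_sqrt (by positivity)
  have hSL : MemLp (fun x : ι → ℝ => ∑ i ∈ I, φ (x i)) 2 (iid ι μ) := memLp_sum_eval h.memLp I
  have hSm : Measurable fun x : ι → ℝ => ∑ i ∈ I, φ (x i) := measurable_sum_eval hm I
  have e1 : ∫ x in B, (∑ i ∈ I, φ (x i)) ^ 2 ∂iid ι μ = b * s ^ 2 := by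
    rw [setIntegral_of_dependsOn hB (F := fun x => (∑ i ∈ I, φ (x i)) ^ 2) (hSm.pow_const 2) hBd
      (fun x y hxy => by simp only [dependsOn_sum φ I hxy] :
        DependsOn (fun x : ι → ℝ => (∑ i ∈ I, φ (x i)) ^ 2) (I : Set ι)) disjoint_compl_left,
      h.integral_sq_sum, hs2]
  have e2 : ∀ i ∈ I, ∫ x in B, φ (x i) ^ 2 ∂iid ι μ = b * (Fintype.card ι : ℝ)⁻¹ := fun i hi => by
    rw [setIntegral_of_dependsOn hB (F := fun x => φ (x i) ^ 2)
      ((hm.comp (measurable_pi_apply i)).pow_const 2) hBd (dependsOn_eval (fun a => φ a ^ 2) i)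
      (disjoint_singleton_right.2 (by simpa using hi)),
      integral_eval (φ := fun a => φ a ^ 2) (hm.pow_const 2), h.second_eq]
  have b1 : ∫ x in B, |∑ i ∈ I, φ (x i)| * |Δ x| ∂iid ι μ ≤ √b * s * η := by
    refine (setIntegral_abs_mul_le hB hSL hΔ.memLp).trans ?_
    rw [e1, Real.sqrt_mul hb0, Real.sqrt_sq hspos.le]
    exact mul_le_mul_of_nonneg_left hΔ.norm_le (by positivity)
  have b2 : ∫ x in B, |∑ i ∈ I, φ (x i)| ∂iid ι μ ≤ b * s := by
    rw [setIntegral_of_dependsOn hB hSm.abs hBd (dependsOn_abs_sum φ I) disjoint_compl_left]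
    exact mul_le_mul_of_nonneg_left (h.integral_abs_sum_le I) measureReal_nonneg
  have iSΔ : Integrable (fun x => |∑ i ∈ I, φ (x i)| * |Δ x|) (iid ι μ) := by
    simpa [abs_mul] using (hSL.integrable_mul hΔ.memLp).abs
  have c1 : ∫ x in B, |∑ i ∈ I, φ (x i)| * ((z + (α + 1) * |Δ x| - (z + α * |Δ x|)) / 2 + L / 2)
      ∂iid ι μ ≤ √b * s * η / 2 + b * s * (L / 2) := by
    have e : ∀ x : ι → ℝ, |∑ i ∈ I, φ (x i)| *
        ((z + (α + 1) * |Δ x| - (z + α * |Δ x|)) / 2 + L / 2)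
        = |∑ i ∈ I, φ (x i)| * |Δ x| * (1 / 2) + |∑ i ∈ I, φ (x i)| * (L / 2) := fun x => by ring
    simp_rw [e]
    rw [integral_add (iSΔ.mul_const _).restrict
      ((hSL.integrable (by norm_num)).abs.mul_const _).restrict, integral_mul_const,
      integral_mul_const]
    have := mul_le_mul_of_nonneg_right b2 hδ
    linarith
  -- For `-1 ≤ α ≤ 0` one has `|α| + |α + 1| = 1`, so the two endpoint errors together cost a single
  -- `|Δ - E i|`.
  have c2 : ∀ i ∈ I, ∫ x in B, |φ (x i)| * (|z + α * |Δ x| - (z + α * |E i x|)|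
      + |z + (α + 1) * |Δ x| - (z + (α + 1) * |E i x|)|) ∂iid ι μ
      ≤ √b * √2 * η / Fintype.card ι := by
    intro i hi
    have hφi : MemLp (fun x : ι → ℝ => φ (x i)) 2 (iid ι μ) := memLp_eval h.memLp i
    have hd := hΔ.memLp.sub (hΔ.memLp_loo i)
    have h1 := setIntegral_abs_mul_le hB hφi hd
    rw [e2 i hi, Real.sqrt_mul hb0, Real.sqrt_inv] at h1
    have h2 : ∫ x in B, |φ (x i)| * (|z + α * |Δ x| - (z + α * |E i x|)|
        + |z + (α + 1) * |Δ x| - (z + (α + 1) * |E i x|)|) ∂iid ι μ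
        ≤ ∫ x in B, |φ (x i)| * |(Δ - E i) x| ∂iid ι μ := by
      refine integral_mono_of_nonneg (ae_of_all _ fun x => by positivity) ?_ (ae_of_all _ fun x => ?_)
      · have : Integrable (fun x => |φ (x i)| * |(Δ - E i) x|) (iid ι μ) := by
          simpa only [Pi.mul_apply, abs_mul] using (hφi.integrable_mul hd).abs
        exact this.restrict
      · refine mul_le_mul_of_nonneg_left ?_ (abs_nonneg _)
        have k := abs_abs_sub_abs_le_abs_sub (Δ x) (E i x)
        rw [show z + α * |Δ x| - (z + α * |E i x|) = α * (|Δ x| - |E i x|) by ring,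
          show z + (α + 1) * |Δ x| - (z + (α + 1) * |E i x|) = (α + 1) * (|Δ x| - |E i x|) by ring,
          abs_mul, abs_mul, abs_of_nonpos hα', abs_of_nonneg (show 0 ≤ α + 1 by linarith)]
        have : -α * |(|Δ x| - |E i x|)| + (α + 1) * |(|Δ x| - |E i x|)| = |(|Δ x| - |E i x|)| := by
          ring
        rw [this]
        exact k
    refine h2.trans (h1.trans ?_)
    have h3 := hΔ.norm_sub_le i
    have hn' : √(Fintype.card ι : ℝ) * √(Fintype.card ι : ℝ) = Fintype.card ι :=
      Real.mul_self_sqrt hn.le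
    calc √b * (√(Fintype.card ι : ℝ))⁻¹ * √(∫ x, (Δ - E i) x ^ 2 ∂iid ι μ)
        ≤ √b * (√(Fintype.card ι : ℝ))⁻¹ * (√2 * η / √(Fintype.card ι)) :=
          mul_le_mul_of_nonneg_left h3 (by positivity)
      _ = √b * √2 * η / (√(Fintype.card ι : ℝ) * √(Fintype.card ι : ℝ)) := by field_simp
      _ = _ := by rw [hn']
  have c2' := Finset.sum_le_sum c2
  rw [Finset.sum_const, nsmul_eq_mul] at c2'
  have c3 : √(I.card * ∫ a, φ a ^ 2 ∂μ) = s := by rw [h.second_eq, ← div_eq_mul_inv]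
  rw [c3] at hc
  have hu := h.half_le_truncMoment hL
  have hR : 0 ≤ R := measureReal_nonneg
  have c4 : (I.card : ℝ) * (√b * √2 * η / Fintype.card ι) = s ^ 2 * (√2 * (√b * η)) := by
    rw [hs2]; field_simp
  have hsum : s ^ 2 / 2 * R ≤ s / 2 * (√b * η + 1.5 * L * b) + s ^ 2 / 2 * (√2 * (√b * η)) := by
    have h1 : s ^ 2 / 2 ≤ I.card * truncMoment μ φ (L / 2) := by
      rw [hs2]
      refine le_trans (le_of_eq ?_) (mul_le_mul_of_nonneg_left hu hIc.le)
      field_simp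
    have h3 := mul_le_mul_of_nonneg_right h1 hR
    rw [c4] at c2'
    linarith
  have hinv : √((Fintype.card ι : ℝ) / I.card) = s⁻¹ := by
    rw [hs, ← Real.sqrt_inv, inv_div]
  rw [hinv]
  have h4 : R = (s ^ 2 / 2 * R) * (2 / s ^ 2) := by field_simp
  rw [h4]
  calc (s ^ 2 / 2 * R) * (2 / s ^ 2)
      ≤ (s / 2 * (√b * η + 1.5 * L * b) + s ^ 2 / 2 * (√2 * (√b * η))) * (2 / s ^ 2) := by gcongr
    _ = _ := by field_simp

omit hΔ in
lemma measurable_total (hΔm : Measurable Δ) : Measurable fun x : ι → ℝ => ∑ i, φ (x i) + Δ x :=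
  (measurable_sum_eval h.measurable _).add hΔm

omit h hΔ in
/-- A remainder changes a distribution function only through the probability of short intervals. -/
lemma abs_real_add_sub_le {W : (ι → ℝ) → ℝ} {z r : ℝ}
    (h0 : (iid ι μ).real {x | z - |Δ x| ≤ W x ∧ W x ≤ z} ≤ r)
    (h1 : (iid ι μ).real {x | z ≤ W x ∧ W x ≤ z + |Δ x|} ≤ r) :
    |(iid ι μ).real {x | W x + Δ x ≤ z} - (iid ι μ).real {x | W x ≤ z}| ≤ r := by
  have k1 : (iid ι μ).real {x | W x + Δ x ≤ z} ≤ (iid ι μ).real {x | W x ≤ z}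
      + (iid ι μ).real {x | z ≤ W x ∧ W x ≤ z + |Δ x|} := by
    refine le_trans (measureReal_mono fun x (hx : W x + Δ x ≤ z) => ?_) (measureReal_union_le _ _)
    rcases le_total (W x) z with hw | hw
    · exact Or.inl hw
    · exact Or.inr ⟨hw, by linarith [neg_abs_le (Δ x)]⟩
  have k2 : (iid ι μ).real {x | W x ≤ z} ≤ (iid ι μ).real {x | W x + Δ x ≤ z}
      + (iid ι μ).real {x | z - |Δ x| ≤ W x ∧ W x ≤ z} := by
    refine le_trans (measureReal_mono fun x (hx : W x ≤ z) => ?_) (measureReal_union_le _ _)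
    by_cases hw : W x + Δ x ≤ z
    · exact Or.inl hw
    · exact Or.inr ⟨by linarith [le_abs_self (Δ x), not_le.1 hw], hx⟩
  rw [abs_le]
  constructor <;> linarith

/-- **Uniform Berry–Esseen bound** for a normalized sum with a remainder. -/
theorem berry_esseen_remainder (z : ℝ) :
    |(iid ι μ).real {x | ∑ i, φ (x i) + Δ x ≤ z} - Phi z| ≤
      (1 + √2) * η + 6.1 * lyap ι μ φ p := by
  have hL0 := h.lyap_pos
  have hη := hΔ.nonneg
  have hs2 : 0 ≤ √2 := Real.sqrt_nonneg 2
  have hη2 : 0 ≤ (1 + √2) * η := by positivity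
  -- If `6.1 L ≥ 1` the bound exceeds one. Otherwise concentration and `berry_esseen` apply, with
  -- `1.5 + 4.3 ≤ 6.1`.
  rcases le_total 1 (6.1 * lyap ι μ φ p) with hL | hL
  · have h1 : (iid ι μ).real {x | ∑ i, φ (x i) + Δ x ≤ z} ≤ 1 := measureReal_le_one
    have h2 : 0 ≤ (iid ι μ).real {x | ∑ i, φ (x i) + Δ x ≤ z} := measureReal_nonneg
    have h3 := Phi_nonneg z
    have h4 := Phi_le_one z
    rw [abs_le]; constructor <;> linarith
  have hn := h.card_pos
  have hne : (Finset.univ : Finset ι).Nonempty := by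
    rw [← Finset.card_pos]; exact_mod_cast hn
  -- The values `α = -1` and `α = 0` give the intervals `[z - |Δ|, z]` and `[z, z + |Δ|]`.
  have key : ∀ α : ℝ, -1 ≤ α → α ≤ 0 → (iid ι μ).real {x | z + α * |Δ x| ≤ ∑ i, φ (x i) ∧
      ∑ i, φ (x i) ≤ z + (α + 1) * |Δ x|} ≤ (1 + √2) * η + 1.5 * lyap ι μ φ p := by
    intro α h1 h2
    have := h.concentration_remainder hΔ (by linarith) hne (V := fun _ => 0) (B := univ)
      MeasurableSet.univ (fun _ _ _ => rfl) measurable_const (fun _ _ _ => rfl) z h1 h2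
    simp only [add_zero, univ_inter, probReal_univ, Real.sqrt_one, one_mul, mul_one,
      Finset.card_univ] at this
    rw [div_self hn.ne', Real.sqrt_one] at this
    linarith
  have k1 := key (-1) le_rfl (by norm_num)
  have k2 := key 0 (by norm_num) le_rfl
  have e1 : ∀ x, z + -1 * |Δ x| = z - |Δ x| := fun x => by ring
  simp only [e1, neg_add_cancel, zero_mul, add_zero, zero_add, one_mul] at k1 k2
  have k3 := abs_real_add_sub_le (Δ := Δ) (W := fun x => ∑ i, φ (x i)) k1 k2
  have k4 := h.berry_esseen hL z
  calc _ ≤ _ := abs_sub_le _ ((iid ι μ).real {x | ∑ i, φ (x i) ≤ z}) _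
    _ ≤ _ := by linarith

end Normalized
end

/-! ### Sums with a remainder: the nonuniform bound -/

/-- The constant in the far concentration bound for a remainder. -/
noncomputable def farRC : ℝ := 4 * (256 * √tailC) + 3 * (256 * √tailC) ^ 2

/-- The constant in the nonuniform bound for a normalized sum with a remainder. -/
noncomputable def nonuniformC : ℝ := 2 * farRC + 4 * farDC + steinC + 12

lemma farRC_pos : 0 < farRC := by unfold farRC; have := tailC_pos; positivity

lemma nonuniformC_ge : 12 ≤ nonuniformC := by
  unfold nonuniformC; have := farRC_pos; have := farDC_pos; have := steinC_pos; linarith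

section

variable {ι : Type*} [Fintype ι] [DecidableEq ι] {μ : Measure ℝ} [IsProbabilityMeasure μ]
  {φ : ℝ → ℝ} {p : ℝ} {Δ : (ι → ℝ) → ℝ} {E : ι → (ι → ℝ) → ℝ} {η : ℝ}

namespace Normalized

variable (h : Normalized ι μ φ p) (hΔ : SmallRemainder ι μ Δ E η)
include h hΔ

/-- Concentration in a random interval on the event that a part of the sum is far out. -/
lemma concentration_remainder_far {J J' : Finset ι} (hd : Disjoint J J') (hJJ : J ∪ J' = Finset.univ)
    (hJ' : (Fintype.card ι : ℝ) ≤ 4 * J'.card) {x : ℝ} (hx : 8 ≤ x) (z : ℝ) {α : ℝ} (hα : -1 ≤ α)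
    (hα' : α ≤ 0) :
    (iid ι μ).real (farEvent φ J x ∩ {ω | z + α * |Δ ω| ≤ ∑ i, φ (ω i) ∧
        ∑ i, φ (ω i) ≤ z + (α + 1) * |Δ ω|}) ≤
      4 * (√tailC * (x ^ 4)⁻¹ * η) + 3 * (√tailC * (x ^ 4)⁻¹) ^ 2 * lyap ι μ φ p := by
  have hm := h.measurable
  have hL0 := h.lyap_pos
  have hn := h.card_pos
  have hη := hΔ.nonneg
  set L := lyap ι μ φ p
  set k := √tailC * (x ^ 4)⁻¹ with hk
  have hk0 : 0 ≤ k := by positivity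
  set b := (iid ι μ).real (farEvent φ J x) with hb
  have hb0 : 0 ≤ b := measureReal_nonneg
  have hbk : b ≤ k ^ 2 := by
    refine (h.real_farEvent_le J hx).trans (le_of_eq ?_)
    rw [hk, mul_pow, Real.sq_sqrt tailC_pos.le]; field_simp
  -- The remainder enters through Cauchy–Schwarz on the event, hence with `√P(B)`. The eighth power
  -- in the tail bound leaves `x^(-4)`, which suffices because `p ≤ 3`.
  have hsb : √b ≤ k := Real.sqrt_le_iff.2 ⟨hk0, hbk⟩
  rcases le_total L (1 / 2) with hL | hL
  · have hI : J'.Nonempty := by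
      rw [← Finset.card_pos]; have : (0 : ℝ) < J'.card := by linarith
      exact_mod_cast this
    have hIpos : (0 : ℝ) < J'.card := by linarith
    have hsub : (J : Set ι) ⊆ (J' : Set ι)ᶜ := fun i hi hi' =>
      Finset.disjoint_left.1 hd hi hi'
    have hc := h.concentration_remainder hΔ hL hI (measurableSet_farEvent hm J x)
      ((dependsOn_farEvent φ J x).mono hsub) (measurable_sum_eval hm J)
      ((dependsOn_sum φ J).mono hsub) z hα hα'
    have e : ∀ ω : ι → ℝ, ∑ i ∈ J', φ (ω i) + ∑ i ∈ J, φ (ω i) = ∑ i, φ (ω i) := fun ω => by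
      rw [← hJJ, Finset.sum_union hd, add_comm]
    simp only [e] at hc
    refine hc.trans ?_
    have hs : √((Fintype.card ι : ℝ) / J'.card) ≤ 2 := by
      rw [Real.sqrt_le_left (by norm_num), div_le_iff₀ hIpos]; linarith
    have hs2 : √(2 : ℝ) ≤ 2 := by rw [Real.sqrt_le_left (by norm_num)]; norm_num
    have h1 : √b * η ≤ k * η := by gcongr
    have h2 : 1.5 * L * b ≤ 1.5 * L * k ^ 2 := by gcongr
    calc √((Fintype.card ι : ℝ) / J'.card) * (√b * η + 1.5 * L * b) + √2 * (√b * η)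
        ≤ 2 * (k * η + 1.5 * L * k ^ 2) + 2 * (k * η) := by gcongr
      _ = _ := by ring
  · refine (measureReal_mono inter_subset_left).trans (hbk.trans ?_)
    have : 0 ≤ 4 * (k * η) := by positivity
    nlinarith [sq_nonneg k]

lemma real_abs_gt_le {t : ℝ} (ht : 0 < t) :
    (iid ι μ).real {ω | t < |Δ ω|} ≤ η ^ 2 / t ^ 2 := by
  have hset : MeasurableSet {ω : ι → ℝ | t < |Δ ω|} := measurableSet_lt measurable_const hΔ.measurable.abs
  have hpt : ∀ ω, {ω | t < |Δ ω|}.indicator (fun _ => (1 : ℝ)) ω ≤ (t ^ 2)⁻¹ * Δ ω ^ 2 := by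
    intro ω
    by_cases hω : t < |Δ ω|
    · rw [indicator_of_mem (show ω ∈ {ω | t < |Δ ω|} from hω), ← div_eq_inv_mul,
        one_le_div (by positivity), ← sq_abs (Δ ω)]
      exact pow_le_pow_left₀ ht.le hω.le 2
    · rw [indicator_of_notMem (show ω ∉ {ω | t < |Δ ω|} from hω)]; positivity
  have h1 := integral_mono ((integrable_const (1 : ℝ)).indicator hset)
    (hΔ.memLp.integrable_sq.const_mul ((t ^ 2)⁻¹)) hpt
  rw [integral_indicator hset, integral_const_mul] at h1
  simp only [integral_const, smul_eq_mul, mul_one, measureReal_restrict_apply, univ_inter,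
    MeasurableSet.univ] at h1
  refine h1.trans ?_
  rw [div_eq_inv_mul]
  refine mul_le_mul_of_nonneg_left ?_ (by positivity)
  have h2 := (Real.sqrt_le_left hΔ.nonneg).1 hΔ.norm_le
  exact h2

/-- If `W` lies within `|Δ|` of `z`, there are three cases. Either `|Δ| > (1 + z)/3`, and
Chebyshev's inequality gives `9η²/(1 + z)²`; or some summand exceeds `z/64`; or `W ≥ z/2`, so one
half of the sum is at least `z/4` and concentration on that far event applies. -/
lemma nonuniform_far (hι : 4 ≤ Fintype.card ι) {z : ℝ} (hz : 64 ≤ z) :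
    |(iid ι μ).real {x | ∑ i, φ (x i) + Δ x ≤ z} - Phi z| ≤
      9 * η ^ 2 / (1 + z) ^ 2 + nonuniformC * ((η + lyap ι μ φ p) * (z / 64) ^ (-p)) := by
  have hm := h.measurable
  have hL0 := h.lyap_pos
  have hη := hΔ.nonneg
  have hp := h.two_lt
  have hp3 := h.le_three
  obtain ⟨J, J', hd, hJJ, hJ, hJ'⟩ := exists_halves (S := (Finset.univ : Finset ι)) hι
    (by rw [Finset.card_univ]; omega)
  set L := lyap ι μ φ p
  set y := z / 64 with hy
  have hy1 : 1 ≤ y := by rw [hy]; linarith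
  have hy0 : 0 < y := by linarith
  set q := y ^ (-p) with hq
  have hq0 : 0 < q := Real.rpow_pos_of_pos hy0 _
  have hy4q : (z ^ 4)⁻¹ ≤ q := by
    have hz4 : (z ^ 4)⁻¹ ≤ (y ^ 4)⁻¹ :=
      inv_anti₀ (by positivity) (pow_le_pow_left₀ hy0.le (by linarith) 4)
    refine hz4.trans ?_
    rw [hq, ← Real.rpow_natCast, ← Real.rpow_neg hy0.le]
    exact Real.rpow_le_rpow_of_exponent_le hy1 (by push_cast; linarith)
  have hz8 : (z ^ 4)⁻¹ ^ 2 ≤ (z ^ 4)⁻¹ := by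
    have h0 : 0 ≤ (z ^ 4)⁻¹ := by positivity
    have h1 : (z ^ 4)⁻¹ ≤ 1 := inv_le_one_of_one_le₀ (one_le_pow₀ (by linarith))
    nlinarith
  have hfar : 4 * (√tailC * ((z / 4) ^ 4)⁻¹ * η) + 3 * (√tailC * ((z / 4) ^ 4)⁻¹) ^ 2 * L
      ≤ farRC * ((η + L) * q) := by
    have e : √tailC * ((z / 4) ^ 4)⁻¹ = 256 * √tailC * (z ^ 4)⁻¹ := by
      field_simp; norm_num
    rw [e, farRC]
    set k := 256 * √tailC
    have hk : 0 ≤ k := by positivity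
    have a1 : k * η * (z ^ 4)⁻¹ ≤ k * η * q := by gcongr
    have a2 : k ^ 2 * L * (z ^ 4)⁻¹ ^ 2 ≤ k ^ 2 * L * q := by
      gcongr; exact hz8.trans hy4q
    have a3 : 0 ≤ k * L * q := by positivity
    have a4 : 0 ≤ k ^ 2 * η * q := by positivity
    calc 4 * (k * (z ^ 4)⁻¹ * η) + 3 * (k * (z ^ 4)⁻¹) ^ 2 * L
        = 4 * (k * η * (z ^ 4)⁻¹) + 3 * (k ^ 2 * L * (z ^ 4)⁻¹ ^ 2) := by ring
      _ ≤ 4 * (k * η * q) + 3 * (k ^ 2 * L * q) + 4 * (k * L * q) + 3 * (k ^ 2 * η * q) := by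
          linarith
      _ = _ := by ring
  have key : ∀ α : ℝ, -1 ≤ α → α ≤ 0 → (iid ι μ).real {x | z + α * |Δ x| ≤ ∑ i, φ (x i) ∧
      ∑ i, φ (x i) ≤ z + (α + 1) * |Δ x|} ≤
      9 * η ^ 2 / (1 + z) ^ 2 + (2 * farRC + 1) * ((η + L) * q) := by
    intro α h1 h2
    set G := {x : ι → ℝ | z + α * |Δ x| ≤ ∑ i, φ (x i) ∧ ∑ i, φ (x i) ≤ z + (α + 1) * |Δ x|}
    have c1 := h.concentration_remainder_far hΔ hd hJJ hJ' (x := z / 4) (by linarith) z h1 h2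
    have c2 := h.concentration_remainder_far hΔ hd.symm (by rw [Finset.union_comm, hJJ]) hJ
      (x := z / 4) (by linarith) z h1 h2
    have c3 := h.real_compl_smallEvent_le (Finset.univ : Finset ι) hy0
    have c4 := h.real_abs_gt_le hΔ (t := (1 + z) / 3) (by linarith)
    have hsub : G ⊆ ({x | (1 + z) / 3 < |Δ x|} ∪ (smallEvent φ Finset.univ y)ᶜ) ∪
        ((farEvent φ J (z / 4) ∩ G) ∪ (farEvent φ J' (z / 4) ∩ G)) := by
      intro x hx
      by_cases hxΔ : (1 + z) / 3 < |Δ x|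
      · exact Or.inl (Or.inl hxΔ)
      by_cases hxs : x ∈ smallEvent φ Finset.univ y
      swap
      · exact Or.inl (Or.inr hxs)
      right
      have hW : z / 2 ≤ ∑ i, φ (x i) := by
        have := hx.1
        nlinarith [abs_nonneg (Δ x), not_lt.1 hxΔ]
      rw [← hJJ, Finset.sum_union hd] at hW
      have hsm : ∀ K : Finset ι, x ∈ smallEvent φ K y := fun K j _ => hxs j (Finset.mem_univ j)
      rcases le_total (z / 4) (∑ i ∈ J, φ (x i)) with hS | hS
      · exact Or.inl ⟨farEvent_mono_of_small J (y := y) (by rw [hy]; linarith) ⟨hsm J, hS⟩, hx⟩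
      · exact Or.inr ⟨farEvent_mono_of_small J' (y := y) (by rw [hy]; linarith)
          ⟨hsm J', by show z / 4 ≤ ∑ j ∈ J', φ (x j); linarith⟩, hx⟩
    have b1 := measureReal_mono hsub (measure_ne_top (iid ι μ) _)
    have b2 := measureReal_union_le (μ := iid ι μ)
      ({x | (1 + z) / 3 < |Δ x|} ∪ (smallEvent φ Finset.univ y)ᶜ)
      ((farEvent φ J (z / 4) ∩ G) ∪ (farEvent φ J' (z / 4) ∩ G))
    have b3 := measureReal_union_le (μ := iid ι μ) {x | (1 + z) / 3 < |Δ x|}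
      (smallEvent φ Finset.univ y)ᶜ
    have b4 := measureReal_union_le (μ := iid ι μ) (farEvent φ J (z / 4) ∩ G)
      (farEvent φ J' (z / 4) ∩ G)
    have e : η ^ 2 / ((1 + z) / 3) ^ 2 = 9 * η ^ 2 / (1 + z) ^ 2 := by
      field_simp; norm_num
    rw [e] at c4
    have : 0 ≤ η * q := by positivity
    linarith
  have k1 := key (-1) le_rfl (by norm_num)
  have k2 := key 0 (by norm_num) le_rfl
  have e1 : ∀ x, z + -1 * |Δ x| = z - |Δ x| := fun x => by ring
  simp only [e1, neg_add_cancel, zero_mul, add_zero, zero_add, one_mul] at k1 k2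
  have k3 := abs_real_add_sub_le (Δ := Δ) (W := fun x => ∑ i, φ (x i)) k1 k2
  have k4 := h.nonuniform_berry_esseen hι hz
  have k5 : (4 * farDC + steinC + 11) * (L * q) ≤ (4 * farDC + steinC + 11) * ((η + L) * q) := by
    have := farDC_pos
    have := steinC_pos
    gcongr; linarith
  rw [nonuniformC]
  calc _ ≤ _ := abs_sub_le _ ((iid ι μ).real {x | ∑ i, φ (x i) ≤ z}) _
    _ ≤ _ := by linarith

/-- For `z ≥ 64` one has `(1 + z)/128 ≤ z/64`. For `z ≤ 64` the power of `(1 + z)/128` is at least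
one, and the uniform bound suffices since `nonuniformC ≥ 12`. -/
lemma nonuniform_of_nonneg (hι : 4 ≤ Fintype.card ι) {z : ℝ} (hz : 0 ≤ z) :
    |(iid ι μ).real {x | ∑ i, φ (x i) + Δ x ≤ z} - Phi z| ≤
      9 * η ^ 2 / (1 + z) ^ 2 + nonuniformC * ((η + lyap ι μ φ p) * ((1 + z) / 128) ^ (-p)) := by
  have hL0 := h.lyap_pos
  have hη := hΔ.nonneg
  have hp := h.two_lt
  have hN := nonuniformC_ge
  rcases le_total 64 z with hz64 | hz64
  · refine (h.nonuniform_far hΔ hι hz64).trans ?_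
    have h1 : (z / 64) ^ (-p) ≤ ((1 + z) / 128) ^ (-p) :=
      Real.rpow_le_rpow_of_nonpos (by linarith) (by linarith) (by linarith)
    gcongr
  · refine (h.berry_esseen_remainder hΔ z).trans ?_
    have h1 : 1 ≤ ((1 + z) / 128) ^ (-p) :=
      Real.one_le_rpow_of_pos_of_le_one_of_nonpos (by linarith) (by linarith) (by linarith)
    have h2 : 0 ≤ 9 * η ^ 2 / (1 + z) ^ 2 := by positivity
    have hs2 : √(2 : ℝ) ≤ 2 := by rw [Real.sqrt_le_left (by norm_num)]; norm_num
    have h3 : √2 * η ≤ 2 * η := by gcongr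
    have h4 : η + lyap ι μ φ p ≤ (η + lyap ι μ φ p) * ((1 + z) / 128) ^ (-p) :=
      le_mul_of_one_le_right (by positivity) h1
    nlinarith

/-- **Nonuniform Berry–Esseen bound** for a normalized sum with a remainder. -/
theorem nonuniform_berry_esseen_remainder (hι : 4 ≤ Fintype.card ι) (z : ℝ) :
    |(iid ι μ).real {x | ∑ i, φ (x i) + Δ x ≤ z} - Phi z| ≤
      9 * η ^ 2 / (1 + |z|) ^ 2
        + nonuniformC * ((η + lyap ι μ φ p) * ((1 + |z|) / 128) ^ (-p)) := by
  rcases le_or_gt 0 z with hz | hz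
  · rw [abs_of_nonneg hz]; exact h.nonuniform_of_nonneg hΔ hι hz
  set bd : ℝ → ℝ := fun z => 9 * η ^ 2 / (1 + |z|) ^ 2
        + nonuniformC * ((η + lyap ι μ φ p) * ((1 + |z|) / 128) ^ (-p)) with hbd
  have hL : lyap ι μ (fun a => -φ a) p = lyap ι μ φ p := by simp [lyap]
  have hTm := h.measurable_total hΔ.measurable
  -- Replacing `φ`, `Δ` by their negatives gives the bound for the strict event `< w`. Letting `w`
  -- decrease to `z`, where `Φ` and the bound are continuous, gives the upper estimate for `≤ z`.
  have hlt : ∀ w : ℝ, w ≤ 0 →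
      |(iid ι μ).real {x | ∑ i, φ (x i) + Δ x < w} - Phi w| ≤ bd w := by
    intro w hw
    have h1 := h.neg.nonuniform_of_nonneg hΔ.neg hι (z := -w) (by linarith)
    rw [hL, Phi_neg, ← abs_of_nonpos hw] at h1
    have e : {x : ι → ℝ | ∑ i, -φ (x i) + -Δ x ≤ -w} = {x : ι → ℝ | ∑ i, φ (x i) + Δ x < w}ᶜ := by
      ext x
      simp only [Finset.sum_neg_distrib, mem_ofPred_eq, mem_compl_iff, not_lt]
      constructor <;> intro k <;> linarith
    rw [abs_of_nonpos hw, e, ← abs_of_nonpos hw,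
      probReal_compl_eq_one_sub (measurableSet_lt hTm measurable_const)] at h1
    rw [← abs_neg]
    convert h1 using 2
    ring
  have hcont : Continuous bd := by
    have h1 : ∀ z : ℝ, (1 + |z|) ^ 2 ≠ 0 := fun z => by positivity
    have h2 : ∀ z : ℝ, (1 + |z|) / 128 ≠ 0 := fun z => by positivity
    have h3 : Continuous fun z : ℝ => ((1 + |z|) / 128) ^ (-p) :=
      Continuous.rpow_const (by fun_prop) fun z => Or.inl (h2 z)
    exact (continuous_const.div (by fun_prop) h1).add
      (continuous_const.mul (continuous_const.mul h3))
  have hlow : Phi z - bd z ≤ (iid ι μ).real {x | ∑ i, φ (x i) + Δ x ≤ z} := by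
    have h1 := (abs_le.1 (hlt z hz.le)).1
    have h2 : (iid ι μ).real {x | ∑ i, φ (x i) + Δ x < z}
        ≤ (iid ι μ).real {x | ∑ i, φ (x i) + Δ x ≤ z} :=
      measureReal_mono fun x (hx : ∑ i, φ (x i) + Δ x < z) => hx.le
    linarith
  have hup : (iid ι μ).real {x | ∑ i, φ (x i) + Δ x ≤ z} ≤ Phi z + bd z := by
    have ht : Tendsto (fun w => Phi w + bd w) (𝓝[>] z) (𝓝 (Phi z + bd z)) :=
      ((continuous_Phi.add hcont).tendsto z).mono_left nhdsWithin_le_nhds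
    refine ge_of_tendsto ht ?_
    filter_upwards [Ioo_mem_nhdsGT hz] with w hw
    have h1 := (abs_le.1 (hlt w hw.2.le)).2
    have h2 : (iid ι μ).real {x | ∑ i, φ (x i) + Δ x ≤ z}
        ≤ (iid ι μ).real {x | ∑ i, φ (x i) + Δ x < w} :=
      measureReal_mono fun x (hx : ∑ i, φ (x i) + Δ x ≤ z) => hx.trans_lt hw.1
    linarith
  rw [abs_le]
  constructor <;> linarith

end Normalized
end

/-! ### Step functions and linear functionals of the empirical process -/

/-- The distribution function of the point mass at `x`. -/
noncomputable def step (x s : ℝ) : ℝ := (Ici x).indicator (fun _ => (1 : ℝ)) s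

lemma step_eq (x s : ℝ) : step x s = if x ≤ s then 1 else 0 := by simp [step, indicator]

lemma step_nonneg (x s : ℝ) : 0 ≤ step x s := by rw [step_eq]; split_ifs <;> norm_num

lemma step_le_one (x s : ℝ) : step x s ≤ 1 := by rw [step_eq]; split_ifs <;> norm_num

lemma measurable_step_uncurry : Measurable (Function.uncurry step) := by
  have : Function.uncurry step = fun q : ℝ × ℝ => if q.1 ≤ q.2 then (1 : ℝ) else 0 := by
    ext q; exact step_eq _ _
  rw [this]
  exact Measurable.ite (measurableSet_le measurable_fst measurable_snd) measurable_const
    measurable_const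

lemma measurable_step_comp {α : Type*} [MeasurableSpace α] {f k : α → ℝ} (hf : Measurable f)
    (hk : Measurable k) : Measurable fun a => step (f a) (k a) :=
  measurable_step_uncurry.comp (hf.prodMk hk)

lemma step_mul_step (x s t : ℝ) : step x s * step x t = step x (min s t) := by
  simp only [step_eq, le_min_iff]
  split_ifs <;> simp_all

lemma step_sub_of_le {x y : ℝ} (hxy : x ≤ y) (s : ℝ) :
    step x s - step y s = (Ico x y).indicator (fun _ => (1 : ℝ)) s := by
  simp only [step_eq, indicator, mem_Ico]
  by_cases h1 : x ≤ s <;> by_cases h2 : y ≤ s <;> simp_all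
  · exact absurd (hxy.trans h2) (not_le.2 h1)

lemma integrable_step_sub (x y : ℝ) : Integrable fun s => step x s - step y s := by
  rcases le_total x y with hxy | hxy
  · simp only [step_sub_of_le hxy]
    exact (integrable_indicator_iff measurableSet_Ico).2 (by simp)
  · have e : ∀ s, step x s - step y s = -((Ico y x).indicator (fun _ => (1 : ℝ)) s) := fun s => by
      rw [← step_sub_of_le hxy]; ring
    simp only [e]
    exact ((integrable_indicator_iff measurableSet_Ico).2 (by simp)).neg

/-- With first argument `0` this writes a real number as an integral of step functions, the
representation that turns `T` into an integral over the line. -/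
lemma integral_step_sub (x y : ℝ) : ∫ s, (step x s - step y s) = y - x := by
  rcases le_total x y with hxy | hxy
  · simp only [step_sub_of_le hxy]
    rw [integral_indicator measurableSet_Ico]
    simp [hxy]
  · have e : ∀ s, step x s - step y s = -((Ico y x).indicator (fun _ => (1 : ℝ)) s) := fun s => by
      rw [← step_sub_of_le hxy]; ring
    simp only [e]
    rw [integral_neg, integral_indicator measurableSet_Ico]
    simp [hxy]

lemma integral_abs_step_sub (x y : ℝ) : ∫ s, |step x s - step y s| = |x - y| := by
  have key : ∀ {x y : ℝ}, x ≤ y → ∫ s, |step x s - step y s| = y - x := fun {x y} hxy => by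
    rw [← integral_step_sub]
    refine integral_congr_ae (ae_of_all _ fun s => ?_)
    simp only [step_sub_of_le hxy]
    exact abs_of_nonneg (indicator_nonneg (fun _ _ => zero_le_one) s)
  rcases le_total x y with hxy | hxy
  · rw [key hxy, abs_of_nonpos (by linarith)]; ring
  · simp_rw [abs_sub_comm (step x _) (step y _)]
    rw [key hxy, abs_of_nonneg (by linarith)]

section

variable {μ : Measure ℝ} [IsProbabilityMeasure μ]

lemma integrable_step (s : ℝ) : Integrable (fun x => step x s) μ :=
  (integrable_const (1 : ℝ)).mono'
    (measurable_step_comp measurable_id measurable_const).aestronglyMeasurable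
    (ae_of_all _ fun x => by
      rw [Real.norm_eq_abs, abs_of_nonneg (step_nonneg _ _)]; exact step_le_one _ _)

lemma integral_step (s : ℝ) : ∫ x, step x s ∂μ = cdf μ s := by
  have e : ∀ x, step x s = (Iic s).indicator (fun _ => (1 : ℝ)) x := fun x => by
    simp [step_eq, indicator]
  simp only [e]
  rw [integral_indicator measurableSet_Iic, cdf_eq_real]
  simp

lemma measurable_cdf : Measurable (cdf μ) := (monotone_cdf μ).measurable

/-- The deviation of the empirical distribution function of a single observation. -/
noncomputable def dev (μ : Measure ℝ) (x s : ℝ) : ℝ := step x s - cdf μ s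

lemma abs_dev_le (x s : ℝ) : |dev μ x s| ≤ 1 := by
  have h1 := cdf_nonneg μ s
  have h2 := cdf_le_one μ s
  have h3 := step_nonneg x s
  have h4 := step_le_one x s
  rw [dev, abs_le]; constructor <;> linarith

lemma measurable_dev_comp {α : Type*} [MeasurableSpace α] {f k : α → ℝ} (hf : Measurable f)
    (hk : Measurable k) : Measurable fun a => dev μ (f a) (k a) :=
  (measurable_step_comp hf hk).sub (measurable_cdf.comp hk)

lemma integral_dev (s : ℝ) : ∫ x, dev μ x s ∂μ = 0 := by
  simp only [dev]
  rw [integral_sub (integrable_step s) (integrable_const _), integral_step]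
  simp

/-- The covariance kernel of the empirical process. -/
noncomputable def bridge (μ : Measure ℝ) (s t : ℝ) : ℝ := cdf μ (min s t) * (1 - cdf μ (max s t))

lemma integral_dev_mul (s t : ℝ) : ∫ x, dev μ x s * dev μ x t ∂μ = bridge μ s t := by
  have e : ∀ x, dev μ x s * dev μ x t
      = step x (min s t) - cdf μ t * step x s - cdf μ s * step x t + cdf μ s * cdf μ t := fun x => by
    rw [← step_mul_step, dev, dev]; ring
  simp only [e]
  have i1 := integrable_step (μ := μ) (min s t)
  have i2 := (integrable_step (μ := μ) s).const_mul (cdf μ t)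
  have i3 := (integrable_step (μ := μ) t).const_mul (cdf μ s)
  have i12 : Integrable (fun x => step x (min s t) - cdf μ t * step x s) μ := i1.sub i2
  have i123 : Integrable (fun x => step x (min s t) - cdf μ t * step x s - cdf μ s * step x t) μ :=
    i12.sub i3
  rw [integral_add i123 (integrable_const _), integral_sub i12 i3, integral_sub i1 i2,
    integral_const_mul, integral_const_mul, integral_step, integral_step, integral_step,
    bridge]
  simp only [integral_const, probReal_univ, smul_eq_mul, one_mul]
  rcases le_total s t with h | h
  · rw [min_eq_left h, max_eq_right h]; ring
  · rw [min_eq_right h, max_eq_left h]; ring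

lemma bridge_nonneg (s t : ℝ) : 0 ≤ bridge μ s t :=
  mul_nonneg (cdf_nonneg _ _) (by linarith [cdf_le_one μ (max s t)])

variable (hX : MemLp (fun x : ℝ => x) 2 μ)
include hX

lemma integrable_step_sub_prod (x : ℝ) :
    Integrable (fun q : ℝ × ℝ => step x q.1 - step q.2 q.1) (volume.prod μ) := by
  have hm : Measurable fun q : ℝ × ℝ => step x q.1 - step q.2 q.1 :=
    (measurable_step_comp measurable_const measurable_fst).sub
      (measurable_step_comp measurable_snd measurable_fst)
  rw [integrable_prod_iff' hm.aestronglyMeasurable]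
  refine ⟨ae_of_all _ fun y => integrable_step_sub x y, ?_⟩
  simp only [Real.norm_eq_abs, integral_abs_step_sub]
  exact ((integrable_const x).sub (hX.integrable (by norm_num))).abs

/-- Steps are not integrable over the line but their differences are, so integrability of the
deviation comes from averaging differences. -/
lemma dev_eq_integral (x s : ℝ) : dev μ x s = ∫ y, (step x s - step y s) ∂μ := by
  rw [integral_sub (integrable_const _) (integrable_step s), integral_step, dev]; simp

lemma integrable_dev_volume (x : ℝ) : Integrable fun s => dev μ x s := by
  simp only [dev_eq_integral hX]
  exact (integrable_step_sub_prod hX x).integral_prod_left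

/-- The total deviation `∫ |I(x ≤ s) - F(s)| ds`. -/
noncomputable def totalDev (μ : Measure ℝ) (x : ℝ) : ℝ := ∫ s, |dev μ x s|

omit hX in
lemma totalDev_nonneg (x : ℝ) : 0 ≤ totalDev μ x := integral_nonneg fun _ => abs_nonneg _

omit hX in
lemma measurable_totalDev : Measurable (totalDev μ) := by
  have : Measurable fun q : ℝ × ℝ => |dev μ q.1 q.2| :=
    (measurable_dev_comp measurable_fst measurable_snd).abs
  exact this.stronglyMeasurable.integral_prod_right'.measurable

lemma totalDev_le (x : ℝ) : totalDev μ x ≤ ∫ y, |x - y| ∂μ := by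
  have hi := integrable_step_sub_prod hX x
  have h1 : ∫ y, |x - y| ∂μ = ∫ s, ∫ y, |step x s - step y s| ∂μ := by
    rw [← integral_congr_ae (ae_of_all _ fun y => integral_abs_step_sub x y)]
    exact (integral_integral_swap (f := fun s y => |step x s - step y s|) hi.abs).symm
  rw [h1, totalDev]
  refine integral_mono (integrable_dev_volume hX x).abs hi.abs.integral_prod_left fun s => ?_
  simp only [dev_eq_integral hX]
  exact abs_integral_le_integral_abs

lemma sq_totalDev_le (x : ℝ) :
    totalDev μ x ^ 2 ≤ x ^ 2 - 2 * x * ∫ y, y ∂μ + ∫ y, y ^ 2 ∂μ := by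
  have hd : MemLp (fun y => |x - y|) 2 μ := ((memLp_const x).sub hX).abs
  have h1 := pow_le_pow_left₀ (totalDev_nonneg x) (totalDev_le hX x) 2
  refine h1.trans ((sq_integral_le hd).trans (le_of_eq ?_))
  have e : ∀ y, |x - y| ^ 2 = x ^ 2 - 2 * x * y + y ^ 2 := fun y => by rw [sq_abs]; ring
  simp only [e]
  have i2 := (hX.integrable (by norm_num)).const_mul (2 * x)
  have i12 : Integrable (fun y => x ^ 2 - 2 * x * y) μ := (integrable_const _).sub i2
  rw [integral_add i12 hX.integrable_sq, integral_sub (integrable_const _) i2, integral_const_mul]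
  simp

lemma memLp_totalDev : MemLp (totalDev μ) 2 μ := by
  rw [memLp_two_iff_integrable_sq measurable_totalDev.aestronglyMeasurable]
  refine Integrable.mono' (g := fun x => x ^ 2 - 2 * x * ∫ y, y ∂μ + ∫ y, y ^ 2 ∂μ) ?_
    (measurable_totalDev.pow_const 2).aestronglyMeasurable (ae_of_all _ fun x => ?_)
  · exact (hX.integrable_sq.sub (((hX.integrable (by norm_num)).const_mul 2).mul_const _)).add
      (integrable_const _)
  · rw [Real.norm_eq_abs, abs_of_nonneg (sq_nonneg _)]
    exact sq_totalDev_le hX x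

/-- Since `totalDev x ≤ E|x - Y|`, the left side is at most `E(X - Y)² = 2 Var X` for an independent
copy `Y` of `X`. -/
lemma integral_sq_totalDev_le : ∫ x, totalDev μ x ^ 2 ∂μ ≤ 2 * ∫ x, x ^ 2 ∂μ := by
  have i1 := ((hX.integrable (by norm_num)).const_mul 2).mul_const (∫ y, y ∂μ)
  have h1 := integral_mono (memLp_totalDev hX).integrable_sq
    ((hX.integrable_sq.sub i1).add (integrable_const (∫ y, y ^ 2 ∂μ))) (sq_totalDev_le hX)
  simp only [Pi.add_apply, Pi.sub_apply] at h1
  have k1 := integral_add (hX.integrable_sq.sub i1) (integrable_const (∫ y, y ^ 2 ∂μ))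
  simp only [Pi.sub_apply] at k1
  rw [k1, integral_sub hX.integrable_sq i1, integral_mul_const, integral_const_mul] at h1
  simp only [integral_const, probReal_univ, smul_eq_mul, one_mul] at h1
  nlinarith [sq_nonneg (∫ y, y ∂μ)]

variable {k : ℝ → ℝ} {c : ℝ} (hk : Measurable k) (hkc : ∀ s, |k s| ≤ c)
include hk hkc

lemma integrable_dev_mul (x : ℝ) : Integrable fun s => dev μ x s * k s :=
  (integrable_dev_volume hX x).mul_bdd (c := c) hk.aestronglyMeasurable
    (ae_of_all _ hkc)

lemma abs_integral_dev_mul_le (x : ℝ) : |∫ s, dev μ x s * k s| ≤ c * totalDev μ x := by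
  refine abs_integral_le_integral_abs.trans ?_
  rw [totalDev, ← integral_const_mul]
  refine integral_mono (integrable_dev_mul hX hk hkc x).abs
    ((integrable_dev_volume hX x).abs.const_mul c) fun s => ?_
  simp only
  rw [abs_mul, mul_comm]
  exact mul_le_mul_of_nonneg_right (hkc s) (abs_nonneg _)

omit hX hkc in
lemma measurable_integral_dev_mul : Measurable fun x => ∫ s, dev μ x s * k s := by
  have : Measurable fun q : ℝ × ℝ => dev μ q.1 q.2 * k q.2 :=
    (measurable_dev_comp measurable_fst measurable_snd).mul (hk.comp measurable_snd)
  exact this.stronglyMeasurable.integral_prod_right'.measurable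

lemma memLp_integral_dev_mul : MemLp (fun x => ∫ s, dev μ x s * k s) 2 μ :=
  ((memLp_totalDev hX).const_mul c).mono (measurable_integral_dev_mul hk).aestronglyMeasurable
    (ae_of_all _ fun x => by
      rw [Real.norm_eq_abs, Real.norm_eq_abs]
      exact (abs_integral_dev_mul_le hX hk hkc x).trans (le_abs_self _))

lemma integral_integral_dev_mul : ∫ x, (∫ s, dev μ x s * k s) ∂μ = 0 := by
  have hm : Measurable (Function.uncurry fun x s => dev μ x s * k s) :=
    (measurable_dev_comp measurable_fst measurable_snd).mul (hk.comp measurable_snd)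
  have hi : Integrable (Function.uncurry fun x s => dev μ x s * k s) (μ.prod volume) := by
    rw [integrable_prod_iff hm.aestronglyMeasurable]
    refine ⟨ae_of_all _ fun x => integrable_dev_mul hX hk hkc x, ?_⟩
    refine (((memLp_totalDev hX).integrable (by norm_num)).const_mul c).mono'
      (hm.norm.stronglyMeasurable.integral_prod_right').aestronglyMeasurable (ae_of_all _ fun x => ?_)
    rw [Real.norm_eq_abs, abs_of_nonneg (integral_nonneg fun _ => norm_nonneg _), totalDev,
      ← integral_const_mul]
    refine integral_mono (integrable_dev_mul hX hk hkc x).norm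
      ((integrable_dev_volume hX x).abs.const_mul c) fun s => ?_
    simp only [Function.uncurry_apply_pair, norm_mul, Real.norm_eq_abs]
    rw [mul_comm]
    exact mul_le_mul_of_nonneg_right (hkc s) (abs_nonneg _)
  rw [integral_integral_swap hi]
  simp_rw [integral_mul_const, integral_dev]
  simp

/-- The variance of a linear functional of the empirical process. -/
lemma integral_sq_integral_dev_mul :
    Integrable (fun q : ℝ × ℝ => k q.1 * k q.2 * bridge μ q.1 q.2) (volume.prod volume) ∧
    ∫ x, (∫ s, dev μ x s * k s) ^ 2 ∂μ
      = ∫ q : ℝ × ℝ, k q.1 * k q.2 * bridge μ q.1 q.2 ∂(volume.prod volume) := by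
  have hm : Measurable (Function.uncurry fun x (q : ℝ × ℝ) =>
      dev μ x q.1 * k q.1 * (dev μ x q.2 * k q.2)) := by
    have m1 : Measurable fun r : ℝ × (ℝ × ℝ) => r.2.1 := measurable_fst.comp measurable_snd
    have m2 : Measurable fun r : ℝ × (ℝ × ℝ) => r.2.2 := measurable_snd.comp measurable_snd
    exact ((measurable_dev_comp measurable_fst m1).mul (hk.comp m1)).mul
      ((measurable_dev_comp measurable_fst m2).mul (hk.comp m2))
  have hsec : ∀ x, Integrable (fun q : ℝ × ℝ => dev μ x q.1 * k q.1 * (dev μ x q.2 * k q.2))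
      (volume.prod volume) := fun x =>
    (integrable_dev_mul hX hk hkc x).mul_prod (integrable_dev_mul hX hk hkc x)
  have hi : Integrable (Function.uncurry fun x (q : ℝ × ℝ) =>
      dev μ x q.1 * k q.1 * (dev μ x q.2 * k q.2)) (μ.prod (volume.prod volume)) := by
    rw [integrable_prod_iff hm.aestronglyMeasurable]
    refine ⟨ae_of_all _ hsec, ?_⟩
    refine ((memLp_totalDev hX).integrable_sq.const_mul (c ^ 2)).mono'
      (hm.norm.stronglyMeasurable.integral_prod_right').aestronglyMeasurable (ae_of_all _ fun x => ?_)
    rw [Real.norm_eq_abs, abs_of_nonneg (integral_nonneg fun _ => norm_nonneg _)]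
    simp only [Function.uncurry_apply_pair, norm_mul]
    have e : ∫ q : ℝ × ℝ, ‖dev μ x q.1‖ * ‖k q.1‖ * (‖dev μ x q.2‖ * ‖k q.2‖)
        ∂(volume.prod volume) = (∫ s, ‖dev μ x s‖ * ‖k s‖) * ∫ s, ‖dev μ x s‖ * ‖k s‖ :=
      integral_prod_mul (fun s => ‖dev μ x s‖ * ‖k s‖) (fun s => ‖dev μ x s‖ * ‖k s‖)
    rw [e, ← sq, ← mul_pow]
    refine pow_le_pow_left₀ (integral_nonneg fun _ => by positivity) ?_ 2
    rw [totalDev, ← integral_const_mul]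
    refine integral_mono ?_ ((integrable_dev_volume hX x).abs.const_mul c) fun s => ?_
    · simpa only [norm_mul] using (integrable_dev_mul hX hk hkc x).norm
    · simp only [Real.norm_eq_abs]
      rw [mul_comm]
      exact mul_le_mul_of_nonneg_right (hkc s) (abs_nonneg _)
  have hin : ∀ q : ℝ × ℝ, ∫ x, dev μ x q.1 * k q.1 * (dev μ x q.2 * k q.2) ∂μ
      = k q.1 * k q.2 * bridge μ q.1 q.2 := fun q => by
    rw [← integral_dev_mul, ← integral_const_mul]
    exact integral_congr_ae (ae_of_all _ fun x => by simp only; ring)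
  refine ⟨by simpa only [Function.uncurry_apply_pair, hin] using hi.integral_prod_right, ?_⟩
  rw [← integral_congr_ae (ae_of_all _ hin), ← integral_integral_swap hi]
  refine integral_congr_ae (ae_of_all _ fun x => ?_)
  simp only
  rw [sq]
  exact (integral_prod_mul (fun s => dev μ x s * k s) (fun s => dev μ x s * k s)).symm

omit hk hkc in
lemma integrable_bridge : Integrable (fun q : ℝ × ℝ => bridge μ q.1 q.2) (volume.prod volume) := by
  simpa using (integral_sq_integral_dev_mul hX (k := fun _ => 1) (c := 1) measurable_const
    (by simp)).1

omit hk hkc in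
-- For the weight `k = 1` the linear functional of the empirical process is `E X - x`, so the kernel
-- has total mass `Var X`.
lemma integral_bridge_le :
    ∫ q : ℝ × ℝ, bridge μ q.1 q.2 ∂(volume.prod volume) ≤ ∫ x, x ^ 2 ∂μ := by
  have h1 := (integral_sq_integral_dev_mul hX (k := fun _ => 1) (c := 1) measurable_const
    (by simp)).2
  simp only [mul_one, one_mul] at h1
  rw [← h1]
  have hd : ∀ x, ∫ s, dev μ x s = (∫ y, y ∂μ) - x := fun x => by
    simp_rw [dev_eq_integral hX]
    rw [integral_integral_swap (f := fun s y => step x s - step y s)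
      (integrable_step_sub_prod hX x)]
    simp_rw [integral_step_sub]
    rw [integral_sub (hX.integrable (by norm_num)) (integrable_const _)]
    simp
  simp_rw [hd]
  set m := ∫ y, y ∂μ with hm
  have e : ∀ x, (m - x) ^ 2 = x ^ 2 - 2 * m * x + m ^ 2 := fun x => by ring
  simp_rw [e]
  have i2 := (hX.integrable (by norm_num)).const_mul (2 * m)
  have i12 : Integrable (fun x => x ^ 2 - 2 * m * x) μ := hX.integrable_sq.sub i2
  rw [integral_add i12 (integrable_const _), integral_sub hX.integrable_sq i2,
    integral_const_mul, ← hm]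
  simp only [integral_const, probReal_univ, smul_eq_mul, one_mul]
  nlinarith [sq_nonneg m]

end

/-! ### The probability integral transform -/

section

variable {μ : Measure ℝ} [IsProbabilityMeasure μ] (hc : Continuous (cdf μ))
include hc

lemma measure_singleton_eq_zero (x : ℝ) : μ {x} = 0 := by
  have h := (cdf μ).measure_singleton x
  rw [measure_cdf, (hc.continuousAt.continuousWithinAt).leftLim_eq] at h
  simpa using h

lemma exists_cdf_eq {t : ℝ} (h0 : 0 < t) (h1 : t < 1) : ∃ x, cdf μ x = t := by
  have ha := (tendsto_cdf_atBot μ).eventually (gt_mem_nhds h0)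
  have hb := (tendsto_cdf_atTop μ).eventually (lt_mem_nhds h1)
  obtain ⟨a, ha⟩ := ha.exists
  obtain ⟨b, hb⟩ := hb.exists
  exact mem_range_of_exists_le_of_exists_ge hc ⟨a, ha.le⟩ ⟨b, hb.le⟩

lemma real_cdf_le {t : ℝ} (h0 : 0 ≤ t) (h1 : t ≤ 1) : μ.real {x | cdf μ x ≤ t} = t := by
  refine le_antisymm ?_ ?_
  · refine le_of_forall_gt_imp_ge_of_dense fun r hr => ?_
    rcases lt_or_ge r 1 with hr1 | hr1
    · obtain ⟨x, hx⟩ := exists_cdf_eq hc (h0.trans_lt hr) hr1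
      rw [← hx, cdf_eq_real]
      refine measureReal_mono fun y (hy : cdf μ y ≤ t) => ?_
      by_contra hyx
      have := monotone_cdf μ (not_le.1 hyx).le
      linarith
    · exact measureReal_le_one.trans hr1
  · refine le_of_forall_lt_imp_le_of_dense fun r hr => ?_
    rcases lt_or_ge 0 r with hr0 | hr0
    · obtain ⟨x, hx⟩ := exists_cdf_eq hc hr0 (hr.trans_le h1)
      rw [← hx, cdf_eq_real]
      refine measureReal_mono fun y (hy : y ≤ x) => ?_
      show cdf μ y ≤ t
      have := monotone_cdf μ hy
      linarith
    · exact hr0.trans measureReal_nonneg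

/-- The probability integral transform. -/
lemma map_cdf : μ.map (cdf μ) = volume.restrict (Icc 0 1) := by
  have hm := measurable_cdf (μ := μ)
  have : IsProbabilityMeasure (μ.map (cdf μ)) := Measure.isProbabilityMeasure_map hm.aemeasurable
  have : IsFiniteMeasure ((volume : Measure ℝ).restrict (Icc 0 1)) := ⟨by simp⟩
  refine Measure.ext_of_Iic _ _ fun t => ?_
  rw [Measure.map_apply hm measurableSet_Iic, Measure.restrict_apply measurableSet_Iic]
  rcases lt_or_ge t 0 with h0 | h0
  · have e1 : (cdf μ) ⁻¹' Iic t = ∅ := by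
      ext x; simp only [mem_preimage, mem_Iic, mem_empty_iff_false, iff_false, not_le]
      exact h0.trans_le (cdf_nonneg μ x)
    have e2 : Iic t ∩ Icc (0 : ℝ) 1 = ∅ := by
      ext x; simp only [mem_inter_iff, mem_Iic, mem_Icc, mem_empty_iff_false, iff_false]
      intro h; linarith [h.1, h.2.1]
    rw [e1, e2]; simp
  rcases le_or_gt t 1 with h1 | h1
  · have e2 : Iic t ∩ Icc (0 : ℝ) 1 = Icc 0 t := by
      ext x; simp only [mem_inter_iff, mem_Iic, mem_Icc]
      constructor
      · rintro ⟨h, h', _⟩; exact ⟨h', h⟩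
      · rintro ⟨h, h'⟩; exact ⟨h', h, h'.trans h1⟩
    rw [e2, Real.volume_Icc, sub_zero]
    have := real_cdf_le hc h0 h1
    have h2 : μ {x | cdf μ x ≤ t} = ENNReal.ofReal t := by rw [← this, ofReal_measureReal, this]
    exact h2
  · have e1 : (cdf μ) ⁻¹' Iic t = univ := by
      ext x; simp only [mem_preimage, mem_Iic, mem_univ, iff_true]
      exact (cdf_le_one μ x).trans h1.le
    have e2 : Iic t ∩ Icc (0 : ℝ) 1 = Icc 0 1 := by
      refine inter_eq_right.2 fun x hx => hx.2.trans h1.le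
    rw [e1, e2]; simp

lemma integral_comp_cdf_mul_step {k : ℝ → ℝ} (hk : Measurable k) (s : ℝ) :
    ∫ x, k (cdf μ x) * step x s ∂μ = ∫ t in (0 : ℝ)..cdf μ s, k t := by
  have hm := measurable_cdf (μ := μ)
  have h0 := cdf_nonneg μ s
  have h1 := cdf_le_one μ s
  have e1 : ∀ x, k (cdf μ x) * step x s = (Iic s).indicator (fun x => k (cdf μ x)) x := fun x => by
    simp [step_eq, indicator]
  have hsub : Iic s ⊆ (cdf μ) ⁻¹' Iic (cdf μ s) := fun x hx => monotone_cdf μ hx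
  -- The two events may differ where `F` is flat to the right of `s`, but both have probability
  -- `F(s)`.
  have hae : (Iic s : Set ℝ) =ᵐ[μ] (cdf μ) ⁻¹' Iic (cdf μ s) := by
    refine ae_eq_of_subset_of_measure_ge hsub ?_ measurableSet_Iic.nullMeasurableSet
      (measure_ne_top _ _)
    have h2 : μ.real {x | cdf μ x ≤ cdf μ s} ≤ μ.real (Iic s) := by
      rw [real_cdf_le hc h0 h1, cdf_eq_real]
    rw [measureReal_def, measureReal_def,
      ENNReal.toReal_le_toReal (measure_ne_top _ _) (measure_ne_top _ _)] at h2
    exact h2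
  simp only [e1]
  rw [integral_indicator measurableSet_Iic, setIntegral_congr_set hae,
    ← setIntegral_map (f := k) measurableSet_Iic hk.aestronglyMeasurable hm.aemeasurable,
    map_cdf hc, Measure.restrict_restrict measurableSet_Iic, intervalIntegral.integral_of_le h0]
  have e2 : Iic (cdf μ s) ∩ Icc (0 : ℝ) 1 = Icc 0 (cdf μ s) := by
    ext x; simp only [mem_inter_iff, mem_Iic, mem_Icc]
    constructor
    · rintro ⟨h, h', _⟩; exact ⟨h', h⟩
    · rintro ⟨h, h'⟩; exact ⟨h', h, h'.trans h1⟩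
  rw [e2, integral_Icc_eq_integral_Ioc]

lemma integral_comp_cdf {k : ℝ → ℝ} (hk : Measurable k) :
    ∫ x, k (cdf μ x) ∂μ = ∫ t in (0 : ℝ)..1, k t := by
  have hm := measurable_cdf (μ := μ)
  rw [← integral_map (f := k) hm.aemeasurable hk.aestronglyMeasurable, map_cdf hc,
    integral_Icc_eq_integral_Ioc, intervalIntegral.integral_of_le zero_le_one]

end

/-! ### The functional `T` as an integral over the line -/

section

variable {μ : Measure ℝ} [IsProbabilityMeasure μ] {J : ℝ → ℝ} {c : ℝ}

/-- The functional `T` at a continuous distribution function, as an integral over the line. -/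
lemma T_cdf_eq (hc : Continuous (cdf μ)) (hX : Integrable (fun x : ℝ => x) μ) (hJ : Measurable J)
    (hJc : ∀ t, |J t| ≤ c) :
    Integrable (fun s => (∫ t in (0 : ℝ)..1, J t) * step 0 s - ∫ t in (0 : ℝ)..cdf μ s, J t) ∧
    T J (cdf μ) = ∫ s, ((∫ t in (0 : ℝ)..1, J t) * step 0 s - ∫ t in (0 : ℝ)..cdf μ s, J t) := by
  have hm := measurable_cdf (μ := μ)
  have hM : Measurable (Function.uncurry fun x s => J (cdf μ x) * (step 0 s - step x s)) :=
    (hJ.comp (hm.comp measurable_fst)).mul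
      ((measurable_step_comp measurable_const measurable_snd).sub
        (measurable_step_comp measurable_fst measurable_snd))
  -- The factor `x` is replaced by `∫ (step 0 s - step x s) ds`. Fubini then puts `s` outside, where
  -- the probability integral transform evaluates the inner expectation.
  have hi : Integrable (Function.uncurry fun x s => J (cdf μ x) * (step 0 s - step x s))
      (μ.prod volume) := by
    rw [integrable_prod_iff hM.aestronglyMeasurable]
    refine ⟨ae_of_all _ fun x => (integrable_step_sub 0 x).const_mul (J (cdf μ x)), ?_⟩
    refine (hX.abs.const_mul c).mono'
      (hM.norm.stronglyMeasurable.integral_prod_right').aestronglyMeasurable (ae_of_all _ fun x => ?_)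
    rw [Real.norm_eq_abs, abs_of_nonneg (integral_nonneg fun _ => norm_nonneg _)]
    simp only [Function.uncurry_apply_pair, norm_mul, Real.norm_eq_abs]
    rw [integral_const_mul, integral_abs_step_sub, zero_sub, abs_neg]
    exact mul_le_mul_of_nonneg_right (hJc _) (abs_nonneg _)
  have hin : ∀ s, ∫ x, J (cdf μ x) * (step 0 s - step x s) ∂μ
      = (∫ t in (0 : ℝ)..1, J t) * step 0 s - ∫ t in (0 : ℝ)..cdf μ s, J t := fun s => by
    have i1 : Integrable (fun x => J (cdf μ x)) μ :=
      (integrable_const c).mono' (hJ.comp hm).aestronglyMeasurable (ae_of_all _ fun x => hJc _)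
    have i2 : Integrable (fun x => J (cdf μ x) * step x s) μ :=
      i1.mul_bdd (c := 1) (integrable_step s).aestronglyMeasurable (ae_of_all _ fun x => by
        rw [Real.norm_eq_abs, abs_of_nonneg (step_nonneg _ _)]; exact step_le_one _ _)
    simp_rw [mul_sub]
    rw [integral_sub (i1.mul_const _) i2, integral_mul_const, integral_comp_cdf hc hJ,
      integral_comp_cdf_mul_step hc hJ]
  refine ⟨by simpa only [Function.uncurry_apply_pair, hin] using hi.integral_prod_right, ?_⟩
  rw [T, measure_cdf, ← integral_congr_ae (ae_of_all _ hin), ← integral_integral_swap hi]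
  refine integral_congr_ae (ae_of_all _ fun x => ?_)
  simp only
  rw [integral_const_mul, integral_step_sub, sub_zero, mul_comm]

variable {n : ℕ}

lemma empiricalCDF_apply (x : Fin n → ℝ) (s : ℝ) :
    empiricalCDF x s = (n : ℝ)⁻¹ * ∑ i, step (x i) s := rfl

lemma empiricalCDF_nonneg (x : Fin n → ℝ) (s : ℝ) : 0 ≤ empiricalCDF x s := by
  rw [empiricalCDF_apply]
  have := Finset.sum_nonneg fun (i : Fin n) (_ : i ∈ Finset.univ) => step_nonneg (x i) s
  positivity

lemma empiricalCDF_le_one (x : Fin n → ℝ) (s : ℝ) : empiricalCDF x s ≤ 1 := by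
  rw [empiricalCDF_apply]
  have h1 : ∑ i, step (x i) s ≤ ∑ _i : Fin n, (1 : ℝ) := Finset.sum_le_sum fun i _ => step_le_one _ _
  simp only [Finset.sum_const, Finset.card_univ, Fintype.card_fin, nsmul_eq_mul, mul_one] at h1
  rcases (Nat.cast_nonneg (α := ℝ) n).eq_or_lt with h0 | h0
  · rw [← h0]; simp
  · rw [inv_mul_le_iff₀ h0]; linarith

lemma measure_empiricalCDF (x : Fin n → ℝ) :
    (empiricalCDF x).measure = ∑ i, ENNReal.ofReal ((n : ℝ)⁻¹) • Measure.dirac (x i) := by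
  rcases Nat.eq_zero_or_pos n with rfl | hn
  · have h0 : ⇑(empiricalCDF x) = fun _ => 0 := funext fun s => by rw [empiricalCDF_apply]; simp
    simp only [Finset.univ_eq_empty, Finset.sum_empty]
    rw [← Measure.measure_univ_eq_zero]
    rw [StieltjesFunction.measure_univ (l := 0) (u := 0) _ (by rw [h0]; exact tendsto_const_nhds)
      (by rw [h0]; exact tendsto_const_nhds)]
    simp
  have hn0 : (0 : ℝ) < n := by exact_mod_cast hn
  have hbot : Tendsto (empiricalCDF x) atBot (𝓝 0) := by
    have : ∀ i : Fin n, Tendsto (fun s => step (x i) s) atBot (𝓝 0) := fun i => by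
      refine tendsto_const_nhds.congr' ?_
      filter_upwards [eventually_lt_atBot (x i)] with s hs
      rw [step_eq, if_neg (not_le.2 hs)]
    have h := (tendsto_finsetSum Finset.univ fun i _ => this i).const_mul ((n : ℝ)⁻¹)
    simp only [Finset.sum_const_zero, mul_zero] at h
    exact h
  have : IsFiniteMeasure (∑ i, ENNReal.ofReal ((n : ℝ)⁻¹) • Measure.dirac (x i)) := by
    refine ⟨?_⟩
    simp [ENNReal.mul_lt_top]
  have hfin : IsFiniteMeasure (empiricalCDF x).measure := by
    have htop : Tendsto (empiricalCDF x) atTop (𝓝 1) := by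
      have : ∀ i : Fin n, Tendsto (fun s => step (x i) s) atTop (𝓝 1) := fun i => by
        refine tendsto_const_nhds.congr' ?_
        filter_upwards [eventually_ge_atTop (x i)] with s hs
        rw [step_eq, if_pos hs]
      have h := (tendsto_finsetSum Finset.univ fun i _ => this i).const_mul ((n : ℝ)⁻¹)
      simp only [Finset.sum_const, Finset.card_univ, Fintype.card_fin, nsmul_eq_mul, mul_one] at h
      rwa [inv_mul_cancel₀ hn0.ne'] at h
    exact ⟨by rw [StieltjesFunction.measure_univ _ hbot htop]; simp⟩
  refine Measure.ext_of_Iic _ _ fun s => ?_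
  rw [StieltjesFunction.measure_Iic _ hbot, sub_zero, empiricalCDF_apply, Finset.mul_sum,
    ENNReal.ofReal_sum_of_nonneg fun i _ => by have := step_nonneg (x i) s; positivity]
  simp only [Measure.coe_finsetSum, Finset.sum_apply, Measure.smul_apply, smul_eq_mul,
    Measure.dirac_apply' _ measurableSet_Iic]
  refine Finset.sum_congr rfl fun i _ => ?_
  rw [ENNReal.ofReal_mul (by positivity), step_eq]
  by_cases h : x i ≤ s <;> simp [indicator, h]

lemma T_empiricalCDF (J : ℝ → ℝ) (x : Fin n → ℝ) :
    T J (empiricalCDF x) = (n : ℝ)⁻¹ * ∑ i, x i * J (empiricalCDF x (x i)) := by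
  rw [T, measure_empiricalCDF, integral_finsetSum_measure, Finset.mul_sum]
  · refine Finset.sum_congr rfl fun i _ => ?_
    rw [integral_smul_measure, integral_dirac, ENNReal.toReal_ofReal (by positivity), smul_eq_mul]
  · intro i _
    exact Integrable.smul_measure (integrable_dirac enorm_lt_top) (by simp)

end

/-! ### Taylor and Riemann-sum errors of a Lipschitz function -/

lemma abs_integral_le_of_affine {f : ℝ → ℝ} {A B : ℝ} (hf : ∀ t, |f t| ≤ A + B * |t|) (x : ℝ) :
    |∫ t in (0 : ℝ)..x, f t| ≤ A * |x| + B * x ^ 2 / 2 := by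
  have key : ∀ {f : ℝ → ℝ}, (∀ t, |f t| ≤ A + B * |t|) → ∀ {x : ℝ}, 0 ≤ x →
      |∫ t in (0 : ℝ)..x, f t| ≤ A * |x| + B * x ^ 2 / 2 := by
    intro f hf x hx
    have h1 := intervalIntegral.norm_integral_le_of_norm_le (μ := volume) (f := f)
      (g := fun t => A + B * t) hx (ae_of_all _ fun t ht => by
        have h2 := hf t
        rwa [abs_of_pos ht.1] at h2) (Continuous.intervalIntegrable (by fun_prop) _ _)
    refine h1.trans (le_of_eq ?_)
    rw [intervalIntegral.integral_add intervalIntegrable_const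
      (Continuous.intervalIntegrable (by fun_prop) _ _), intervalIntegral.integral_const_mul,
      integral_id, intervalIntegral.integral_const, abs_of_nonneg hx]
    simp only [sub_zero, smul_eq_mul]; ring
  rcases le_total 0 x with hx | hx
  · exact key hf hx
  · have h1 := key (f := fun t => f (-t)) (fun t => by simpa using hf (-t)) (x := -x) (by linarith)
    rw [intervalIntegral.integral_comp_neg, neg_neg, neg_zero, intervalIntegral.integral_symm,
      abs_neg, abs_neg] at h1
    simpa using h1

/-- The primitive of `J` vanishing at zero. -/
noncomputable def prim (J : ℝ → ℝ) (t : ℝ) : ℝ := ∫ u in (0 : ℝ)..t, J u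

section

variable {J : ℝ → ℝ} {c₀ : ℝ} (hJ : ∀ s t, |J t - J s| ≤ c₀ * |t - s|)
include hJ

lemma lipschitz_const_nonneg : 0 ≤ c₀ := by
  have := hJ 0 1
  simp only [sub_zero, abs_one, mul_one] at this
  exact (abs_nonneg _).trans this

lemma continuous_of_lipschitz : Continuous J :=
  (LipschitzWith.of_dist_le' (K := c₀) fun x y => by
    rw [Real.dist_eq, Real.dist_eq]; exact hJ y x).continuous

/-- The left side is the integral of `J(y' + w) - J(u)` for `w` from `0` to `y - y'`. Three free
points let one estimate serve for the Taylor error (`u = y' = F(s)`), for one Riemann cell (`u = y'`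
its right endpoint), and for the difference of two Taylor errors about the same `u`. -/
lemma abs_prim_sub_le (u y y' : ℝ) :
    |prim J y - prim J y' - J u * (y - y')| ≤ c₀ * |y - y'| * (|y' - u| + |y - y'| / 2) := by
  have hcont := continuous_of_lipschitz hJ
  have h0 := lipschitz_const_nonneg hJ
  have e : prim J y - prim J y' - J u * (y - y') = ∫ w in (0 : ℝ)..(y - y'), (J (y' + w) - J u) := by
    have hi : ∀ a b, IntervalIntegrable J volume a b := fun a b => hcont.intervalIntegrable a b
    rw [intervalIntegral.integral_sub (Continuous.intervalIntegrable (by fun_prop) _ _)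
      intervalIntegrable_const, intervalIntegral.integral_comp_add_left (fun w => J w), prim, prim,
      intervalIntegral.integral_interval_sub_left (hi _ _) (hi _ _),
      intervalIntegral.integral_const]
    simp only [add_zero, add_sub_cancel, sub_zero, smul_eq_mul]
    ring
  rw [e]
  have h1 := abs_integral_le_of_affine (f := fun w => J (y' + w) - J u) (A := c₀ * |y' - u|) (B := c₀)
    (fun w => by
      refine (hJ _ _).trans ?_
      rw [← mul_add]
      refine mul_le_mul_of_nonneg_left ?_ h0
      rw [show y' + w - u = (y' - u) + w by ring]
      exact abs_add_le _ _) (y - y')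
  refine h1.trans (le_of_eq ?_)
  rw [← sq_abs]; ring

/-- The error of a Riemann sum for the primitive of a Lipschitz function extends to a function
with a small Lipschitz constant. -/
lemma exists_gridError {n : ℕ} (hn : 0 < n) :
    ∃ e : ℝ → ℝ, (∀ s t, |e t - e s| ≤ c₀ / (2 * n) * |t - s|) ∧
      ∀ k : ℕ, e (k / n) = (n : ℝ)⁻¹ * ∑ m ∈ Finset.Icc 1 k, J (m / n) - prim J (k / n) := by
  have h0 := lipschitz_const_nonneg hJ
  have hn0 : (0 : ℝ) < n := by exact_mod_cast hn
  set d : ℕ → ℝ := fun k => (n : ℝ)⁻¹ * ∑ m ∈ Finset.Icc 1 k, J (m / n) - prim J (k / n) with hd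
  have hstep : ∀ k, |d (k + 1) - d k| ≤ c₀ / (2 * n) * (1 / n) := by
    intro k
    have h1 := abs_prim_sub_le hJ (((k + 1 : ℕ) : ℝ) / n) ((k : ℝ) / n) (((k + 1 : ℕ) : ℝ) / n)
    have h2 : (k : ℝ) / n - ((k + 1 : ℕ) : ℝ) / n = -(1 / n) := by push_cast; ring
    rw [h2, sub_self, abs_zero, abs_neg,
      abs_of_pos (show (0 : ℝ) < 1 / n by positivity)] at h1
    have e : d (k + 1) - d k = prim J ((k : ℝ) / n) - prim J (((k + 1 : ℕ) : ℝ) / n)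
        - J (((k + 1 : ℕ) : ℝ) / n) * -(1 / n) := by
      simp only [hd]
      rw [Finset.sum_Icc_succ_top (by omega)]
      ring
    rw [e]
    refine h1.trans (le_of_eq ?_)
    field_simp; ring
  have hmono : ∀ k j, |d (k + j) - d k| ≤ c₀ / (2 * n) * (j / n) := by
    intro k j
    induction j with
    | zero => simp
    | succ j ih =>
      have h1 := hstep (k + j)
      have e : d (k + (j + 1)) - d k = (d (k + j + 1) - d (k + j)) + (d (k + j) - d k) := by
        rw [← add_assoc]; ring
      rw [e]
      refine (abs_add_le _ _).trans ?_
      have : c₀ / (2 * n) * (((j + 1 : ℕ) : ℝ) / n)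
          = c₀ / (2 * n) * (1 / n) + c₀ / (2 * n) * (j / n) := by push_cast; ring
      linarith
  have hall : ∀ k l : ℕ, |d k - d l| ≤ c₀ / (2 * n) * |(k : ℝ) / n - l / n| := by
    intro k l
    have key : ∀ k l : ℕ, l ≤ k → |d k - d l| ≤ c₀ / (2 * n) * |(k : ℝ) / n - l / n| := by
      intro k l hkl
      obtain ⟨j, rfl⟩ := Nat.exists_eq_add_of_le hkl
      have e : ((l + j : ℕ) : ℝ) / n - l / n = j / n := by push_cast; ring
      rw [e, abs_of_nonneg (show (0 : ℝ) ≤ j / n by positivity)]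
      exact hmono l j
    rcases le_total l k with h | h
    · exact key k l h
    · rw [abs_sub_comm, abs_sub_comm ((k : ℝ) / n)]
      exact key l k h
  set K : NNReal := ⟨c₀ / (2 * n), by positivity⟩ with hK
  have hfloor : ∀ k : ℕ, ⌊(k : ℝ) / n * n⌋₊ = k := fun k => by
    rw [div_mul_cancel₀ _ hn0.ne', Nat.floor_natCast]
  -- One right-endpoint cell has error at most `c₀/(2n²)`, so the accumulated error is Lipschitz on
  -- the grid with constant `c₀/(2n)`. A Lipschitz extension to the line is needed because the mixed
  -- distribution functions take values off the grid.
  have hlip : LipschitzOnWith K (fun t : ℝ => d ⌊t * n⌋₊) (range fun k : ℕ => (k : ℝ) / n) := by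
    refine LipschitzOnWith.of_dist_le_mul ?_
    rintro _ ⟨k, rfl⟩ _ ⟨l, rfl⟩
    simp only [hfloor, Real.dist_eq]
    exact hall k l
  obtain ⟨e, he, heq⟩ := hlip.extend_real
  refine ⟨e, fun s t => ?_, fun k => ?_⟩
  · have := he.dist_le_mul t s
    rwa [Real.dist_eq, Real.dist_eq] at this
  · have := heq ⟨k, rfl⟩
    simp only [hfloor] at this
    rw [← this]

end

/-! ### Linearization of `T` -/

section

variable {n : ℕ}

/-- The number of observations up to `s`. -/
noncomputable def countLE (x : Fin n → ℝ) (s : ℝ) : ℕ := (Finset.univ.filter fun i => x i ≤ s).card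

lemma empiricalCDF_eq_countLE (x : Fin n → ℝ) (s : ℝ) :
    empiricalCDF x s = (countLE x s : ℝ) / n := by
  rw [empiricalCDF_apply, countLE, div_eq_inv_mul]
  simp [step_eq]

/-- A rank sum over the observations up to `s`, in the absence of ties. -/
lemma sum_rank_eq {x : Fin n → ℝ} (hx : Function.Injective x) (k : ℕ → ℝ) (s : ℝ) :
    ∑ i, k (countLE x (x i)) * step (x i) s = ∑ m ∈ Finset.Icc 1 (countLE x s), k m := by
  have h1 : ∑ i, k (countLE x (x i)) * step (x i) s
      = ∑ i ∈ Finset.univ.filter fun i => x i ≤ s, k (countLE x (x i)) := by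
    rw [Finset.sum_filter]
    exact Finset.sum_congr rfl fun i _ => by rw [step_eq]; split_ifs <;> simp
  have hlt : ∀ {a b : ℝ} {i : Fin n}, a < b → x i = b → countLE x a < countLE x b := by
    intro a b i hab hi
    refine Finset.card_lt_card ?_
    rw [Finset.ssubset_iff_of_subset]
    · exact ⟨i, by simp [hi], by simp [hi, hab]⟩
    · intro j hj
      simp only [Finset.mem_filter, Finset.mem_univ, true_and] at hj ⊢
      linarith
  have hinj : Function.Injective fun i => countLE x (x i) := by
    intro i j hij
    by_contra hne
    rcases lt_or_gt_of_ne (fun h => hne (hx h) : x i ≠ x j) with h | h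
    · exact absurd hij (hlt h rfl).ne
    · exact absurd hij.symm (hlt h rfl).ne
  -- Without ties the ranks are distinct; they lie in `1, …, countLE x s` and are as many, hence
  -- exhaust this range.
  have himg : (Finset.univ.filter fun i => x i ≤ s).image (fun i => countLE x (x i))
      = Finset.Icc 1 (countLE x s) := by
    refine Finset.eq_of_subset_of_card_le ?_ ?_
    · intro m hm
      obtain ⟨i, hi, rfl⟩ := Finset.mem_image.1 hm
      simp only [Finset.mem_filter, Finset.mem_univ, true_and] at hi
      rw [Finset.mem_Icc]
      constructor
      · exact Finset.card_pos.2 ⟨i, by simp⟩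
      · refine Finset.card_le_card fun j hj => ?_
        simp only [Finset.mem_filter, Finset.mem_univ, true_and] at hj ⊢
        exact hj.trans hi
    · rw [Finset.card_image_of_injective _ hinj, Nat.card_Icc]
      exact le_of_eq (by simp [countLE])
  rw [h1, ← himg, Finset.sum_image fun i _ j _ hij => hinj hij]

variable {μ : Measure ℝ} [IsProbabilityMeasure μ]

/-- The empirical distribution function based on the observations in `I`, completed by the true
distribution function. -/
noncomputable def mixedCDF (μ : Measure ℝ) (I : Finset (Fin n)) (x : Fin n → ℝ) (s : ℝ) : ℝ :=
  cdf μ s + (n : ℝ)⁻¹ * ∑ j ∈ I, dev μ (x j) s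

lemma mixedCDF_univ (hn : 0 < n) (x : Fin n → ℝ) (s : ℝ) :
    mixedCDF μ Finset.univ x s = empiricalCDF x s := by
  have hn0 : (0 : ℝ) < n := by exact_mod_cast hn
  simp only [mixedCDF, dev, Finset.sum_sub_distrib, Finset.sum_const, Finset.card_univ,
    Fintype.card_fin, nsmul_eq_mul, empiricalCDF_apply]
  field_simp; ring

/-- The integrand of the remainder in the linearization of `T`. -/
noncomputable def remIntegrand (μ : Measure ℝ) (J e : ℝ → ℝ) (s y : ℝ) : ℝ :=
  e 1 * step 0 s - e y - (prim J y - prim J (cdf μ s) - J (cdf μ s) * (y - cdf μ s))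

/-- The remainder in the linearization of `T`. -/
noncomputable def remainder (μ : Measure ℝ) (J e : ℝ → ℝ) (I : Finset (Fin n)) (x : Fin n → ℝ) : ℝ :=
  ∫ s, remIntegrand μ J e s (mixedCDF μ I x s)

lemma abs_mixedCDF_sub_le (I : Finset (Fin n)) (x : Fin n → ℝ) (s : ℝ) :
    |mixedCDF μ I x s - cdf μ s| ≤ (n : ℝ)⁻¹ * ∑ j ∈ I, |dev μ (x j) s| := by
  rw [mixedCDF, add_sub_cancel_left, abs_mul, abs_of_nonneg (by positivity)]
  exact mul_le_mul_of_nonneg_left (Finset.abs_sum_le_sum_abs _ _) (by positivity)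

lemma abs_mixedCDF_sub_le_one (I : Finset (Fin n)) (x : Fin n → ℝ) (s : ℝ) :
    |mixedCDF μ I x s - cdf μ s| ≤ 1 := by
  refine (abs_mixedCDF_sub_le I x s).trans ?_
  have h1 : ∑ j ∈ I, |dev μ (x j) s| ≤ ∑ _j ∈ I, (1 : ℝ) := Finset.sum_le_sum fun j _ => abs_dev_le _ _
  have h2 : (I.card : ℝ) ≤ n := by exact_mod_cast (I.card_le_univ).trans (by simp)
  simp only [Finset.sum_const, nsmul_eq_mul, mul_one] at h1
  rcases (Nat.cast_nonneg (α := ℝ) n).eq_or_lt with h0 | h0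
  · rw [← h0]; simp
  · rw [inv_mul_le_iff₀ h0]; linarith

lemma measurable_mixedCDF (I : Finset (Fin n)) :
    Measurable fun q : (Fin n → ℝ) × ℝ => mixedCDF μ I q.1 q.2 := by
  refine (measurable_cdf.comp measurable_snd).add (measurable_const.mul ?_)
  exact Finset.measurable_sum I fun j _ =>
    measurable_dev_comp ((measurable_pi_apply j).comp measurable_fst) measurable_snd

lemma integrable_mixedCDF_sub (hX : MemLp (fun x : ℝ => x) 2 μ) (I : Finset (Fin n))
    (x : Fin n → ℝ) : Integrable fun s => mixedCDF μ I x s - cdf μ s := by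
  simp only [mixedCDF, add_sub_cancel_left]
  exact (integrable_finsetSum I fun j _ => integrable_dev_volume hX (x j)).const_mul _

variable {J e : ℝ → ℝ} {c₀ K : ℝ} (hJ : ∀ s t, |J t - J s| ≤ c₀ * |t - s|)
  (he : ∀ s t, |e t - e s| ≤ K * |t - s|) (he0 : e 0 = 0)
include hJ he

lemma continuous_prim : Continuous (prim J) :=
  intervalIntegral.continuous_primitive
    (fun a b => (continuous_of_lipschitz hJ).intervalIntegrable a b) 0

lemma measurable_remIntegrand : Measurable fun q : ℝ × ℝ => remIntegrand μ J e q.1 q.2 := by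
  have h1 := (continuous_of_lipschitz hJ).measurable
  have h2 := (continuous_of_lipschitz he).measurable
  have h3 := (continuous_prim hJ he).measurable
  have h4 : Measurable fun q : ℝ × ℝ => cdf μ q.1 := measurable_cdf.comp measurable_fst
  exact (((measurable_step_comp measurable_const measurable_fst).const_mul _).sub
    (h2.comp measurable_snd)).sub (((h3.comp measurable_snd).sub (h3.comp h4)).sub
      ((h1.comp h4).mul (measurable_snd.sub h4)))

lemma measurable_remainder (I : Finset (Fin n)) : Measurable (remainder μ J e I) := by
  have : Measurable fun q : (Fin n → ℝ) × ℝ => remIntegrand μ J e q.2 (mixedCDF μ I q.1 q.2) :=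
    (measurable_remIntegrand hJ he).comp (measurable_snd.prodMk (measurable_mixedCDF I))
  exact this.stronglyMeasurable.integral_prod_right'.measurable

lemma dependsOn_remainder (I : Finset (Fin n)) :
    DependsOn (remainder μ J e I) (I : Set (Fin n)) := fun x y hxy => by
  have : ∀ s, mixedCDF μ I x s = mixedCDF μ I y s := fun s => by
    rw [mixedCDF, mixedCDF]
    congr 2
    exact Finset.sum_congr rfl fun j hj => by rw [hxy j hj]
  simp only [remainder, this]

include he0

/-- As `step 0 s` is `0` or `1` and `e 0 = 0`, the first part is the increment of `e` from `y` to
`step 0 s`. This keeps the remainder integrable over the line. -/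
lemma abs_remIntegrand_le (s y : ℝ) :
    |remIntegrand μ J e s y| ≤ K * |step 0 s - y| + c₀ / 2 * (y - cdf μ s) ^ 2 := by
  rw [remIntegrand]
  have h1 : |e 1 * step 0 s - e y| ≤ K * |step 0 s - y| := by
    rw [step_eq]
    split_ifs
    · rw [mul_one]; exact he y 1
    · rw [mul_zero]
      have := he y 0
      rwa [he0] at this
  have h2 := abs_prim_sub_le hJ (cdf μ s) y (cdf μ s)
  rw [sub_self, abs_zero] at h2
  refine (abs_sub _ _).trans (add_le_add h1 (h2.trans (le_of_eq ?_)))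
  rw [← sq_abs]; ring

omit he0 in
lemma abs_remIntegrand_sub_le (s y y' : ℝ) :
    |remIntegrand μ J e s y - remIntegrand μ J e s y'|
      ≤ K * |y - y'| + c₀ * |y - y'| * (|y' - cdf μ s| + |y - y'| / 2) := by
  have h1 := he y' y
  have h2 := abs_prim_sub_le hJ (cdf μ s) y y'
  have e1 : remIntegrand μ J e s y - remIntegrand μ J e s y'
      = -((e y - e y') + (prim J y - prim J y' - J (cdf μ s) * (y - y'))) := by
    rw [remIntegrand, remIntegrand]; ring
  rw [e1, abs_neg]
  exact (abs_add_le _ _).trans (add_le_add h1 h2)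

lemma integrable_remIntegrand (hX : MemLp (fun x : ℝ => x) 2 μ) (I : Finset (Fin n))
    (x : Fin n → ℝ) : Integrable fun s => remIntegrand μ J e s (mixedCDF μ I x s) := by
  have h0 := lipschitz_const_nonneg hJ
  have hK := lipschitz_const_nonneg he
  have i1 := integrable_mixedCDF_sub hX I x
  have i2 := (integrable_dev_volume hX 0).sub i1
  refine Integrable.mono' ((i2.abs.const_mul K).add (i1.abs.const_mul (c₀ / 2)))
    ((measurable_remIntegrand hJ he).comp (measurable_id.prodMk
      ((measurable_mixedCDF I).comp (measurable_const.prodMk measurable_id)))).aestronglyMeasurable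
    (ae_of_all _ fun s => ?_)
  refine (abs_remIntegrand_le hJ he he0 s _).trans ?_
  simp only [Pi.add_apply, Pi.sub_apply]
  have e1 : step 0 s - mixedCDF μ I x s = dev μ 0 s - (mixedCDF μ I x s - cdf μ s) := by
    rw [dev]; ring
  have h1 := abs_mixedCDF_sub_le_one (μ := μ) I x s
  rw [e1, ← sq_abs (mixedCDF μ I x s - cdf μ s)]
  have h2 : |mixedCDF μ I x s - cdf μ s| ^ 2 ≤ |mixedCDF μ I x s - cdf μ s| := by
    nlinarith [abs_nonneg (mixedCDF μ I x s - cdf μ s)]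
  gcongr

/-- The linearization of `T` at a continuous distribution function. -/
theorem T_sub_eq (hn : 0 < n) (hc : Continuous (cdf μ)) (hX : MemLp (fun x : ℝ => x) 2 μ) {c : ℝ}
    (hJc : ∀ t, |J t| ≤ c)
    (hgrid : ∀ k : ℕ, e (k / n) = (n : ℝ)⁻¹ * ∑ m ∈ Finset.Icc 1 k, J (m / n) - prim J (k / n))
    {x : Fin n → ℝ} (hx : Function.Injective x) :
    T J (empiricalCDF x) - T J (cdf μ)
      = -((n : ℝ)⁻¹ * ∑ i, g J (cdf μ) (x i)) + remainder μ J e Finset.univ x := by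
  have hJm := (continuous_of_lipschitz hJ).measurable
  have hkm : Measurable fun s => J (cdf μ s) := hJm.comp measurable_cdf
  have hn0 : (0 : ℝ) < n := by exact_mod_cast hn
  obtain ⟨iT, eT⟩ := T_cdf_eq hc (hX.integrable (by norm_num)) hJm hJc
  -- The rank sum is the Riemann sum of `J` up to `F_n(s)`, which is a grid point, so `e` is exactly
  -- its error there.
  have hΨ : ∀ s, (n : ℝ)⁻¹ * ∑ i, J (empiricalCDF x (x i)) * step (x i) s
      = prim J (empiricalCDF x s) + e (empiricalCDF x s) := fun s => by
    simp only [empiricalCDF_eq_countLE]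
    rw [sum_rank_eq hx (fun m => J ((m : ℝ) / n)) s, hgrid]
    ring
  have hΨ1 : (n : ℝ)⁻¹ * ∑ i, J (empiricalCDF x (x i)) = prim J 1 + e 1 := by
    obtain ⟨s, hs⟩ : ∃ s, ∀ i, x i ≤ s := by
      obtain ⟨s, hs⟩ := (Set.finite_range x).bddAbove
      exact ⟨s, fun i => hs ⟨i, rfl⟩⟩
    have h1 : ∀ i, step (x i) s = 1 := fun i => by rw [step_eq, if_pos (hs i)]
    have h2 : empiricalCDF x s = 1 := by
      rw [empiricalCDF_apply]; simp [h1, hn0.ne']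
    have := hΨ s
    simpa only [h1, h2, mul_one] using this
  have iF : Integrable fun s => (n : ℝ)⁻¹ *
      ∑ i, J (empiricalCDF x (x i)) * (step 0 s - step (x i) s) :=
    (integrable_finsetSum _ fun i _ => (integrable_step_sub 0 (x i)).const_mul _).const_mul _
  have eF : T J (empiricalCDF x) = ∫ s, (n : ℝ)⁻¹ *
      ∑ i, J (empiricalCDF x (x i)) * (step 0 s - step (x i) s) := by
    rw [T_empiricalCDF, integral_const_mul, integral_finsetSum _ fun i _ =>
      (integrable_step_sub 0 (x i)).const_mul _]
    congr 1
    refine Finset.sum_congr rfl fun i _ => ?_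
    rw [integral_const_mul, integral_step_sub, sub_zero, mul_comm]
  have iD : Integrable fun s => (n : ℝ)⁻¹ * ∑ i, dev μ (x i) s * J (cdf μ s) :=
    (integrable_finsetSum _ fun i _ => integrable_dev_mul hX hkm (fun s => hJc _) (x i)).const_mul _
  have eD : (n : ℝ)⁻¹ * ∑ i, g J (cdf μ) (x i)
      = ∫ s, (n : ℝ)⁻¹ * ∑ i, dev μ (x i) s * J (cdf μ s) := by
    rw [integral_const_mul, integral_finsetSum _ fun i _ =>
      integrable_dev_mul hX hkm (fun s => hJc _) (x i)]
    rfl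
  have iR := integrable_remIntegrand (n := n) hJ he he0 hX Finset.univ x
  rw [eF, eT, ← integral_sub iF iT, eD, remainder, ← integral_neg]
  have iD' : Integrable fun s => -((n : ℝ)⁻¹ * ∑ i, dev μ (x i) s * J (cdf μ s)) := iD.neg
  rw [← integral_add iD' iR]
  refine integral_congr_ae (ae_of_all _ fun s => ?_)
  simp only [mul_sub, Finset.sum_sub_distrib, ← Finset.sum_mul]
  have h3 := hΨ s
  have h4 : (n : ℝ)⁻¹ * ((∑ i, J (empiricalCDF x (x i))) * step 0 s)
      = (prim J 1 + e 1) * step 0 s := by rw [← mul_assoc, hΨ1]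
  rw [h4, h3]
  have h5 : mixedCDF μ Finset.univ x s - cdf μ s = (n : ℝ)⁻¹ * ∑ i, dev μ (x i) s := by
    rw [mixedCDF, add_sub_cancel_left]
  rw [remIntegrand, h5, mixedCDF_univ hn]
  change (prim J 1 + e 1) * step 0 s - (prim J (empiricalCDF x s) + e (empiricalCDF x s))
    - (prim J 1 * step 0 s - prim J (cdf μ s)) = _
  ring

end

/-! ### Fourth moments of the empirical process -/

section

variable {ι : Type*} [Fintype ι] [DecidableEq ι] {μ : Measure ℝ} [IsProbabilityMeasure μ]

/-- Mixed second and fourth moments of two sums of bounded centred variables. -/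
lemma integral_sq_mul_sq_sum {f k : ℝ → ℝ} (hf : Measurable f) (hk : Measurable k)
    (hf1 : ∀ a, |f a| ≤ 1) (hk1 : ∀ a, |k a| ≤ 1) (hf0 : ∫ a, f a ∂μ = 0) (hk0 : ∫ a, k a ∂μ = 0)
    (I : Finset ι) :
    ∫ x, (∑ i ∈ I, f (x i)) * (∑ i ∈ I, k (x i)) ∂iid ι μ = I.card * ∫ a, f a * k a ∂μ ∧
    ∫ x, (∑ i ∈ I, f (x i)) ^ 2 * (∑ i ∈ I, k (x i)) ^ 2 ∂iid ι μ
      = I.card * ∫ a, f a ^ 2 * k a ^ 2 ∂μ + I.card * (I.card - 1) *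
        ((∫ a, f a ^ 2 ∂μ) * (∫ a, k a ^ 2 ∂μ) + 2 * (∫ a, f a * k a ∂μ) ^ 2) := by
  have bf : MemLp f 2 μ := MemLp.of_bound hf.aestronglyMeasurable 1 (ae_of_all _ hf1)
  have bk : MemLp k 2 μ := MemLp.of_bound hk.aestronglyMeasurable 1 (ae_of_all _ hk1)
  induction I using Finset.induction_on with
  | empty => simp
  | insert i I hi ih =>
    obtain ⟨ih1, ih2⟩ := ih
    set S : (ι → ℝ) → ℝ := fun x => ∑ j ∈ I, f (x j) with hS
    set R : (ι → ℝ) → ℝ := fun x => ∑ j ∈ I, k (x j) with hR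
    replace ih1 : ∫ x, S x * R x ∂iid ι μ = I.card * ∫ a, f a * k a ∂μ := ih1
    replace ih2 : ∫ x, S x ^ 2 * R x ^ 2 ∂iid ι μ
      = I.card * ∫ a, f a ^ 2 * k a ^ 2 ∂μ + I.card * (I.card - 1) *
        ((∫ a, f a ^ 2 ∂μ) * (∫ a, k a ^ 2 ∂μ) + 2 * (∫ a, f a * k a ∂μ) ^ 2) := ih2
    have mS : Measurable S := measurable_sum_eval hf I
    have mR : Measurable R := measurable_sum_eval hk I
    obtain ⟨t, ht⟩ : ∃ t : ℕ → ℕ → ℕ → ℕ → (ι → ℝ) → ℝ, ∀ a b c d x,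
        t a b c d x = (S x ^ a * R x ^ b) * (f (x i) ^ c * k (x i) ^ d) :=
      ⟨_, fun _ _ _ _ _ => rfl⟩
    have mfi : ∀ c d, Measurable fun a => f a ^ c * k a ^ d := fun c d =>
      (hf.pow_const c).mul (hk.pow_const d)
    have mSR : ∀ a b, Measurable fun x => S x ^ a * R x ^ b := fun a b =>
      (mS.pow_const a).mul (mR.pow_const b)
    have bS : ∀ x, |S x| ≤ I.card := fun x => by
      refine (Finset.abs_sum_le_sum_abs _ _).trans ?_
      simpa using Finset.sum_le_sum fun j (_ : j ∈ I) => hf1 (x j)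
    have bR : ∀ x, |R x| ≤ I.card := fun x => by
      refine (Finset.abs_sum_le_sum_abs _ _).trans ?_
      simpa using Finset.sum_le_sum fun j (_ : j ∈ I) => hk1 (x j)
    have It : ∀ a b c d, Integrable (t a b c d) (iid ι μ) := fun a b c d => by
      refine (integrable_const ((I.card : ℝ) ^ a * (I.card : ℝ) ^ b)).mono' ?_
        (ae_of_all _ fun x => ?_)
      · have : t a b c d = fun x => (S x ^ a * R x ^ b) * (f (x i) ^ c * k (x i) ^ d) := funext (ht _ _ _ _)
        rw [this]
        exact ((mSR a b).mul ((mfi c d).comp (measurable_pi_apply i))).aestronglyMeasurable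
      · rw [ht, Real.norm_eq_abs, abs_mul, abs_mul, abs_mul, abs_pow, abs_pow, abs_pow, abs_pow]
        have h1 : |f (x i)| ^ c * |k (x i)| ^ d ≤ 1 :=
          mul_le_one₀ (pow_le_one₀ (abs_nonneg _) (hf1 _)) (by positivity)
            (pow_le_one₀ (abs_nonneg _) (hk1 _))
        refine (mul_le_of_le_one_right (by positivity) h1).trans ?_
        gcongr
        · exact bS x
        · exact bR x
    have Vt : ∀ a b c d, ∫ x, t a b c d x ∂iid ι μ
        = (∫ x, S x ^ a * R x ^ b ∂iid ι μ) * ∫ y, f y ^ c * k y ^ d ∂μ := fun a b c d => by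
      simp only [ht]
      rw [integral_mul_of_dependsOn (G := fun x => f (x i) ^ c * k (x i) ^ d) (mSR a b)
        ((mfi c d).comp (measurable_pi_apply i))
        (S := (I : Set ι)) (fun x y hxy => ?_) (dependsOn_eval (fun y => f y ^ c * k y ^ d) i)
        (disjoint_singleton_right.2 (by simpa using hi)),
        integral_eval (φ := fun y => f y ^ c * k y ^ d) (mfi c d)]
      have e1 : S x = S y := dependsOn_sum f I hxy
      have e2 : R x = R y := dependsOn_sum k I hxy
      simp only [e1, e2]
    have S1 : ∫ x, S x ∂iid ι μ = 0 := by
      have := integral_sum_eval hf (bf.integrable (by norm_num)) (μ := μ) I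
      rw [hf0, mul_zero] at this
      exact this
    have R1 : ∫ x, R x ∂iid ι μ = 0 := by
      have := integral_sum_eval hk (bk.integrable (by norm_num)) (μ := μ) I
      rw [hk0, mul_zero] at this
      exact this
    have S2 : ∫ x, S x ^ 2 ∂iid ι μ = I.card * ∫ a, f a ^ 2 ∂μ := integral_sum_eval_sq hf bf hf0 I
    have R2 : ∫ x, R x ^ 2 ∂iid ι μ = I.card * ∫ a, k a ^ 2 ∂μ := integral_sum_eval_sq hk bk hk0 I
    have hcard : ((insert i I).card : ℝ) = I.card + 1 := by
      rw [Finset.card_insert_of_notMem hi]; push_cast; ring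
    simp only [Finset.sum_insert hi, hcard]
    constructor
    · have e : ∀ x, (f (x i) + S x) * (k (x i) + R x)
          = t 1 1 0 0 x + t 1 0 0 1 x + t 0 1 1 0 x + t 0 0 1 1 x := fun x => by
        simp only [ht]; ring
      have i2 : Integrable (fun x => t 1 1 0 0 x + t 1 0 0 1 x) (iid ι μ) := (It _ _ _ _).add (It _ _ _ _)
      have i3 : Integrable (fun x => t 1 1 0 0 x + t 1 0 0 1 x + t 0 1 1 0 x) (iid ι μ) :=
        i2.add (It _ _ _ _)
      calc ∫ x, (f (x i) + S x) * (k (x i) + R x) ∂iid ι μ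
          = ∫ x, (t 1 1 0 0 x + t 1 0 0 1 x + t 0 1 1 0 x + t 0 0 1 1 x) ∂iid ι μ :=
            integral_congr_ae (ae_of_all _ e)
        _ = _ := by
            rw [integral_add i3 (It _ _ _ _), integral_add i2 (It _ _ _ _),
              integral_add (It _ _ _ _) (It _ _ _ _)]
            simp only [Vt, pow_one, pow_zero, one_mul, mul_one, S1, R1, ih1, zero_mul, add_zero,
              integral_const, probReal_univ, smul_eq_mul]
            ring
    -- Of the nine monomials only `S²R²`, `S²k²`, `4SRfk`, `R²f²` and `f²k²` survive; each of the
    -- others contains, after factorization, the mean of a single `f`, `k`, `S` or `R`.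
    · have e : ∀ x, (f (x i) + S x) ^ 2 * (k (x i) + R x) ^ 2
          = t 2 2 0 0 x + 2 * t 2 1 0 1 x + t 2 0 0 2 x + 2 * t 1 2 1 0 x + 4 * t 1 1 1 1 x
            + 2 * t 1 0 1 2 x + t 0 2 2 0 x + 2 * t 0 1 2 1 x + t 0 0 2 2 x := fun x => by
        simp only [ht]; ring
      have i2 : Integrable (fun x => t 2 2 0 0 x + 2 * t 2 1 0 1 x) (iid ι μ) :=
        (It _ _ _ _).add ((It _ _ _ _).const_mul 2)
      have i3 : Integrable (fun x => t 2 2 0 0 x + 2 * t 2 1 0 1 x + t 2 0 0 2 x) (iid ι μ) :=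
        i2.add (It _ _ _ _)
      have i4 : Integrable (fun x => t 2 2 0 0 x + 2 * t 2 1 0 1 x + t 2 0 0 2 x
          + 2 * t 1 2 1 0 x) (iid ι μ) := i3.add ((It _ _ _ _).const_mul 2)
      have i5 : Integrable (fun x => t 2 2 0 0 x + 2 * t 2 1 0 1 x + t 2 0 0 2 x
          + 2 * t 1 2 1 0 x + 4 * t 1 1 1 1 x) (iid ι μ) := i4.add ((It _ _ _ _).const_mul 4)
      have i6 : Integrable (fun x => t 2 2 0 0 x + 2 * t 2 1 0 1 x + t 2 0 0 2 x
          + 2 * t 1 2 1 0 x + 4 * t 1 1 1 1 x + 2 * t 1 0 1 2 x) (iid ι μ) :=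
        i5.add ((It _ _ _ _).const_mul 2)
      have i7 : Integrable (fun x => t 2 2 0 0 x + 2 * t 2 1 0 1 x + t 2 0 0 2 x
          + 2 * t 1 2 1 0 x + 4 * t 1 1 1 1 x + 2 * t 1 0 1 2 x + t 0 2 2 0 x) (iid ι μ) :=
        i6.add (It _ _ _ _)
      have i8 : Integrable (fun x => t 2 2 0 0 x + 2 * t 2 1 0 1 x + t 2 0 0 2 x
          + 2 * t 1 2 1 0 x + 4 * t 1 1 1 1 x + 2 * t 1 0 1 2 x + t 0 2 2 0 x
          + 2 * t 0 1 2 1 x) (iid ι μ) := i7.add ((It _ _ _ _).const_mul 2)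
      calc ∫ x, (f (x i) + S x) ^ 2 * (k (x i) + R x) ^ 2 ∂iid ι μ
          = ∫ x, (t 2 2 0 0 x + 2 * t 2 1 0 1 x + t 2 0 0 2 x + 2 * t 1 2 1 0 x + 4 * t 1 1 1 1 x
            + 2 * t 1 0 1 2 x + t 0 2 2 0 x + 2 * t 0 1 2 1 x + t 0 0 2 2 x) ∂iid ι μ :=
            integral_congr_ae (ae_of_all _ e)
        _ = _ := by
            rw [integral_add i8 (It _ _ _ _), integral_add i7 ((It _ _ _ _).const_mul _),
              integral_add i6 (It _ _ _ _), integral_add i5 ((It _ _ _ _).const_mul _),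
              integral_add i4 ((It _ _ _ _).const_mul _), integral_add i3 ((It _ _ _ _).const_mul _),
              integral_add i2 (It _ _ _ _), integral_add (It _ _ _ _) ((It _ _ _ _).const_mul _)]
            simp only [integral_const_mul, Vt, pow_one, pow_zero, one_mul, mul_one, S1, R1, S2, R2,
              ih1, ih2, hf0, hk0, zero_mul, mul_zero, add_zero, integral_const, probReal_univ,
              smul_eq_mul]
            ring

lemma bridge_comm (s t : ℝ) : bridge μ s t = bridge μ t s := by
  rw [bridge, bridge, min_comm, max_comm]

lemma bridge_self_le (s : ℝ) : bridge μ s s ≤ 1 / 4 := by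
  rw [bridge, min_self, max_self]
  nlinarith [sq_nonneg (cdf μ s - 1 / 2)]

lemma integral_dev_sq (s : ℝ) : ∫ a, dev μ a s ^ 2 ∂μ = bridge μ s s := by
  rw [← integral_dev_mul]; simp only [sq]

lemma integral_dev_sq_mul_sq {s t : ℝ} (hst : s ≤ t) :
    ∫ a, dev μ a s ^ 2 * dev μ a t ^ 2 ∂μ = bridge μ s t *
      ((1 - 2 * cdf μ s) * (1 - cdf μ t) + cdf μ s * cdf μ t) := by
  set u := cdf μ s with hu
  set v := cdf μ t with hv
  have e : ∀ a, dev μ a s ^ 2 * dev μ a t ^ 2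
      = (1 - 2 * u) * (1 - v) ^ 2 * step a s + u ^ 2 * (1 - 2 * v) * step a t + u ^ 2 * v ^ 2 := by
    intro a
    simp only [dev, step_eq, ← hu, ← hv]
    by_cases h1 : a ≤ s
    · simp only [h1, h1.trans hst, if_true]; ring
    · by_cases h2 : a ≤ t
      · simp only [h1, h2, if_true, if_false]; ring
      · simp only [h1, h2, if_false]; ring
  simp only [e]
  have i1 := (integrable_step (μ := μ) s).const_mul ((1 - 2 * u) * (1 - v) ^ 2)
  have i2 := (integrable_step (μ := μ) t).const_mul (u ^ 2 * (1 - 2 * v))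
  have i12 : Integrable (fun a => (1 - 2 * u) * (1 - v) ^ 2 * step a s
      + u ^ 2 * (1 - 2 * v) * step a t) μ := i1.add i2
  rw [integral_add i12 (integrable_const _), integral_add i1 i2, integral_const_mul,
    integral_const_mul, integral_step, integral_step, bridge, min_eq_left hst, max_eq_right hst,
    ← hu, ← hv]
  simp only [integral_const, probReal_univ, smul_eq_mul, one_mul]
  ring

/-- Let `u = F(s) ≤ v = F(t)` and `b = bridge s t`. The single-variable mixed fourth moment is `b r`
with `r = 1 - v - 2u + 3uv`, while the pair term is `b (1 - r)`. Hence the left side is `|I| b (r +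
(|I| - 1)(1 - r))`, and `0 ≤ r ≤ 1` gives the bound with constant exactly one. -/
lemma integral_sum_dev_sq_mul_sq_le (I : Finset ι) (s t : ℝ) :
    ∫ x, (∑ i ∈ I, dev μ (x i) s) ^ 2 * (∑ i ∈ I, dev μ (x i) t) ^ 2 ∂iid ι μ
      ≤ I.card ^ 2 * bridge μ s t := by
  have key : ∀ {s t : ℝ}, s ≤ t →
      ∫ x, (∑ i ∈ I, dev μ (x i) s) ^ 2 * (∑ i ∈ I, dev μ (x i) t) ^ 2 ∂iid ι μ
      ≤ I.card ^ 2 * bridge μ s t := by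
    intro s t hst
    have md : ∀ s, Measurable fun a => dev μ a s := fun s =>
      measurable_dev_comp measurable_id measurable_const
    rw [(integral_sq_mul_sq_sum (md s) (md t) (fun a => abs_dev_le a s) (fun a => abs_dev_le a t)
      (integral_dev s) (integral_dev t) I).2, integral_dev_sq_mul_sq hst, integral_dev_sq,
      integral_dev_sq, integral_dev_mul]
    rcases Finset.eq_empty_or_nonempty I with rfl | hI
    · simp
    have hc : (1 : ℝ) ≤ I.card := by exact_mod_cast hI.card_pos
    have hb := bridge_nonneg (μ := μ) s t
    have hu0 := cdf_nonneg μ s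
    have hv1 := cdf_le_one μ t
    have huv := monotone_cdf μ hst
    set u := cdf μ s with hu
    set v := cdf μ t with hv
    have hbr : bridge μ s t = u * (1 - v) := by
      rw [bridge, min_eq_left hst, max_eq_right hst]
    have e1 : bridge μ s s * bridge μ t t = bridge μ s t * ((1 - u) * v) := by
      rw [hbr, bridge, bridge, min_self, max_self, min_self, max_self, ← hu, ← hv]; ring
    have hr0 : 0 ≤ 1 - v - 2 * u + 3 * (u * v) := by
      rcases le_total 1 (3 * u) with h | h
      · nlinarith [mul_nonneg (sub_nonneg.2 h) (sub_nonneg.2 huv), sq_nonneg (2 * u - 1)]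
      · nlinarith [mul_nonneg (sub_nonneg.2 h) (sub_nonneg.2 hv1)]
    have hr1 : 1 - v - 2 * u + 3 * (u * v) ≤ 1 := by
      nlinarith [mul_nonneg hu0 (sub_nonneg.2 hv1), mul_nonneg (hu0.trans huv)
        (sub_nonneg.2 (huv.trans hv1))]
    set r := 1 - v - 2 * u + 3 * (u * v) with hr
    have e2 : (I.card : ℝ) * (bridge μ s t * ((1 - 2 * u) * (1 - v) + u * v)) + I.card * (I.card - 1)
        * (bridge μ s s * bridge μ t t + 2 * bridge μ s t ^ 2)
        = I.card * bridge μ s t * (r + (I.card - 1) * (1 - r)) := by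
      rw [e1, sq (bridge μ s t)]; nth_rewrite 4 [hbr]; rw [hr]; ring
    rw [e2]
    have h3 : r + (I.card - 1) * (1 - r) ≤ I.card := by nlinarith
    calc (I.card : ℝ) * bridge μ s t * (r + (I.card - 1) * (1 - r))
        ≤ I.card * bridge μ s t * I.card := by gcongr
      _ = _ := by ring
  rcases le_total s t with h | h
  · exact key h
  · rw [bridge_comm]
    simp_rw [mul_comm ((∑ i ∈ I, dev μ (_ : ℝ) s) ^ 2)]
    exact key h

end

/-! ### Mean-square bounds for the remainder -/

/-- Minkowski's inequality for a function dominated by a sum. -/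
lemma memLp_and_sqrt_le_of_abs_le_add {α : Type*} [MeasurableSpace α] {P : Measure α}
    {f a b : α → ℝ} {A B : ℝ} (hf : AEStronglyMeasurable f P) (ha : MemLp a 2 P) (hb : MemLp b 2 P)
    (hA : √(∫ x, a x ^ 2 ∂P) ≤ A) (hB : √(∫ x, b x ^ 2 ∂P) ≤ B) (hfab : ∀ x, |f x| ≤ a x + b x) :
    MemLp f 2 P ∧ √(∫ x, f x ^ 2 ∂P) ≤ A + B := by
  have hA0 : 0 ≤ A := (Real.sqrt_nonneg _).trans hA
  have hB0 : 0 ≤ B := (Real.sqrt_nonneg _).trans hB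
  have hfL : MemLp f 2 P := (ha.add hb).mono hf (ae_of_all _ fun x => by
    rw [Real.norm_eq_abs, Real.norm_eq_abs, Pi.add_apply]; exact (hfab x).trans (le_abs_self _))
  refine ⟨hfL, Real.sqrt_le_iff.2 ⟨by positivity, ?_⟩⟩
  have iab : Integrable (fun x => a x * b x) P := ha.integrable_mul hb
  have hpt : ∀ x, f x ^ 2 ≤ a x ^ 2 + 2 * (a x * b x) + b x ^ 2 := fun x => by
    rw [← sq_abs]
    have := pow_le_pow_left₀ (abs_nonneg _) (hfab x) 2
    linarith [this]
  have i1 : Integrable (fun x => a x ^ 2 + 2 * (a x * b x)) P :=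
    ha.integrable_sq.add (iab.const_mul 2)
  have h1 := integral_mono hfL.integrable_sq (i1.add hb.integrable_sq) hpt
  simp only [Pi.add_apply] at h1
  rw [integral_add i1 hb.integrable_sq, integral_add ha.integrable_sq (iab.const_mul 2),
    integral_const_mul] at h1
  have h2 : ∫ x, a x * b x ∂P ≤ A * B :=
    (le_abs_self _).trans (abs_integral_le_integral_abs.trans ((integral_abs_mul_le ha hb).trans
      (mul_le_mul hA hB (Real.sqrt_nonneg _) hA0)))
  have h3 := (Real.sqrt_le_left hA0).1 hA
  have h4 := (Real.sqrt_le_left hB0).1 hB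
  nlinarith

section

variable {n : ℕ} {μ : Measure ℝ} [IsProbabilityMeasure μ] (hX : MemLp (fun x : ℝ => x) 2 μ)

/-- The sum of the deviations over the observations in `I`. -/
noncomputable def devSum (μ : Measure ℝ) (I : Finset (Fin n)) (x : Fin n → ℝ) (s : ℝ) : ℝ :=
  ∑ j ∈ I, dev μ (x j) s

lemma measurable_devSum_comp {α : Type*} [MeasurableSpace α] (I : Finset (Fin n))
    {f : α → Fin n → ℝ} {k : α → ℝ} (hf : Measurable f) (hk : Measurable k) :
    Measurable fun a => devSum μ I (f a) (k a) :=
  Finset.measurable_sum I fun j _ => measurable_dev_comp ((measurable_pi_apply j).comp hf) hk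

lemma abs_devSum_le (I : Finset (Fin n)) (x : Fin n → ℝ) (s : ℝ) : |devSum μ I x s| ≤ I.card := by
  refine (Finset.abs_sum_le_sum_abs _ _).trans ?_
  simpa using Finset.sum_le_sum fun j (_ : j ∈ I) => abs_dev_le (μ := μ) (x j) s

lemma mixedCDF_eq (I : Finset (Fin n)) (x : Fin n → ℝ) (s : ℝ) :
    mixedCDF μ I x s = cdf μ s + (n : ℝ)⁻¹ * devSum μ I x s := rfl

include hX

lemma integrable_devSum (I : Finset (Fin n)) (x : Fin n → ℝ) :
    Integrable fun s => devSum μ I x s :=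
  integrable_finsetSum I fun j _ => integrable_dev_volume hX (x j)

lemma integrable_devSum_sq (I : Finset (Fin n)) (x : Fin n → ℝ) :
    Integrable fun s => devSum μ I x s ^ 2 := by
  simp only [sq]
  exact (integrable_devSum hX I x).mul_bdd (c := I.card)
    (measurable_devSum_comp I measurable_const measurable_id).aestronglyMeasurable
    (ae_of_all _ fun s => abs_devSum_le I x s)

/-- The mean square of the Cramér–von Mises type integral of the empirical process. -/
lemma integral_devSum_sq_sq_le (I : Finset (Fin n)) :
    MemLp (fun x => ∫ s, devSum μ I x s ^ 2) 2 (iid (Fin n) μ) ∧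
    √(∫ x, (∫ s, devSum μ I x s ^ 2) ^ 2 ∂iid (Fin n) μ) ≤ I.card * √(∫ x, x ^ 2 ∂μ) := by
  have m1 : Measurable fun q : (Fin n → ℝ) × ℝ => devSum μ I q.1 q.2 ^ 2 :=
    (measurable_devSum_comp I measurable_fst measurable_snd).pow_const 2
  have hm : Measurable (Function.uncurry fun (x : Fin n → ℝ) (q : ℝ × ℝ) =>
      devSum μ I x q.1 ^ 2 * devSum μ I x q.2 ^ 2) :=
    ((measurable_devSum_comp I measurable_fst (measurable_fst.comp measurable_snd)).pow_const 2).mul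
      ((measurable_devSum_comp I measurable_fst (measurable_snd.comp measurable_snd)).pow_const 2)
  have hb : ∀ q : ℝ × ℝ, ∫ x, devSum μ I x q.1 ^ 2 * devSum μ I x q.2 ^ 2 ∂iid (Fin n) μ
      ≤ I.card ^ 2 * bridge μ q.1 q.2 := fun q => integral_sum_dev_sq_mul_sq_le I q.1 q.2
  have hi : Integrable (Function.uncurry fun (x : Fin n → ℝ) (q : ℝ × ℝ) =>
      devSum μ I x q.1 ^ 2 * devSum μ I x q.2 ^ 2) ((iid (Fin n) μ).prod (volume.prod volume)) := by
    rw [integrable_prod_iff' hm.aestronglyMeasurable]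
    refine ⟨ae_of_all _ fun q => ?_, ?_⟩
    · refine (integrable_const ((I.card : ℝ) ^ 2 * (I.card : ℝ) ^ 2)).mono'
        (hm.comp measurable_prodMk_right).aestronglyMeasurable (ae_of_all _ fun x => ?_)
      simp only [Function.uncurry_apply_pair, Real.norm_eq_abs, abs_mul, abs_pow]
      gcongr <;> exact abs_devSum_le I x _
    · refine ((integrable_bridge hX).const_mul ((I.card : ℝ) ^ 2)).mono'
        (hm.norm.stronglyMeasurable.integral_prod_left').aestronglyMeasurable
        (ae_of_all _ fun q => ?_)
      rw [Real.norm_eq_abs, abs_of_nonneg (integral_nonneg fun _ => norm_nonneg _)]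
      refine le_trans (le_of_eq (integral_congr_ae (ae_of_all _ fun x => ?_))) (hb q)
      simp only [Function.uncurry_apply_pair, Real.norm_eq_abs]
      exact abs_of_nonneg (by positivity)
  -- Squaring gives a double integral, so after Fubini only the mixed fourth moment and the total
  -- mass of the kernel are needed.
  have hsq : ∀ x, (∫ s, devSum μ I x s ^ 2) ^ 2
      = ∫ q : ℝ × ℝ, devSum μ I x q.1 ^ 2 * devSum μ I x q.2 ^ 2 ∂(volume.prod volume) := fun x => by
    rw [sq]
    exact (integral_prod_mul (fun s => devSum μ I x s ^ 2) (fun s => devSum μ I x s ^ 2)).symm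
  have mI : Measurable fun x => ∫ s, devSum μ I x s ^ 2 :=
    m1.stronglyMeasurable.integral_prod_right'.measurable
  refine ⟨?_, ?_⟩
  · rw [memLp_two_iff_integrable_sq mI.aestronglyMeasurable]
    simp only [hsq]
    exact hi.integral_prod_left
  · refine Real.sqrt_le_iff.2 ⟨by positivity, ?_⟩
    simp only [hsq]
    rw [integral_integral_swap hi, mul_pow,
      Real.sq_sqrt (integral_nonneg fun x => sq_nonneg x)]
    refine (integral_mono hi.integral_prod_right ((integrable_bridge hX).const_mul _) hb).trans ?_
    rw [integral_const_mul]
    exact mul_le_mul_of_nonneg_left (integral_bridge_le hX) (by positivity)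

/-- Interaction of one observation with the empirical process of the others. -/
lemma integral_abs_dev_mul_devSum_le {i : Fin n} {I : Finset (Fin n)} (hi : i ∉ I) :
    MemLp (fun x => ∫ s, |dev μ (x i) s| * |devSum μ I x s|) 2 (iid (Fin n) μ) ∧
    √(∫ x, (∫ s, |dev μ (x i) s| * |devSum μ I x s|) ^ 2 ∂iid (Fin n) μ)
      ≤ √(I.card / 2) * √(∫ x, x ^ 2 ∂μ) := by
  have md : Measurable fun q : (Fin n → ℝ) × ℝ => dev μ (q.1 i) q.2 :=
    measurable_dev_comp ((measurable_pi_apply i).comp measurable_fst) measurable_snd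
  have mS : Measurable fun q : (Fin n → ℝ) × ℝ => devSum μ I q.1 q.2 :=
    measurable_devSum_comp I measurable_fst measurable_snd
  have m1 : Measurable fun q : (Fin n → ℝ) × ℝ => |dev μ (q.1 i) q.2| * |devSum μ I q.1 q.2| :=
    md.abs.mul mS.abs
  have mI : Measurable fun x => ∫ s, |dev μ (x i) s| * |devSum μ I x s| :=
    m1.stronglyMeasurable.integral_prod_right'.measurable
  -- Cauchy–Schwarz
  have hcs : ∀ x, (∫ s, |dev μ (x i) s| * |devSum μ I x s|) ^ 2
      ≤ ∫ s, totalDev μ (x i) * |dev μ (x i) s| * devSum μ I x s ^ 2 := by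
    intro x
    have id := (integrable_dev_volume hX (x i)).abs
    have ids : Integrable fun s => |dev μ (x i) s| * devSum μ I x s ^ 2 :=
      (integrable_devSum_sq hX I x).bdd_mul (c := 1)
        (measurable_dev_comp (μ := μ) (f := fun _ : ℝ => x i) measurable_const
          measurable_id).abs.aestronglyMeasurable
        (ae_of_all _ fun s => by simpa using abs_dev_le (μ := μ) (x i) s)
    have mD : Measurable fun s => |dev μ (x i) s| :=
      (measurable_dev_comp measurable_const measurable_id).abs
    have mT : Measurable fun s => devSum μ I x s :=
      measurable_devSum_comp I measurable_const measurable_id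
    have ea : ∀ s, √|dev μ (x i) s| ^ 2 = |dev μ (x i) s| := fun s => Real.sq_sqrt (abs_nonneg _)
    have eb : ∀ s, (√|dev μ (x i) s| * |devSum μ I x s|) ^ 2
        = |dev μ (x i) s| * devSum μ I x s ^ 2 := fun s => by rw [mul_pow, ea, sq_abs]
    have La : MemLp (fun s => √|dev μ (x i) s|) 2 volume := by
      rw [memLp_two_iff_integrable_sq mD.sqrt.aestronglyMeasurable]
      simp only [ea]; exact id
    have Lb : MemLp (fun s => √|dev μ (x i) s| * |devSum μ I x s|) 2 volume := by
      have mb : Measurable fun s => √|dev μ (x i) s| * |devSum μ I x s| := mD.sqrt.mul mT.abs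
      rw [memLp_two_iff_integrable_sq mb.aestronglyMeasurable]
      simp only [eb]; exact ids
    have h1 := integral_abs_mul_le La Lb
    have ec : ∀ s, |√|dev μ (x i) s| * (√|dev μ (x i) s| * |devSum μ I x s|)|
        = |dev μ (x i) s| * |devSum μ I x s| := fun s => by
      rw [← mul_assoc, Real.mul_self_sqrt (abs_nonneg _), abs_of_nonneg (by positivity)]
    simp only [ea, eb, ec] at h1
    have h2 := pow_le_pow_left₀ (integral_nonneg fun s => by positivity) h1 2
    refine h2.trans (le_of_eq ?_)
    rw [mul_pow, Real.sq_sqrt (integral_nonneg fun _ => abs_nonneg _),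
      Real.sq_sqrt (integral_nonneg fun _ => by positivity), ← integral_const_mul]
    refine integral_congr_ae (ae_of_all _ fun s => ?_)
    simp only [totalDev, mul_assoc]
  -- Fubini for a single observation
  have hm2 : Measurable (Function.uncurry fun y s => totalDev μ y * |dev μ y s|) :=
    (measurable_totalDev.comp measurable_fst).mul
      (measurable_dev_comp measurable_fst measurable_snd).abs
  have hi2 : Integrable (Function.uncurry fun y s => totalDev μ y * |dev μ y s|)
      (μ.prod volume) := by
    rw [integrable_prod_iff hm2.aestronglyMeasurable]
    refine ⟨ae_of_all _ fun y => (integrable_dev_volume hX y).abs.const_mul (totalDev μ y), ?_⟩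
    refine (memLp_totalDev hX).integrable_sq.congr (ae_of_all _ fun y => ?_)
    simp only [Function.uncurry_apply_pair, Real.norm_eq_abs, abs_mul, abs_abs,
      abs_of_nonneg (totalDev_nonneg y)]
    rw [integral_const_mul, sq]; rfl
  have hsec : ∀ s, ∫ y, totalDev μ y * |dev μ y s| ∂μ ≥ 0 := fun s =>
    integral_nonneg fun y => mul_nonneg (totalDev_nonneg y) (abs_nonneg _)
  have htot : ∫ s, ∫ y, totalDev μ y * |dev μ y s| ∂μ = ∫ y, totalDev μ y ^ 2 ∂μ := by
    rw [← integral_integral_swap hi2]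
    refine integral_congr_ae (ae_of_all _ fun y => ?_)
    simp only
    rw [integral_const_mul, sq]; rfl
  have hS2 : ∀ s, ∫ x, devSum μ I x s ^ 2 ∂iid (Fin n) μ = I.card * bridge μ s s := fun s => by
    have mds : Measurable fun a => dev μ a s := measurable_dev_comp measurable_id measurable_const
    rw [← integral_dev_sq]
    exact integral_sum_eval_sq mds (MemLp.of_bound mds.aestronglyMeasurable 1
      (ae_of_all _ fun a => abs_dev_le a s)) (integral_dev s) I
  have hm3 : Measurable (Function.uncurry fun (x : Fin n → ℝ) s =>
      totalDev μ (x i) * |dev μ (x i) s| * devSum μ I x s ^ 2) :=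
    ((measurable_totalDev.comp ((measurable_pi_apply i).comp measurable_fst)).mul md.abs).mul
      (mS.pow_const 2)
  have hprod : ∀ s, ∫ x, totalDev μ (x i) * |dev μ (x i) s| * devSum μ I x s ^ 2 ∂iid (Fin n) μ
      = (∫ y, totalDev μ y * |dev μ y s| ∂μ) * (I.card * bridge μ s s) := fun s => by
    have mk : Measurable fun y => totalDev μ y * |dev μ y s| := hm2.comp measurable_prodMk_right
    rw [integral_mul_of_dependsOn (F := fun x => totalDev μ (x i) * |dev μ (x i) s|)
      (G := fun x => devSum μ I x s ^ 2) (mk.comp (measurable_pi_apply i))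
      ((measurable_devSum_comp I measurable_id measurable_const).pow_const 2)
      (dependsOn_eval (fun y => totalDev μ y * |dev μ y s|) i) (T := (I : Set (Fin n)))
      (fun x y hxy => ?_) (disjoint_singleton_left.2 (by simpa using hi)), hS2,
      integral_eval (φ := fun y => totalDev μ y * |dev μ y s|) mk]
    have : devSum μ I x s = devSum μ I y s := dependsOn_sum (fun a => dev μ a s) I hxy
    simp only [this]
  -- Independence factors the mean, and `bridge s s ≤ 1/4`; with `E totalDev² ≤ 2 E X²` this
  -- produces the factor `|I|/2`.
  have hb : ∀ s, ∫ x, totalDev μ (x i) * |dev μ (x i) s| * devSum μ I x s ^ 2 ∂iid (Fin n) μ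
      ≤ (I.card / 4 : ℝ) * ∫ y, totalDev μ y * |dev μ y s| ∂μ := fun s => by
    rw [hprod, mul_comm]
    refine mul_le_mul_of_nonneg_right ?_ (hsec s)
    have := mul_le_mul_of_nonneg_left (bridge_self_le (μ := μ) s) (Nat.cast_nonneg (α := ℝ) I.card)
    linarith
  have hi3 : Integrable (Function.uncurry fun (x : Fin n → ℝ) s =>
      totalDev μ (x i) * |dev μ (x i) s| * devSum μ I x s ^ 2) ((iid (Fin n) μ).prod volume) := by
    rw [integrable_prod_iff' hm3.aestronglyMeasurable]
    refine ⟨ae_of_all _ fun s => ?_, ?_⟩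
    · have i1 : Integrable (fun x : Fin n → ℝ => totalDev μ (x i)) (iid (Fin n) μ) :=
        integrable_eval ((memLp_totalDev hX).integrable (by norm_num)) i
      refine (i1.mul_const ((I.card : ℝ) ^ 2)).mono'
        (hm3.comp measurable_prodMk_right).aestronglyMeasurable (ae_of_all _ fun x => ?_)
      have h0 := totalDev_nonneg (μ := μ) (x i)
      simp only [Function.uncurry_apply_pair, Real.norm_eq_abs, abs_mul, abs_pow, abs_abs,
        abs_of_nonneg h0]
      have h1 := pow_le_pow_left₀ (abs_nonneg _) (abs_devSum_le (μ := μ) I x s) 2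
      exact mul_le_mul (mul_le_of_le_one_right h0 (abs_dev_le _ _)) h1 (by positivity) h0
    · refine (hi2.integral_prod_right.const_mul (I.card / 4 : ℝ)).mono'
        (hm3.norm.stronglyMeasurable.integral_prod_left').aestronglyMeasurable
        (ae_of_all _ fun s => ?_)
      rw [Real.norm_eq_abs, abs_of_nonneg (integral_nonneg fun _ => norm_nonneg _)]
      refine le_trans (le_of_eq (integral_congr_ae (ae_of_all _ fun x => ?_))) (hb s)
      have h0 := totalDev_nonneg (μ := μ) (x i)
      simp only [Function.uncurry_apply_pair, Real.norm_eq_abs]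
      exact abs_of_nonneg (by positivity)
  have hL : MemLp (fun x => ∫ s, |dev μ (x i) s| * |devSum μ I x s|) 2 (iid (Fin n) μ) := by
    rw [memLp_two_iff_integrable_sq mI.aestronglyMeasurable]
    refine hi3.integral_prod_left.mono' (mI.pow_const 2).aestronglyMeasurable
      (ae_of_all _ fun x => ?_)
    rw [Real.norm_eq_abs, abs_of_nonneg (sq_nonneg _)]
    exact hcs x
  refine ⟨hL, Real.sqrt_le_iff.2 ⟨by positivity, ?_⟩⟩
  refine (integral_mono hL.integrable_sq hi3.integral_prod_left hcs).trans ?_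
  simp only [Function.uncurry_apply_pair]
  rw [integral_integral_swap hi3, mul_pow, Real.sq_sqrt (by positivity),
    Real.sq_sqrt (integral_nonneg fun x => sq_nonneg x)]
  refine (integral_mono hi3.integral_prod_right (hi2.integral_prod_right.const_mul _) hb).trans ?_
  simp only [Function.uncurry_apply_pair]
  rw [integral_const_mul, htot]
  have h1 := mul_le_mul_of_nonneg_left (integral_sq_totalDev_le hX)
    (show (0 : ℝ) ≤ I.card / 4 by positivity)
  linarith

end

lemma sqrt_integral_const_mul_sq {α : Type*} [MeasurableSpace α] {P : Measure α} {r : ℝ}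
    (hr : 0 ≤ r) (f : α → ℝ) : √(∫ x, (r * f x) ^ 2 ∂P) = r * √(∫ x, f x ^ 2 ∂P) := by
  simp only [mul_pow]
  rw [integral_const_mul, Real.sqrt_mul (sq_nonneg r), Real.sqrt_sq hr]

section

variable {n : ℕ} {μ : Measure ℝ} [IsProbabilityMeasure μ] (hX : MemLp (fun x : ℝ => x) 2 μ)
  {J e : ℝ → ℝ} {c₀ : ℝ} (hJ : ∀ s t, |J t - J s| ≤ c₀ * |t - s|)
  (he : ∀ s t, |e t - e s| ≤ c₀ / (2 * n) * |t - s|) (he0 : e 0 = 0) (hn : 0 < n)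
include hX hJ he he0 hn

lemma abs_remainder_le (x : Fin n → ℝ) :
    |remainder μ J e Finset.univ x| ≤ c₀ / (2 * n) * ((n : ℝ)⁻¹ * ∑ i, |x i|)
      + c₀ / 2 * ((n : ℝ)⁻¹ ^ 2) * ∫ s, devSum μ Finset.univ x s ^ 2 := by
  have hn0 : (0 : ℝ) < n := by exact_mod_cast hn
  have h0 := lipschitz_const_nonneg hJ
  have i1 : Integrable fun s => c₀ / (2 * n) * ((n : ℝ)⁻¹ * ∑ i, |step 0 s - step (x i) s|) :=
    ((integrable_finsetSum _ fun i _ => (integrable_step_sub 0 (x i)).abs).const_mul _).const_mul _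
  have i2 : Integrable fun s => c₀ / 2 * ((n : ℝ)⁻¹ ^ 2) * devSum μ Finset.univ x s ^ 2 :=
    (integrable_devSum_sq hX Finset.univ x).const_mul _
  have hpt : ∀ s, |remIntegrand μ J e s (mixedCDF μ Finset.univ x s)| ≤
      c₀ / (2 * n) * ((n : ℝ)⁻¹ * ∑ i, |step 0 s - step (x i) s|)
        + c₀ / 2 * ((n : ℝ)⁻¹ ^ 2) * devSum μ Finset.univ x s ^ 2 := fun s => by
    refine (abs_remIntegrand_le hJ he he0 s _).trans (add_le_add ?_ (le_of_eq ?_))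
    · refine mul_le_mul_of_nonneg_left ?_ (by positivity)
      have e1 : step 0 s - mixedCDF μ Finset.univ x s
          = (n : ℝ)⁻¹ * ∑ i, (step 0 s - step (x i) s) := by
        rw [mixedCDF_univ hn, empiricalCDF_apply, Finset.sum_sub_distrib]
        simp only [Finset.sum_const, Finset.card_univ, Fintype.card_fin, nsmul_eq_mul]
        field_simp
      rw [e1, abs_mul, abs_of_nonneg (show 0 ≤ (n : ℝ)⁻¹ by positivity)]
      exact mul_le_mul_of_nonneg_left (Finset.abs_sum_le_sum_abs _ _) (by positivity)
    · rw [mixedCDF_eq, add_sub_cancel_left]; ring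
  rw [remainder]
  refine abs_integral_le_integral_abs.trans ((integral_mono
    (integrable_remIntegrand hJ he he0 hX Finset.univ x).abs (i1.add i2) hpt).trans (le_of_eq ?_))
  simp only [Pi.add_apply]
  rw [integral_add i1 i2, integral_const_mul, integral_const_mul, integral_const_mul,
    integral_finsetSum _ fun i _ => (integrable_step_sub 0 (x i)).abs]
  simp only [integral_abs_step_sub, zero_sub, abs_neg]

/-- The Riemann-sum part and the Taylor part each contribute `c₀ ‖X‖₂ / (2n)`. -/
lemma memLp_remainder : MemLp (remainder μ J e (Finset.univ : Finset (Fin n))) 2 (iid (Fin n) μ) ∧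
    √(∫ x, remainder μ J e Finset.univ x ^ 2 ∂iid (Fin n) μ) ≤ c₀ * √(∫ x, x ^ 2 ∂μ) / n := by
  have hn0 : (0 : ℝ) < n := by exact_mod_cast hn
  have h0 := lipschitz_const_nonneg hJ
  obtain ⟨h1, h2⟩ := integral_devSum_sq_sq_le hX (Finset.univ : Finset (Fin n))
  simp only [Finset.card_univ, Fintype.card_fin] at h2
  have hA : MemLp (fun x : Fin n → ℝ => (n : ℝ)⁻¹ * ∑ i, |x i|) 2 (iid (Fin n) μ) :=
    (memLp_sum_eval hX.abs Finset.univ).const_mul _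
  have hA2 : √(∫ x : Fin n → ℝ, ((n : ℝ)⁻¹ * ∑ i, |x i|) ^ 2 ∂iid (Fin n) μ) ≤ √(∫ x, x ^ 2 ∂μ) := by
    refine Real.sqrt_le_sqrt ?_
    have i1 : ∀ i : Fin n, Integrable (fun x : Fin n → ℝ => x i ^ 2) (iid (Fin n) μ) := fun i =>
      integrable_eval (φ := fun a => a ^ 2) hX.integrable_sq i
    have hpt : ∀ x : Fin n → ℝ, ((n : ℝ)⁻¹ * ∑ i, |x i|) ^ 2 ≤ (n : ℝ)⁻¹ * ∑ i, x i ^ 2 := fun x => by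
      have h3 := sq_sum_le_card_mul_sum_sq (s := Finset.univ) (f := fun i => |x i|)
      simp only [Finset.card_univ, Fintype.card_fin, sq_abs] at h3
      calc ((n : ℝ)⁻¹ * ∑ i, |x i|) ^ 2 = (n : ℝ)⁻¹ ^ 2 * (∑ i, |x i|) ^ 2 := by ring
        _ ≤ (n : ℝ)⁻¹ ^ 2 * (n * ∑ i, x i ^ 2) := by gcongr
        _ = _ := by field_simp
    refine (integral_mono hA.integrable_sq ((integrable_finsetSum _ fun i _ => i1 i).const_mul _)
      hpt).trans (le_of_eq ?_)
    rw [integral_const_mul, integral_finsetSum _ fun i _ => i1 i]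
    have h4 : ∀ i : Fin n, ∫ x : Fin n → ℝ, x i ^ 2 ∂iid (Fin n) μ = ∫ a, a ^ 2 ∂μ := fun i =>
      integral_eval (φ := fun a => a ^ 2) (by fun_prop) i
    simp only [h4, Finset.sum_const, Finset.card_univ, Fintype.card_fin, nsmul_eq_mul]
    field_simp
  have k := memLp_and_sqrt_le_of_abs_le_add
    (measurable_remainder (n := n) (μ := μ) hJ he Finset.univ).aestronglyMeasurable
    (hA.const_mul (c₀ / (2 * n))) (h1.const_mul (c₀ / 2 * ((n : ℝ)⁻¹ ^ 2)))
    (le_of_eq (sqrt_integral_const_mul_sq (by positivity) _))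
    (le_of_eq (sqrt_integral_const_mul_sq (by positivity) _))
    (abs_remainder_le hX hJ he he0 hn)
  refine ⟨k.1, k.2.trans ?_⟩
  have a1 := mul_le_mul_of_nonneg_left hA2 (show 0 ≤ c₀ / (2 * n) by positivity)
  have a2 := mul_le_mul_of_nonneg_left h2 (show 0 ≤ c₀ / 2 * ((n : ℝ)⁻¹ ^ 2) by positivity)
  refine (add_le_add a1 a2).trans (le_of_eq ?_)
  field_simp; ring

lemma abs_remainder_sub_le (i : Fin n) (x : Fin n → ℝ) :
    |remainder μ J e Finset.univ x - remainder μ J e (Finset.univ.erase i) x| ≤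
      c₀ * (n : ℝ)⁻¹ ^ 2 * (∫ s, |dev μ (x i) s| * |devSum μ (Finset.univ.erase i) x s|)
      + c₀ * (n : ℝ)⁻¹ ^ 2 * totalDev μ (x i) := by
  have hn0 : (0 : ℝ) < n := by exact_mod_cast hn
  have h0 := lipschitz_const_nonneg hJ
  set I : Finset (Fin n) := Finset.univ.erase i
  have i1 : Integrable fun s => |dev μ (x i) s| * |devSum μ I x s| :=
    (integrable_dev_volume hX (x i)).abs.mul_bdd (c := I.card)
      (measurable_devSum_comp I measurable_const measurable_id).abs.aestronglyMeasurable
      (ae_of_all _ fun s => by simpa using abs_devSum_le (μ := μ) I x s)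
  have i2 := (integrable_dev_volume hX (x i)).abs
  have hpt : ∀ s, |remIntegrand μ J e s (mixedCDF μ Finset.univ x s)
      - remIntegrand μ J e s (mixedCDF μ I x s)| ≤
      c₀ * (n : ℝ)⁻¹ ^ 2 * (|dev μ (x i) s| * |devSum μ I x s|)
        + c₀ * (n : ℝ)⁻¹ ^ 2 * |dev μ (x i) s| := fun s => by
    refine (abs_remIntegrand_sub_le hJ he s _ _).trans ?_
    have e1 : mixedCDF μ Finset.univ x s - mixedCDF μ I x s = (n : ℝ)⁻¹ * dev μ (x i) s := by
      rw [mixedCDF, mixedCDF, ← Finset.add_sum_erase _ _ (Finset.mem_univ i)]; ring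
    have e2 : mixedCDF μ I x s - cdf μ s = (n : ℝ)⁻¹ * devSum μ I x s := by
      rw [mixedCDF_eq, add_sub_cancel_left]
    have hinv : |(n : ℝ)⁻¹| = (n : ℝ)⁻¹ := abs_of_nonneg (by positivity)
    rw [e1, e2, abs_mul, abs_mul, hinv]
    have h1 := abs_dev_le (μ := μ) (x i) s
    set d := |dev μ (x i) s|
    have hd0 : 0 ≤ d := abs_nonneg _
    have e3 : c₀ / (2 * n) * ((n : ℝ)⁻¹ * d)
        + c₀ * ((n : ℝ)⁻¹ * d) * ((n : ℝ)⁻¹ * |devSum μ I x s| + (n : ℝ)⁻¹ * d / 2)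
        = c₀ * (n : ℝ)⁻¹ ^ 2 * (d * |devSum μ I x s|) + c₀ * (n : ℝ)⁻¹ ^ 2 * ((d + d * d) / 2) := by
      field_simp; ring
    rw [e3]
    -- As `d ≤ 1`, the Riemann-sum increment and the quadratic self-term of the observation merge
    -- into one `totalDev` term.
    have h2 : (d + d * d) / 2 ≤ d := by nlinarith
    gcongr
  have k1 := integrable_remIntegrand (n := n) hJ he he0 hX Finset.univ x
  have k2 := integrable_remIntegrand (n := n) hJ he he0 hX I x
  rw [remainder, remainder, ← integral_sub k1 k2]
  refine abs_integral_le_integral_abs.trans ((integral_mono (k1.sub k2).abs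
    ((i1.const_mul _).add (i2.const_mul _)) hpt).trans (le_of_eq ?_))
  simp only [Pi.add_apply]
  rw [integral_add (i1.const_mul _) (i2.const_mul _), integral_const_mul, integral_const_mul]
  rfl

lemma memLp_remainder_sub (hn4 : 4 ≤ n) (i : Fin n) :
    MemLp (fun x => remainder μ J e Finset.univ x - remainder μ J e (Finset.univ.erase i) x) 2
      (iid (Fin n) μ) ∧
    √(∫ x, (remainder μ J e Finset.univ x - remainder μ J e (Finset.univ.erase i) x) ^ 2
      ∂iid (Fin n) μ) ≤ √2 * (c₀ * √(∫ x, x ^ 2 ∂μ) / n) / √n := by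
  have hn0 : (0 : ℝ) < n := by exact_mod_cast hn
  have h0 := lipschitz_const_nonneg hJ
  obtain ⟨h1, h2⟩ := integral_abs_dev_mul_devSum_le hX (Finset.notMem_erase i Finset.univ)
  set M := √(∫ x, x ^ 2 ∂μ) with hM
  have hM0 : 0 ≤ M := Real.sqrt_nonneg _
  have hB : MemLp (fun x : Fin n → ℝ => totalDev μ (x i)) 2 (iid (Fin n) μ) :=
    memLp_eval (memLp_totalDev hX) i
  have hB2 : √(∫ x : Fin n → ℝ, totalDev μ (x i) ^ 2 ∂iid (Fin n) μ) ≤ √2 * M := by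
    rw [integral_eval (φ := fun a => totalDev μ a ^ 2) (measurable_totalDev.pow_const 2), hM,
      ← Real.sqrt_mul (by norm_num)]
    exact Real.sqrt_le_sqrt (integral_sq_totalDev_le hX)
  have k := memLp_and_sqrt_le_of_abs_le_add
    ((measurable_remainder (n := n) (μ := μ) hJ he Finset.univ).sub
      (measurable_remainder hJ he (Finset.univ.erase i))).aestronglyMeasurable
    (h1.const_mul (c₀ * (n : ℝ)⁻¹ ^ 2)) (hB.const_mul (c₀ * (n : ℝ)⁻¹ ^ 2))
    (le_of_eq (sqrt_integral_const_mul_sq (by positivity) _))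
    (le_of_eq (sqrt_integral_const_mul_sq (by positivity) _))
    (abs_remainder_sub_le hX hJ he he0 hn i)
  refine ⟨k.1, k.2.trans ?_⟩
  have a1 := mul_le_mul_of_nonneg_left h2 (show 0 ≤ c₀ * (n : ℝ)⁻¹ ^ 2 by positivity)
  have a2 := mul_le_mul_of_nonneg_left hB2 (show 0 ≤ c₀ * (n : ℝ)⁻¹ ^ 2 by positivity)
  refine (add_le_add a1 a2).trans ?_
  -- The condition `n ≥ 4` enters here: `√n ≥ 2` makes each of the two terms at most half of the
  -- right side.
  have hs : √(((Finset.univ.erase i).card : ℝ) / 2) + √2 ≤ √2 * √n := by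
    have b1 : √(((Finset.univ.erase i).card : ℝ) / 2) ≤ √2 * √n / 2 := by
      refine Real.sqrt_le_iff.2 ⟨by positivity, ?_⟩
      rw [div_pow, mul_pow, Real.sq_sqrt (by norm_num), Real.sq_sqrt hn0.le]
      have : ((Finset.univ.erase i).card : ℝ) ≤ n := by
        exact_mod_cast (Finset.card_le_univ _).trans (by simp)
      linarith
    have b2 : (2 : ℝ) ≤ √n := Real.le_sqrt_of_sq_le (by norm_num; exact_mod_cast hn4)
    have b3 := mul_le_mul_of_nonneg_left b2 (Real.sqrt_nonneg 2)
    linarith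
  calc c₀ * (n : ℝ)⁻¹ ^ 2 * (√(((Finset.univ.erase i).card : ℝ) / 2) * M)
      + c₀ * (n : ℝ)⁻¹ ^ 2 * (√2 * M)
      = c₀ * (n : ℝ)⁻¹ ^ 2 * M * (√(((Finset.univ.erase i).card : ℝ) / 2) + √2) := by ring
    _ ≤ c₀ * (n : ℝ)⁻¹ ^ 2 * M * (√2 * √n) := by gcongr
    _ = √2 * (c₀ * M / n) * (√n / n) := by ring
    _ = _ := by rw [Real.sqrt_div_self]; ring

lemma smallRemainder (hn4 : 4 ≤ n) {σ : ℝ} (hσ : 0 < σ) :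
    SmallRemainder (Fin n) μ (fun x => √n * σ⁻¹ * remainder μ J e Finset.univ x)
      (fun i x => √n * σ⁻¹ * remainder μ J e (Finset.univ.erase i) x)
      (c₀ * √(∫ x, x ^ 2 ∂μ) / (√n * σ)) := by
  have hn0 : (0 : ℝ) < n := by exact_mod_cast hn
  have hr : 0 ≤ √n * σ⁻¹ := by positivity
  obtain ⟨h1, h2⟩ := memLp_remainder hX hJ he he0 hn
  have hnn : (n : ℝ) = √n * √n := (Real.mul_self_sqrt hn0.le).symm
  have hsn : 0 < √(n : ℝ) := by positivity
  refine ⟨(measurable_remainder hJ he _).const_mul _, h1.const_mul _,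
    fun i => (measurable_remainder hJ he _).const_mul _, fun i => ?_, fun i x y hxy => ?_, ?_,
    fun i => ?_⟩
  · obtain ⟨h3, -⟩ := memLp_remainder_sub hX hJ he he0 hn hn4 i
    have h4 := h1.sub h3
    refine MemLp.const_mul (f := remainder μ J e (Finset.univ.erase i)) ?_ _
    convert h4 using 1
    ext x; simp
  · have : remainder μ J e (Finset.univ.erase i) x = remainder μ J e (Finset.univ.erase i) y :=
      dependsOn_remainder hJ he (Finset.univ.erase i) fun j hj => hxy j (by simpa using hj)
    simp only [this]
  · rw [sqrt_integral_const_mul_sq hr]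
    refine (mul_le_mul_of_nonneg_left h2 hr).trans (le_of_eq ?_)
    nth_rewrite 2 [hnn]
    field_simp
  · obtain ⟨-, h3⟩ := memLp_remainder_sub hX hJ he he0 hn hn4 i
    simp only [← mul_sub]
    rw [sqrt_integral_const_mul_sq hr, Fintype.card_fin]
    refine (mul_le_mul_of_nonneg_left h3 hr).trans (le_of_eq ?_)
    nth_rewrite 2 [hnn]
    field_simp

end

/-! ### Absence of ties and the normalized influence function -/

section

variable {μ : Measure ℝ} [IsProbabilityMeasure μ]

/-- A sample from a continuous distribution has no ties. -/
lemma ae_injective {ι : Type*} [Fintype ι] (hc : Continuous (cdf μ)) :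
    ∀ᵐ x ∂iid ι μ, Function.Injective x := by
  have hpair : ∀ i j : ι, i ≠ j → ∀ᵐ x ∂iid ι μ, x i ≠ x j := by
    intro i j hij
    have hind : IndepFun (fun x : ι → ℝ => x i) (fun x => x j) (iid ι μ) :=
      indepFun_of_dependsOn (measurable_pi_apply i) (measurable_pi_apply j) (dependsOn_eval id i)
        (dependsOn_eval id j) (by simpa using hij)
    have hmap := hind.map_prod_eq_prod_map_map (measurable_pi_apply i).aemeasurable
      (measurable_pi_apply j).aemeasurable
    rw [(measurePreserving_eval (fun _ : ι => μ) i).map_eq,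
      (measurePreserving_eval (fun _ : ι => μ) j).map_eq] at hmap
    have hset : MeasurableSet {q : ℝ × ℝ | q.1 = q.2} :=
      measurableSet_eq_fun measurable_fst measurable_snd
    have h0 : (μ.prod μ) {q : ℝ × ℝ | q.1 = q.2} = 0 := by
      rw [Measure.measure_prod_null hset]
      refine ae_of_all _ fun a => ?_
      have : Prod.mk a ⁻¹' {q : ℝ × ℝ | q.1 = q.2} = {a} := by
        ext b; simp [eq_comm]
      change μ (Prod.mk a ⁻¹' {q : ℝ × ℝ | q.1 = q.2}) = 0
      rw [this]
      exact measure_singleton_eq_zero hc a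
    rw [← hmap, Measure.map_apply ((measurable_pi_apply i).prodMk (measurable_pi_apply j)) hset] at h0
    exact measure_eq_zero_iff_ae_notMem.1 h0
  have hall : ∀ᵐ x ∂iid ι μ, ∀ i j : ι, i ≠ j → x i ≠ x j := by
    rw [ae_all_iff]; intro i
    rw [ae_all_iff]; intro j
    by_cases hij : i = j
    · exact ae_of_all _ fun x h => absurd hij h
    · filter_upwards [hpair i j hij] with x hx _ using hx
  filter_upwards [hall] with x hx i j hij
  by_contra hne
  exact hx i j hne hij

lemma g_eq (J : ℝ → ℝ) (x : ℝ) : g J (cdf μ) x = ∫ s, dev μ x s * J (cdf μ s) := rfl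

/-- The influence function, normalized. -/
lemma normalized_influence {n : ℕ} (hn : 0 < n) (hX : MemLp (fun x : ℝ => x) 2 μ) {J : ℝ → ℝ}
    {c p : ℝ} (hJm : Measurable J) (hJc : ∀ t, |J t| ≤ c) (hp : 2 < p) (hp' : p ≤ 3)
    (hg : Integrable (fun x => |g J (cdf μ) x| ^ p) μ) (hσ : 0 < sigmaSq J (cdf μ)) :
    Normalized (Fin n) μ (fun x => -((√n * sigma J (cdf μ))⁻¹ * g J (cdf μ) x)) p ∧
    lyap (Fin n) μ (fun x => -((√n * sigma J (cdf μ))⁻¹ * g J (cdf μ) x)) p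
      = (∫ x, |g J (cdf μ) x| ^ p ∂μ) / ((n : ℝ) ^ ((p - 2) / 2) * sigma J (cdf μ) ^ p) := by
  have hn0 : (0 : ℝ) < n := by exact_mod_cast hn
  have hkm : Measurable fun s => J (cdf μ s) := hJm.comp measurable_cdf
  have hkc : ∀ s, |J (cdf μ s)| ≤ c := fun s => hJc _
  set σ := sigma J (cdf μ) with hσd
  have hσ0 : 0 < σ := Real.sqrt_pos.2 hσ
  have hσ2 : σ ^ 2 = sigmaSq J (cdf μ) := Real.sq_sqrt hσ.le
  have hgL : MemLp (g J (cdf μ)) 2 μ := memLp_integral_dev_mul hX hkm hkc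
  have hgm : Measurable (g J (cdf μ)) := measurable_integral_dev_mul hkm
  have hg0 : ∫ x, g J (cdf μ) x ∂μ = 0 := integral_integral_dev_mul hX hkm hkc
  -- The variance formula for linear functionals of the empirical process, with weight `J ∘ F`, is
  -- precisely the double integral defining `σ²`.
  have hg2 : ∫ x, g J (cdf μ) x ^ 2 ∂μ = σ ^ 2 := by
    obtain ⟨i1, e1⟩ := integral_sq_integral_dev_mul hX hkm hkc
    rw [hσ2, sigmaSq]
    simp only [g_eq]
    rw [e1, integral_prod _ i1]
    simp only [bridge, mul_assoc]
  have hr : 0 < √n * σ := by positivity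
  have habs : ∀ x, |(-((√n * σ)⁻¹ * g J (cdf μ) x))| ^ p
      = ((√n * σ) ^ p)⁻¹ * |g J (cdf μ) x| ^ p := fun x => by
    rw [abs_neg, abs_mul, abs_of_pos (inv_pos.2 hr), Real.mul_rpow (by positivity) (abs_nonneg _),
      Real.inv_rpow hr.le]
  refine ⟨⟨(hgm.const_mul _).neg, (hgL.const_mul _).neg, ?_, ?_, ?_, hp, hp'⟩, ?_⟩
  · rw [integral_neg, integral_const_mul, hg0]; simp
  · simp only [neg_sq, mul_pow]
    rw [integral_const_mul, hg2, Fintype.card_fin, inv_pow, mul_pow, Real.sq_sqrt hn0.le]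
    field_simp
  · simp only [habs]; exact hg.const_mul _
  · rw [lyap]
    simp only [habs]
    rw [integral_const_mul, Fintype.card_fin, Real.mul_rpow (by positivity) hσ0.le]
    have e1 : √(n : ℝ) ^ p = n * (n : ℝ) ^ ((p - 2) / 2) := by
      rw [Real.sqrt_eq_rpow, ← Real.rpow_mul hn0.le]
      nth_rewrite 2 [← Real.rpow_one (n : ℝ)]
      rw [← Real.rpow_add hn0]
      congr 1; ring
    rw [e1]
    have : 0 < (n : ℝ) ^ ((p - 2) / 2) := by positivity
    have : 0 < σ ^ p := by positivity
    field_simp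

end

/-! ### Extension of `J` beyond the unit interval -/

section Clip

/-- The restriction of `J` to the unit interval, extended by constants. -/
noncomputable def clip (J : ℝ → ℝ) (t : ℝ) : ℝ := J (max 0 (min 1 t))

lemma clip_of_mem {J : ℝ → ℝ} {t : ℝ} (h0 : 0 ≤ t) (h1 : t ≤ 1) : clip J t = J t := by
  rw [clip, min_eq_right h1, max_eq_right h0]

variable {J : ℝ → ℝ} {c₀ : ℝ}
  (hJ : ∀ s ∈ Icc (0 : ℝ) 1, ∀ t ∈ Icc (0 : ℝ) 1, |J t - J s| ≤ c₀ * |t - s|)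
include hJ

lemma clip_const_nonneg : 0 ≤ c₀ := by
  have := hJ 0 (by simp) 1 (by simp)
  simp only [sub_zero, abs_one, mul_one] at this
  exact (abs_nonneg _).trans this

lemma abs_clip_sub_le (s t : ℝ) : |clip J t - clip J s| ≤ c₀ * |t - s| := by
  have hm : ∀ t : ℝ, max 0 (min 1 t) ∈ Icc (0 : ℝ) 1 := fun t =>
    ⟨le_max_left _ _, max_le zero_le_one (min_le_left _ _)⟩
  refine (hJ _ (hm s) _ (hm t)).trans (mul_le_mul_of_nonneg_left ?_ (clip_const_nonneg hJ))
  refine (abs_max_sub_max_le_max _ _ _ _).trans (max_le (by simp) ?_)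
  exact (abs_min_sub_min_le_max _ _ _ _).trans (max_le (by simp) le_rfl)

lemma abs_clip_le (t : ℝ) : |clip J t| ≤ |J 0| + c₀ := by
  have hm : max 0 (min 1 t) ∈ Icc (0 : ℝ) 1 :=
    ⟨le_max_left _ _, max_le zero_le_one (min_le_left _ _)⟩
  have h1 := hJ 0 (by simp) _ hm
  have h2 : c₀ * |max 0 (min 1 t) - 0| ≤ c₀ := by
    refine mul_le_of_le_one_right (clip_const_nonneg hJ) ?_
    rw [sub_zero, abs_of_nonneg hm.1]; exact hm.2
  have h3 := abs_sub_abs_le_abs_sub (J (max 0 (min 1 t))) (J 0)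
  rw [clip]
  linarith

end Clip

end LStat

/-! ### The two bounds for the L-statistic -/

theorem theorem3p3 :
    ∃ C : ℝ, ∀ {Ω : Type*} [MeasurableSpace Ω] (P : Measure Ω) [IsProbabilityMeasure P]
      (n : ℕ) (_hn : 4 ≤ n)
      -- `X₁, …, Xₙ` are i.i.d. with common law `μ` and common distribution function `cdf μ`
      (X : Fin n → Ω → ℝ) (μ : Measure ℝ) [IsProbabilityMeasure μ]
      (_hlaw : ∀ i, HasLaw (X i) μ P) (_hindep : iIndepFun X P)
      (_hcont : Continuous (cdf μ))
      (J : ℝ → ℝ) (c₀ : ℝ)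
      (_hJ : ∀ s ∈ Icc (0 : ℝ) 1, ∀ t ∈ Icc (0 : ℝ) 1, |J t - J s| ≤ c₀ * |t - s|)
      (p : ℝ) (_hp : 2 < p) (_hp' : p ≤ 3)
      (_hX2 : Integrable (fun x => x ^ 2) μ)
      (_hg : Integrable (fun x => |LStat.g J (cdf μ) x| ^ p) μ)
      (_hσ : 0 < LStat.sigmaSq J (cdf μ)),
      (⨆ z : ℝ, |LStat.standardizedCDF P X J (cdf μ) z - LStat.Phi z|) ≤
          (1 + Real.sqrt 2) * c₀ * Real.sqrt (∫ x, x ^ 2 ∂μ)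
              / (Real.sqrt n * LStat.sigma J (cdf μ))
            + 6.1 * (∫ x, |LStat.g J (cdf μ) x| ^ p ∂μ)
              / ((n : ℝ) ^ ((p - 2) / 2) * LStat.sigma J (cdf μ) ^ p) ∧
      ∀ z : ℝ, |LStat.standardizedCDF P X J (cdf μ) z - LStat.Phi z| ≤
          9 * c₀ ^ 2 * (∫ x, x ^ 2 ∂μ)
              / ((1 + |z|) ^ 2 * n * LStat.sigma J (cdf μ) ^ 2)
            + C / (1 + |z|) ^ p *
              (c₀ * Real.sqrt (∫ x, x ^ 2 ∂μ) / (Real.sqrt n * LStat.sigma J (cdf μ))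
                + (∫ x, |LStat.g J (cdf μ) x| ^ p ∂μ)
                  / ((n : ℝ) ^ ((p - 2) / 2) * LStat.sigma J (cdf μ) ^ p)) := by
  -- The scale `128` of the nonuniform bound appears to the power `p ≤ 3`.
  refine ⟨LStat.nonuniformC * 128 ^ 3, ?_⟩
  intro Ω _ P _ n hn X μ _ hlaw hindep hcont J c₀ hJ p hp hp' hX2 hg hσ
  have hn0 : 0 < n := by omega
  have hnr : (0 : ℝ) < n := by exact_mod_cast hn0
  have hX : MemLp (fun x : ℝ => x) 2 μ :=
    (memLp_two_iff_integrable_sq measurable_id.aestronglyMeasurable).2 hX2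
  -- Only values of `J` on `[0, 1]` enter, so `J` may be replaced by an extension that is bounded
  -- and Lipschitz on the whole line.
  have hF : ∀ s, LStat.clip J (cdf μ s) = J (cdf μ s) := fun s =>
    LStat.clip_of_mem (cdf_nonneg μ s) (cdf_le_one μ s)
  have hgK : LStat.g J (cdf μ) = LStat.g (LStat.clip J) (cdf μ) := by
    funext x; simp only [LStat.g, hF]
  have hsK : LStat.sigmaSq J (cdf μ) = LStat.sigmaSq (LStat.clip J) (cdf μ) := by
    simp only [LStat.sigmaSq, hF]
  have hσK : LStat.sigma J (cdf μ) = LStat.sigma (LStat.clip J) (cdf μ) := by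
    simp only [LStat.sigma, hsK]
  have hTK : LStat.T J (cdf μ) = LStat.T (LStat.clip J) (cdf μ) := by
    simp only [LStat.T, hF]
  have hTnK : ∀ x : Fin n → ℝ, LStat.T J (LStat.empiricalCDF x)
      = LStat.T (LStat.clip J) (LStat.empiricalCDF x) := fun x => by
    simp only [LStat.T, LStat.clip_of_mem (LStat.empiricalCDF_nonneg x _)
      (LStat.empiricalCDF_le_one x _)]
  have hK := LStat.abs_clip_sub_le hJ
  have hKc := LStat.abs_clip_le hJ
  have hKm := (LStat.continuous_of_lipschitz hK).measurable
  obtain ⟨e, he, hgrid⟩ := LStat.exists_gridError hK hn0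
  have he0 : e 0 = 0 := by
    have := hgrid 0
    simpa [LStat.prim] using this
  set σ := LStat.sigma J (cdf μ) with hσd
  have hσ0 : 0 < σ := Real.sqrt_pos.2 hσ
  obtain ⟨hN, hL⟩ := LStat.normalized_influence hn0 hX hKm hKc hp hp' (hgK ▸ hg) (hsK ▸ hσ)
  have hR := LStat.smallRemainder hX hK he he0 hn0 hn hσ0
  rw [← hσK] at hN hL
  rw [← hgK] at hN hL
  set φ : ℝ → ℝ := fun x => -((√n * σ)⁻¹ * LStat.g J (cdf μ) x) with hφ
  set Δ : (Fin n → ℝ) → ℝ := fun x => √n * σ⁻¹ * LStat.remainder μ (LStat.clip J) e Finset.univ x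
  set M := √(∫ x, x ^ 2 ∂μ) with hM
  set η := c₀ * M / (√n * σ) with hη
  set L := (∫ x, |LStat.g J (cdf μ) x| ^ p ∂μ) / ((n : ℝ) ^ ((p - 2) / 2) * σ ^ p) with hLd
  have hXm : ∀ i, AEMeasurable (X i) P := fun i => (hlaw i).aemeasurable
  have hmap : P.map (fun ω i => X i ω) = LStat.iid (Fin n) μ := by
    rw [(iIndepFun_iff_map_fun_eq_pi_map hXm).1 hindep]
    simp only [(hlaw _).map_eq]
  have hXv : AEMeasurable (fun ω i => X i ω) P := aemeasurable_pi_lambda _ hXm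
  have hcdf : ∀ z, LStat.standardizedCDF P X J (cdf μ) z
      = (LStat.iid (Fin n) μ).real {x | ∑ i, φ (x i) + Δ x ≤ z} := fun z => by
    have hset : MeasurableSet {x : Fin n → ℝ | ∑ i, φ (x i) + Δ x ≤ z} :=
      measurableSet_le (hN.measurable_total hR.measurable) measurable_const
    rw [← hmap, measureReal_def, Measure.map_apply_of_aemeasurable hXv hset, ← measureReal_def,
      LStat.standardizedCDF]
    refine measureReal_congr ?_
    -- The linearization is an identity only for samples without ties, hence almost surely, which
    -- suffices for equality of probabilities.
    have hinj : ∀ᵐ ω ∂P, Function.Injective fun i => X i ω := by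
      have h1 := LStat.ae_injective (ι := Fin n) hcont
      rw [← hmap] at h1
      exact ae_of_ae_map hXv h1
    filter_upwards [hinj] with ω hω
    refine propext ?_
    change √n * σ⁻¹ * (LStat.T J (LStat.empiricalCDF fun i => X i ω) - LStat.T J (cdf μ)) ≤ z
      ↔ ∑ i, φ (X i ω) + Δ (fun i => X i ω) ≤ z
    have h2 := LStat.T_sub_eq hK he he0 hn0 hcont hX hKc hgrid hω
    rw [← hTnK, ← hTK, ← hgK] at h2
    have h3 : √n * σ⁻¹ * (LStat.T J (LStat.empiricalCDF fun i => X i ω) - LStat.T J (cdf μ))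
        = ∑ i, φ (X i ω) + Δ (fun i => X i ω) := by
      rw [h2, mul_add]
      congr 1
      simp only [hφ, Finset.sum_neg_distrib, ← Finset.mul_sum]
      have hsn : 0 < √(n : ℝ) := by positivity
      have hnn : (n : ℝ) = √n * √n := (Real.mul_self_sqrt hnr.le).symm
      nth_rewrite 2 [hnn]
      field_simp
    rw [h3]
  refine ⟨?_, fun z => ?_⟩
  · refine ciSup_le fun z => ?_
    rw [hcdf]
    refine (hN.berry_esseen_remainder hR z).trans (le_of_eq ?_)
    rw [hL, hη, hLd]
    ring
  · rw [hcdf]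
    refine (hN.nonuniform_berry_esseen_remainder hR (by simpa using hn) z).trans ?_
    rw [hL]
    have hz : 0 < 1 + |z| := by positivity
    have hη0 : 0 ≤ η := hR.nonneg
    have hL0 : 0 ≤ L := hL ▸ LStat.lyap_nonneg
    have e1 : 9 * η ^ 2 / (1 + |z|) ^ 2
        = 9 * c₀ ^ 2 * (∫ x, x ^ 2 ∂μ) / ((1 + |z|) ^ 2 * n * σ ^ 2) := by
      rw [hη, div_pow, mul_pow, mul_pow, Real.sq_sqrt hnr.le, hM,
        Real.sq_sqrt (integral_nonneg fun x => sq_nonneg x)]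
      field_simp
    have e2 : ((1 + |z|) / 128) ^ (-p) ≤ 128 ^ 3 / (1 + |z|) ^ p := by
      rw [Real.rpow_neg (by positivity), Real.div_rpow hz.le (by norm_num), inv_div]
      have : (128 : ℝ) ^ p ≤ 128 ^ 3 := by
        rw [← Real.rpow_natCast]
        exact Real.rpow_le_rpow_of_exponent_le (by norm_num) (by push_cast; exact hp')
      gcongr
    rw [e1]
    have hC : 0 ≤ LStat.nonuniformC := by linarith [LStat.nonuniformC_ge]
    refine add_le_add le_rfl ?_
    calc LStat.nonuniformC * ((η + L) * ((1 + |z|) / 128) ^ (-p))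
        ≤ LStat.nonuniformC * ((η + L) * (128 ^ 3 / (1 + |z|) ^ p)) := by gcongr
      _ = LStat.nonuniformC * 128 ^ 3 / (1 + |z|) ^ p * (η + L) := by ring
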